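/- **Setting.** Let $A=\mathbb C[[\varpi]]$ and $F=\mathbb C((\varpi))$. Let $S$ be a commutative $A$-algebra with a finite $A$-basis $(s_u)_{1\le u\le e}$ such that $S_{\mathbb C}=S/\varpi S$ is a local ring, and put $S_F=F\otimes_A S$. Let $V_A$ be a free $S$-module with basis $(e_r)_{1\le r\le d}$, put $V_F=F\otimes_A V_A$ and $e_{ru}=e_rs_u$, so that $(e_{ru})$ is an $A$-basis of $V_A$. A function with values in $V_A$, $V_F$, $\mathrm{End}_S(V_A)$ or $\mathrm{End}_{S_F}(V_F)$ is called holomorphic if it is a series $\sum_{n\ge N}a_n\varpi^n$, with $N\in\mathbb Z$ fixed ($N=0$ for values in $V_A$ or $\mathrm{End}_S(V_A)$), whose coefficients $a_n$ are holomorphic; that is, the coefficients of $\varpi^n$ of its coordinates in the given bases are holomorphic functions. Such functions are differentiated coefficient by coefficient. Let $I$ be a finite set, $R_j\in(0,\infty]$ for $j\in I$, and $U=\{z\in\mathbb C^I:\ |z_j|<R_j\ \text{for all } j\}$ (so $U=\mathbb C^I$ if all $R_j=\infty$). For $j\in I$ let $A_j:U\to\mathrm{End}_S(V_A)$ be holomorphic,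 and assume that the connection $\nabla=d-\sum_jA_j\,dz_j/z_j$ is integrable, that is, $z_i\partial_{z_i}A_j-z_j\partial_{z_j}A_i=[A_i,A_j]$ on $U$ for all $i,j\in I$. Let $\Omega=\{\zeta\in\mathbb C^I:\ (e^{\zeta_j})_{j}\in U\}$ be the universal cover of $\{z\in U:\ \prod_jz_j\ne0\}$, with $z_j=e^{\zeta_j}$. Let $V_A^\nabla$ be the $A$-module of horizontal sections, i.e. of holomorphic $g:\Omega\to V_A$ with $\partial_{\zeta_j}g=A_jg$ for all $j$. Assume that $A_j(0)\,e_r=e_rm_{rj}$ with $m_{rj}\in S$, and that $k+m_{rj}-m_{tj}$ is invertible in $S_F$ for all $r,t\in\{1,\dots,d\}$, all $j\in I$ and all integers $k\ne0$. Let $\mu_{rj}$ be the image of $m_{rj}$ in the residue field of $S$ (which is also that of $S_{\mathbb C}$, and equals $\mathbb C$), and write $\mu_t>\mu_r$ if the differences $\mu_{tj}-\mu_{rj}$ $(j\in I)$ are all non-negative integers and are not all zero. Let $z^{A_0}$ be the $S$-linear map with $z^{A_0}e_r=e_r\exp\bigl(\sum_j\zeta_jm_{rj}\bigr)$, the exponential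 series being taken in $S$ with convergence coefficient by coefficient. **Proposition.** There is a unique holomorphic $H:U\to\mathrm{End}_{S_F}(V_F)$ with $H(0)=\mathrm{Id}$ such that $G=Hz^{A_0}$ satisfies $\partial_{\zeta_j}G=A_jG$ on $\Omega$ for all $j\in I$. Put $f_{ru}=Ge_{ru}$. Then $V_A^\nabla$ has an $A$-basis $(b_{ru})_{1\le r\le d,\,1\le u\le e}$ (in particular it is free of rank $de$) such that, for all $r,u$, $$b_{ru}\in f_{ru}+\sum_{t:\ \mu_t>\mu_r}\ \sum_{v=1}^{e}f_{tv}F .$$ -/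

import Mathlib

/-!
Setting.  `A = ℂ⟦X⟧` and `F = ℂ⸨X⸩` (the variable `X` is the formal parameter `ϖ`); `S` is a
commutative `A`-algebra with a finite `A`-basis `s : Basis (Fin e) A S`; `S_F = F ⊗_A S`; the free
`S`-module of rank `d` with basis `(e_r)` is `Fin d → S`, so that its `S`-linear endomorphisms are
the matrices `Matrix (Fin d) (Fin d) S`, and `e_{ru} = s_u e_r` is `Pi.single r (s u)`.
-/

namespace FormalConnection

open PowerSeries LaurentSeries TensorProduct

noncomputable section

/-- The generic fibre `S_F = F ⊗_A S`. -/
abbrev GenericFibre (S : Type*) [CommRing S] [Algebra ℂ⟦X⟧ S] : Type _ := ℂ⸨X⸩ ⊗[ℂ⟦X⟧] S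

/-- The special fibre `S_ℂ = ℂ ⊗_A S = S / ϖ S`. -/
abbrev SpecialFibre (S : Type*) [CommRing S] [Algebra ℂ⟦X⟧ S] : Type _ :=
  S ⧸ Ideal.span {algebraMap ℂ⟦X⟧ S PowerSeries.X}

/-- The canonical map `S → S_F`. -/
def toGeneric (S : Type*) [CommRing S] [Algebra ℂ⟦X⟧ S] : S →+* GenericFibre S :=
  (Algebra.TensorProduct.includeRight : S →ₐ[ℂ⟦X⟧] GenericFibre S).toRingHom

/-- The map from `S` to its residue field, through the local ring `S_ℂ`. -/
def residueMap (S : Type*) [CommRing S] [Algebra ℂ⟦X⟧ S] [IsLocalRing (SpecialFibre S)] :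
    S →+* IsLocalRing.ResidueField (SpecialFibre S) :=
  (IsLocalRing.residue (SpecialFibre S)).comp (Ideal.Quotient.mk _)

section Coefficients

variable {S : Type*} [CommRing S] [Algebra ℂ⟦X⟧ S] {e : ℕ} (s : Module.Basis (Fin e) ℂ⟦X⟧ S)

/-- The coefficient of `ϖ ^ n` in the `u`-th coordinate of an element of `S`. -/
def coeffA (u : Fin e) (n : ℕ) (x : S) : ℂ := PowerSeries.coeff n (s.repr x u)

/-- The coefficient of `ϖ ^ n` in the `u`-th coordinate of an element of `S_F`. -/
def coeffF (u : Fin e) (n : ℤ) (x : GenericFibre S) : ℂ := ((s.baseChange ℂ⸨X⸩).repr x u).coeff n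

/-- The exponential `∑ₖ xᵏ / k!` in `S`, for the topology of coefficientwise convergence (the
series converges absolutely in every coefficient, for every `x`). -/
def expS (x : S) : S :=
  s.equivFun.symm fun u => PowerSeries.mk fun n =>
    ∑' k : ℕ, coeffA s u n (x ^ k) / (k.factorial : ℂ)

end Coefficients

section Domains

variable {I : Type*}

/-- The open polydisc of polyradius `R` (each radius may be infinite) around `0`. -/
def polydisc (R : I → ENNReal) : Set (I → ℂ) := {z | ∀ j, ‖z j‖ₑ < R j}

/-- The coordinates `z_j = exp ζ_j`. -/
def expMap (ζ : I → ℂ) : I → ℂ := fun j => Complex.exp (ζ j)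

/-- The universal cover of `{z ∈ polydisc R | ∏ z_j ≠ 0}`, in the coordinates `ζ_j = log z_j`. -/
def logCover (R : I → ENNReal) : Set (I → ℂ) := {ζ | expMap ζ ∈ polydisc R}

/-- The covector `∑ⱼ aⱼ dζⱼ`, where `dζⱼ = dzⱼ / zⱼ`. -/
def dlogForm [Fintype I] (a : I → ℂ) : (I → ℂ) →L[ℂ] ℂ :=
  ∑ j, a j • ContinuousLinearMap.proj (R := ℂ) (φ := fun _ : I => ℂ) j

theorem dlogForm_apply [Fintype I] (a v : I → ℂ) : dlogForm a v = ∑ j, a j * v j := by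
  simp [dlogForm]

end Domains

section Connection

variable {I : Type*} [Fintype I] {S : Type*} [CommRing S] [Algebra ℂ⟦X⟧ S] {d e : ℕ}
  (s : Module.Basis (Fin e) ℂ⟦X⟧ S)

/-- Holomorphic functions with values in `End(V_A)`: every coefficient is holomorphic. -/
def IsHolomorphicA (U : Set (I → ℂ)) (B : (I → ℂ) → Matrix (Fin d) (Fin d) S) : Prop :=
  ∀ (r t : Fin d) (u : Fin e) (n : ℕ), DifferentiableOn ℂ (fun z => coeffA s u n (B z r t)) U

/-- Holomorphic functions with values in `End(V_F)`: a series `∑_{n ≥ N} a_n ϖ ^ n` whose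
coefficients `a_n` are holomorphic, with one bound `N` for the whole domain. -/
def IsHolomorphicF (U : Set (I → ℂ)) (H : (I → ℂ) → Matrix (Fin d) (Fin d) (GenericFibre S)) :
    Prop :=
  (∀ (r t : Fin d) (u : Fin e) (n : ℤ), DifferentiableOn ℂ (fun z => coeffF s u n (H z r t)) U) ∧
    ∃ N : ℤ, ∀ z ∈ U, ∀ (r t : Fin d) (u : Fin e) (n : ℤ), n < N → coeffF s u n (H z r t) = 0

/-- Flatness of `∇ = d - ∑ⱼ Aⱼ dzⱼ / zⱼ` on `U`, coefficient by coefficient: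
`zᵢ ∂Aⱼ/∂zᵢ - zⱼ ∂Aᵢ/∂zⱼ = Aᵢ Aⱼ - Aⱼ Aᵢ`. -/
def IsIntegrable [DecidableEq I] (U : Set (I → ℂ))
    (A : I → (I → ℂ) → Matrix (Fin d) (Fin d) S) : Prop :=
  ∀ (i j : I), ∀ z ∈ U, ∀ (r t : Fin d) (u : Fin e) (n : ℕ),
    z i * fderiv ℂ (fun w => coeffA s u n (A j w r t)) z (Pi.single i 1)
      - z j * fderiv ℂ (fun w => coeffA s u n (A i w r t)) z (Pi.single j 1)
      = coeffA s u n ((A i z * A j z - A j z * A i z) r t)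

/-- The space `V_A^∇` of horizontal sections: holomorphic `V_A`-valued functions `g` on the
universal cover with `dg = ∑ⱼ Aⱼ g dζⱼ`, where `dζⱼ = dzⱼ / zⱼ`.  A function on the cover is
represented by its extension by zero to all of `I → ℂ`. -/
def horizontalSections (R : I → ENNReal) (A : I → (I → ℂ) → Matrix (Fin d) (Fin d) S) :
    Submodule ℂ⟦X⟧ ((I → ℂ) → Fin d → S) where
  carrier := {g | (∀ ζ ∉ logCover R, g ζ = 0) ∧
    ∀ ζ ∈ logCover R, ∀ (r : Fin d) (u : Fin e) (n : ℕ),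
      HasFDerivAt (𝕜 := ℂ) (fun ξ => coeffA s u n (g ξ r))
        (dlogForm fun j => coeffA s u n ((A j (expMap ζ)).mulVec (g ζ) r)) ζ}
  zero_mem' := by
    refine ⟨fun _ _ => rfl, fun ζ _ r u n => ?_⟩
    have h0 : (fun ξ : I → ℂ => coeffA s u n ((0 : (I → ℂ) → Fin d → S) ξ r)) = fun _ => 0 := by
      funext ξ
      simp [coeffA]
    rw [h0]
    refine (hasFDerivAt_const (𝕜 := ℂ) (0 : ℂ) ζ).congr_fderiv ?_
    ext v
    simp [dlogForm_apply, coeffA]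
  add_mem' := by
    rintro g h ⟨hg0, hg⟩ ⟨hh0, hh⟩
    refine ⟨fun ζ hζ => by simp [hg0 ζ hζ, hh0 ζ hζ], fun ζ hζ r u n => ?_⟩
    have h1 : (fun ξ => coeffA s u n ((g + h) ξ r)) =
        fun ξ => coeffA s u n (g ξ r) + coeffA s u n (h ξ r) := by
      funext ξ
      simp [coeffA]
    rw [h1]
    refine ((hg ζ hζ r u n).fun_add (hh ζ hζ r u n)).congr_fderiv ?_
    ext v
    rw [add_apply, dlogForm_apply, dlogForm_apply, dlogForm_apply,
      ← Finset.sum_add_distrib]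
    refine Finset.sum_congr rfl fun j _ => ?_
    rw [Pi.add_apply, Matrix.mulVec_add, ← add_mul]
    simp [coeffA]
  smul_mem' := by
    rintro p g ⟨hg0, hg⟩
    refine ⟨fun ζ hζ => by simp [hg0 ζ hζ], fun ζ hζ r u n => ?_⟩
    have h1 : (fun ξ => coeffA s u n ((p • g) ξ r)) =
        fun ξ => ∑ k ∈ Finset.HasAntidiagonal.antidiagonal n,
          PowerSeries.coeff k.1 p * coeffA s u k.2 (g ξ r) := by
      funext ξ
      simp [coeffA, PowerSeries.coeff_mul]
    rw [h1]
    refine (HasFDerivAt.fun_sum fun k _ =>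
      (hg ζ hζ r u k.2).const_mul (PowerSeries.coeff k.1 p)).congr_fderiv ?_
    ext v
    simp only [sum_apply, smul_apply, dlogForm_apply,
      Finset.smul_sum]
    rw [Finset.sum_comm]
    refine Finset.sum_congr rfl fun j _ => ?_
    rw [Pi.smul_apply, Matrix.mulVec_smul]
    simp [coeffA, PowerSeries.coeff_mul, Finset.sum_mul, mul_assoc]

/-- `z ^ {m_r} = ∏ⱼ zⱼ ^ {m_{rj}} = exp (∑ⱼ ζⱼ m_{rj})`. -/
def zPow (m : Fin d → I → S) (r : Fin d) (ζ : I → ℂ) : S :=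
  expS s (∑ j, algebraMap ℂ⟦X⟧ S (PowerSeries.C (ζ j)) * m r j)

/-- `G = H z ^ {A_0}`, where `A_{j0}` is the diagonal matrix with entries `m_{rj}`. -/
def fundamentalMatrix (m : Fin d → I → S)
    (H : (I → ℂ) → Matrix (Fin d) (Fin d) (GenericFibre S)) (ζ : I → ℂ) :
    Matrix (Fin d) (Fin d) (GenericFibre S) :=
  H (expMap ζ) * Matrix.diagonal fun r => toGeneric S (zPow s m r ζ)

/-- `G = H z ^ {A_0}` is a normalized fundamental solution: `H` is holomorphic on the polydisc,
`H(0) = Id`, and `dG = ∑ⱼ Aⱼ G dζⱼ` on the universal cover. -/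
structure IsNormalizedSolution (R : I → ENNReal) (A : I → (I → ℂ) → Matrix (Fin d) (Fin d) S)
    (m : Fin d → I → S) (H : (I → ℂ) → Matrix (Fin d) (Fin d) (GenericFibre S)) : Prop where
  holomorphic : IsHolomorphicF s (polydisc R) H
  map_zero : H 0 = 1
  horizontal : ∀ ζ ∈ logCover R, ∀ (r t : Fin d) (u : Fin e) (n : ℤ),
    HasFDerivAt (𝕜 := ℂ) (fun ξ => coeffF s u n (fundamentalMatrix s m H ξ r t))
      (dlogForm fun j => coeffF s u n
        (((A j (expMap ζ)).map (toGeneric S) * fundamentalMatrix s m H ζ) r t)) ζ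

/-- `f_{ru} = G e_{ru}`. -/
def fundamentalSection (m : Fin d → I → S)
    (H : (I → ℂ) → Matrix (Fin d) (Fin d) (GenericFibre S)) (r : Fin d) (u : Fin e)
    (ζ : I → ℂ) : Fin d → GenericFibre S :=
  (fundamentalMatrix s m H ζ).mulVec (Pi.single r (toGeneric S (s u)))

/-- `μ_r < μ_t`, where `μ_{rj}` is the residue of `m_{rj}`: the difference `μ_t - μ_r` is a nonzero
family of natural numbers. -/
def ExponentLT [IsLocalRing (SpecialFibre S)] (m : Fin d → I → S) (r t : Fin d) : Prop :=
  ∃ β : I → ℕ, β ≠ 0 ∧ ∀ j, residueMap S (m t j) - residueMap S (m r j) = β j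

end Connection

end

end FormalConnection

/-!
The proof is the Frobenius method, arranged so that the factors `ϖ ^ (-n)` it produces are confined
to a matrix that can be moved into the constants.

All analytic objects are expanded in power series in `z`, coefficient by coefficient in `ϖ`
(`HasExpM`); horizontality of `H z ^ {A_0}` becomes the vanishing of `formalConn` on the expansion
of `H` (`hasDlog_of_formalConn_eq_zero`, `formalConn_eq_zero_of_hasDlog`).  Over `S_F`, where all
`k + m_{rj} - m_{tj}` with `k ≠ 0` are invertible, the resulting recursion on multi-indices has
exactly one solution `H` with constant term `1` (`exists_formal_solution`,
`eq_zero_of_formalConn_eq_zero`), which gives uniqueness.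

For existence and for the basis, `H` is factored as `P Z` (`exists_resonant_factorization`): an
entry `(r, t)` of a coefficient of degree `α` is resonant if `μ_r - μ_t = α`, and `Z` collects the
resonant entries.  The gauge transform `B` of the connection by `P` is again resonant.  In a
nonresonant degree some `α_j - m_{rj} + m_{tj}` is nonzero in the residue field, hence invertible in
`S`, because `S` is local (`isUnit_of_residueMap_ne_zero`); in a resonant degree `P` vanishes by
choice.  By induction `P` and `B` are therefore defined over `S` (`exists_normal_form`).  There are
only finitely many resonant degrees, so `B` and `Z` are polynomials in `z` and `Z` has a bounded
denominator `ϖ ^ N`.  A majorant argument shows that `P` and its inverse, being solutions of linear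
systems with logarithmic poles, converge on the whole polydisc (`isConvergent_of_euler`).

Finally fix a base point `ζ₀` of the cover.  There `Z` is unitriangular for the order on the
exponents, so it has an inverse `Q'` of the same shape (`exists_unitriangular_inverse`).  The matrix
`M = z ^ {-A_0} Q' z ^ {A_0}` at `ζ₀` is also unitriangular, and `H z ^ {A_0} M` takes at `ζ₀` the
value `P z ^ {A_0}`, an invertible matrix over `S`.  A horizontal section whose coefficients of
order at most `n` vanish at one point has all of them zero everywhere
(`coeffA_eq_zero_of_horizontal`); applied to the negative powers of `ϖ` this shows that the columns
of `H z ^ {A_0} M` have values in `V_A` (`exists_horizontal_quotient`), and applied to differences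
of sections it shows that they form a basis (`exists_basis_horizontalSections`).

The ring `S_F` is used only through the map from `S`, the elements `ϖ ^ (-N)` and the coefficient
functions; these are collected in the structure `LaurentExtension`.
-/

namespace FormalConnection

open PowerSeries LaurentSeries TensorProduct

noncomputable section

/-! ### Power series expansions on polydiscs -/

/-- A circle integral of a jointly holomorphic function is holomorphic in the other variables. -/
theorem differentiableOn_circleIntegral {n : ℕ} {U : Set ℂ} {V : Set (Fin n → ℂ)} (hU : IsOpen U)
    (hV : IsOpen V) {g : ℂ × (Fin n → ℂ) → ℂ} (hg : DifferentiableOn ℂ g (U ×ˢ V)) {σ : ℝ}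
    (hσ : 0 ≤ σ) (hσU : Metric.sphere (0 : ℂ) σ ⊆ U) {h : ℂ → ℂ}
    (hh : ContinuousOn h (Metric.sphere 0 σ)) :
    DifferentiableOn ℂ (fun x => ∮ w in C(0, σ), h w * g (w, x)) V := by
  intro x₀ hx₀
  refine DifferentiableAt.differentiableWithinAt ?_
  obtain ⟨ε, hε, hεV⟩ : ∃ ε > 0, Metric.closedBall x₀ (2 * ε) ⊆ V := by
    obtain ⟨δ, hδ, hδV⟩ := Metric.nhds_basis_closedBall.mem_iff.1 (hV.mem_nhds hx₀)
    exact ⟨δ / 2, by positivity, by rwa [mul_div_cancel₀ _ two_ne_zero]⟩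
  have hK : IsCompact (Metric.sphere (0 : ℂ) σ ×ˢ Metric.closedBall x₀ (2 * ε)) :=
    (isCompact_sphere _ _).prod (isCompact_closedBall _ _)
  obtain ⟨M, hM⟩ := hK.exists_bound_of_continuousOn
    (hg.continuousOn.mono (Set.prod_mono hσU hεV))
  obtain ⟨C, hC⟩ := (isCompact_sphere (0 : ℂ) σ).exists_bound_of_continuousOn hh
  have hcm : ∀ θ, circleMap 0 σ θ ∈ Metric.sphere (0 : ℂ) σ := circleMap_mem_sphere 0 hσ
  have hgd : ∀ w ∈ Metric.sphere (0 : ℂ) σ, ∀ x ∈ V, HasFDerivAt (fun y => g (w, y))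
      ((fderiv ℂ g (w, x)).comp (ContinuousLinearMap.inr ℂ ℂ (Fin n → ℂ))) x := fun w hw x hx =>
    ((hg.differentiableAt ((hU.prod hV).mem_nhds ⟨hσU hw, hx⟩)).hasFDerivAt).comp x
      (hasFDerivAt_prodMk_right w x)
  have hcont : ∀ x ∈ V, Continuous fun θ : ℝ => deriv (circleMap 0 σ) θ •
      (h (circleMap 0 σ θ) * g (circleMap 0 σ θ, x)) := by
    intro x hx
    have h1 : Continuous fun θ : ℝ => h (circleMap 0 σ θ) :=
      hh.comp_continuous (continuous_circleMap 0 σ) hcm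
    have h2 : Continuous fun θ : ℝ => g (circleMap 0 σ θ, x) :=
      hg.continuousOn.comp_continuous ((continuous_circleMap 0 σ).prodMk continuous_const)
        fun θ => ⟨hσU (hcm θ), hx⟩
    have h3 : Continuous fun θ : ℝ => deriv (circleMap 0 σ) θ := by
      simp only [deriv_circleMap]
      exact (continuous_circleMap 0 σ).mul continuous_const
    exact h3.smul (h1.mul h2)
  have hball : ∀ x ∈ Metric.ball x₀ ε, x ∈ V := fun x hx =>
    hεV (Metric.ball_subset_closedBall (Metric.ball_subset_ball (by linarith) hx))
  unfold circleIntegral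
  simp only [intervalIntegral.integral_of_le Real.two_pi_pos.le]
  refine HasFDerivAt.differentiableAt (𝕜 := ℂ)
    (hasFDerivAt_integral_of_dominated_of_fderiv_le
    (F' := fun x θ => deriv (circleMap 0 σ) θ • h (circleMap 0 σ θ) •
      (fderiv ℂ g (circleMap 0 σ θ, x)).comp (ContinuousLinearMap.inr ℂ ℂ (Fin n → ℂ)))
    (bound := fun _ => σ * (C * (2 * M / ε)))
    (Metric.ball_mem_nhds x₀ hε) ?_ ?_ ?_ ?_ ?_ ?_)
  · filter_upwards [Metric.ball_mem_nhds x₀ hε] with x hx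
    exact (hcont x (hball x hx)).aestronglyMeasurable
  · exact ((hcont x₀ hx₀).integrableOn_Icc).mono_set Set.Ioc_subset_Icc_self
  · have h3 : Continuous fun θ : ℝ => deriv (circleMap 0 σ) θ := by
      simp only [deriv_circleMap]
      exact (continuous_circleMap 0 σ).mul continuous_const
    have h1 : Continuous fun θ : ℝ => h (circleMap 0 σ θ) :=
      hh.comp_continuous (continuous_circleMap 0 σ) hcm
    have : ProperSpace (ℂ × (Fin n → ℂ) →L[ℂ] ℂ) := FiniteDimensional.proper ℂ _
    have h2 : MeasureTheory.AEStronglyMeasurable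
        (fun θ : ℝ => fderiv ℂ g (circleMap 0 σ θ, x₀))
        (MeasureTheory.volume.restrict (Set.Ioc 0 (2 * Real.pi))) :=
      ((measurable_fderiv ℂ g).comp
        ((continuous_circleMap 0 σ).prodMk continuous_const).measurable).aestronglyMeasurable
    have h4 := (ContinuousLinearMap.precomp ℂ
      (ContinuousLinearMap.inr ℂ ℂ (Fin n → ℂ))).continuous.comp_aestronglyMeasurable h2
    exact h3.aestronglyMeasurable.smul (h1.aestronglyMeasurable.smul h4)
  · refine Filter.Eventually.of_forall fun θ x hx => ?_
    have hw := hcm θ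
    have hd : ‖(fderiv ℂ g (circleMap 0 σ θ, x)).comp
        (ContinuousLinearMap.inr ℂ ℂ (Fin n → ℂ))‖ ≤ 2 * M / ε := by
      rw [← (hgd _ hw x (hball x hx)).fderiv]
      have hsub : Metric.ball x ε ⊆ Metric.closedBall x₀ (2 * ε) := fun y hy => by
        have := dist_triangle y x x₀
        rw [Metric.mem_ball] at hx hy
        rw [Metric.mem_closedBall]
        linarith
      refine Complex.norm_fderiv_le_div_of_mapsTo_ball
        (fun y hy => ((hgd _ hw y (hεV (hsub hy))).differentiableAt).differentiableWithinAt)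
        (fun y hy => ?_) hε
      rw [mem_closedBall_iff_norm]
      have h1 := hM (circleMap 0 σ θ, y) ⟨hw, hsub hy⟩
      have h2 := hM (circleMap 0 σ θ, x) ⟨hw, hsub (Metric.mem_ball_self hε)⟩
      exact (norm_sub_le _ _).trans (by linarith)
    rw [norm_smul, norm_smul]
    have h1 : ‖deriv (circleMap 0 σ) θ‖ = σ := by
      simp [deriv_circleMap, abs_of_nonneg hσ]
    rw [h1]
    have hC' := hC _ hw
    have : 0 ≤ C := (norm_nonneg _).trans hC'
    gcongr
  · exact MeasureTheory.integrable_const _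
  · refine Filter.Eventually.of_forall fun θ x hx => ?_
    exact ((hgd _ (hcm θ) x (hball x hx)).const_mul _).fun_const_smul _

theorem summable_prod_pow : ∀ {n : ℕ} (t : Fin n → ℝ), (∀ j, 0 ≤ t j) → (∀ j, t j < 1) →
    Summable fun α : Fin n → ℕ => ∏ j, t j ^ α j
  | 0, t, _, _ => (hasSum_fintype _).summable
  | n + 1, t, h0, h1 => by
    rw [← (Fin.consEquiv fun _ : Fin (n + 1) => ℕ).summable_iff]
    have := (summable_geometric_of_lt_one (h0 0) (h1 0)).mul_of_nonneg
      (summable_prod_pow (fun j => t j.succ) (fun j => h0 _) fun j => h1 _)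
      (fun k => pow_nonneg (h0 0) k) (fun α => Finset.prod_nonneg fun j _ => pow_nonneg (h0 _) _)
    refine this.congr fun x => ?_
    simp [Fin.prod_univ_succ, Fin.consEquiv]

theorem isOpen_polydisc {I : Type*} [Finite I] (R : I → ENNReal) : IsOpen (polydisc R) := by
  have : polydisc R = ⋂ j, {z : I → ℂ | ‖z j‖ₑ < R j} := by
    ext z; simp [polydisc]
  rw [this]
  exact isOpen_iInter_of_finite fun j =>
    isOpen_lt (continuous_enorm.comp (continuous_apply j)) continuous_const

/-- Every radius below `R` can be enlarged to another real radius below `R`. -/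
theorem exists_radius {x : ℝ} (hx : 0 ≤ x) {R : ENNReal} (h : ENNReal.ofReal x < R) :
    ∃ ρ, x < ρ ∧ ENNReal.ofReal ρ < R := by
  obtain ⟨r, h1, h2⟩ := ENNReal.lt_iff_exists_nnreal_btwn.1 h
  refine ⟨r, ?_, by simpa using h2⟩
  rw [ENNReal.ofReal_lt_iff_lt_toReal hx ENNReal.coe_ne_top] at h1
  simpa using h1

theorem mem_polydisc_of_le {I : Type*} {R : I → ENNReal} {ρ : I → ℝ}
    (hρ : ∀ j, ENNReal.ofReal (ρ j) < R j) {z : I → ℂ} (hz : ∀ j, ‖z j‖ ≤ ρ j) :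
    z ∈ polydisc R := fun j => by
  rw [← ofReal_norm]
  exact (ENNReal.ofReal_le_ofReal (hz j)).trans_lt (hρ j)

theorem exists_bound_polydisc {I : Type*} [Fintype I] {R : I → ENNReal} {f : (I → ℂ) → ℂ}
    (hf : ContinuousOn f (polydisc R)) {ρ : I → ℝ} (hρ : ∀ j, ENNReal.ofReal (ρ j) < R j) :
    ∃ M, ∀ z : I → ℂ, (∀ j, ‖z j‖ ≤ ρ j) → ‖f z‖ ≤ M := by
  have hK : IsCompact (Set.pi Set.univ fun j => Metric.closedBall (0 : ℂ) (ρ j)) :=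
    isCompact_univ_pi fun j => isCompact_closedBall _ _
  obtain ⟨M, hM⟩ := hK.exists_bound_of_continuousOn (hf.mono fun z hz =>
    mem_polydisc_of_le hρ fun j => by simpa using hz j trivial)
  exact ⟨M, fun z hz => hM z fun j _ => by simpa using hz j⟩

/-- Coefficients that satisfy the Cauchy estimates on all smaller closed polydiscs define a series
that converges on the polydisc. -/
theorem hasSum_of_cauchy_estimate {n : ℕ} {R : Fin n → ENNReal} {f : (Fin n → ℂ) → ℂ}
    (hf : ContinuousOn f (polydisc R)) {p : (Fin n → ℕ) → ℂ}
    (hp : ∀ ρ : Fin n → ℝ, (∀ j, 0 < ρ j) → (∀ j, ENNReal.ofReal (ρ j) < R j) →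
        ∀ M, (∀ z : Fin n → ℂ, (∀ j, ‖z j‖ ≤ ρ j) → ‖f z‖ ≤ M) →
        ∀ α, ‖p α‖ * ∏ j, ρ j ^ α j ≤ M) {z : Fin n → ℂ} (hz : z ∈ polydisc R) :
    Summable fun α => p α * ∏ j, z j ^ α j := by
  have : ∀ j, ∃ ρ, ‖z j‖ < ρ ∧ ENNReal.ofReal ρ < R j := fun j =>
    exists_radius (norm_nonneg _) (by rw [ofReal_norm]; exact hz j)
  choose ρ h1 h2 using this
  have h0 : ∀ j, 0 < ρ j := fun j => (norm_nonneg _).trans_lt (h1 j)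
  obtain ⟨M, hM⟩ := exists_bound_polydisc hf h2
  refine Summable.of_norm_bounded ((summable_prod_pow (fun j => ‖z j‖ / ρ j)
    (fun j => div_nonneg (norm_nonneg _) (h0 j).le)
    (fun j => (div_lt_one (h0 j)).2 (h1 j))).mul_left M) fun α => ?_
  rw [norm_mul, norm_prod]
  have hpos : 0 < ∏ j, ρ j ^ α j := Finset.prod_pos fun j _ => pow_pos (h0 j) _
  have := hp ρ h0 h2 M hM α
  simp only [div_pow, Finset.prod_div_distrib, norm_pow]
  rw [← le_div_iff₀ hpos] at this
  calc _ ≤ M / (∏ j, ρ j ^ α j) * ∏ j, ‖z j‖ ^ α j := by gcongr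
    _ = _ := by ring

/-- Power series expansion on a polydisc, by induction on the number of variables: the Taylor
coefficients in the first variable are holomorphic in the other ones. The Cauchy estimates are
carried along to make the iterated series summable. -/
theorem exists_expansion_fin : ∀ (n : ℕ) (R : Fin n → ENNReal) (_ : ∀ j, 0 < R j)
    (f : (Fin n → ℂ) → ℂ) (_ : DifferentiableOn ℂ f (polydisc R)),
    ∃ p : (Fin n → ℕ) → ℂ,
      (∀ ρ : Fin n → ℝ, (∀ j, 0 < ρ j) → (∀ j, ENNReal.ofReal (ρ j) < R j) →
        ∀ M, (∀ z : Fin n → ℂ, (∀ j, ‖z j‖ ≤ ρ j) → ‖f z‖ ≤ M) →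
        ∀ α, ‖p α‖ * ∏ j, ρ j ^ α j ≤ M) ∧
      ∀ z ∈ polydisc R, HasSum (fun α => p α * ∏ j, z j ^ α j) (f z)
  | 0, R, _, f, _ => by
    refine ⟨fun _ => f 0, ?_, ?_⟩
    · intro ρ _ _ M h α
      simpa using h 0 (by simp)
    · intro z _
      rw [Subsingleton.elim z 0]
      simp
  | n + 1, R, hR, f, hf => by
    set R' : Fin n → ENNReal := fun j => R j.succ with hR'
    have hcons : ∀ w x, ‖w‖ₑ < R 0 → x ∈ polydisc R' →
        (Fin.cons w x : Fin (n + 1) → ℂ) ∈ polydisc R :=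
      fun w x hw hx j => by
        refine Fin.cases ?_ (fun j => ?_) j
        · simpa using hw
        · simpa using hx j
    -- the slices in the first variable
    have hslice : ∀ x ∈ polydisc R', DifferentiableOn ℂ (fun w => f (Fin.cons w x))
        (Metric.eball 0 (R 0)) := fun x hx => by
      refine hf.comp (fun w _ => DifferentiableAt.differentiableWithinAt ?_) fun w hw =>
        hcons w x (by simpa using hw) hx
      rw [differentiableAt_pi]
      intro j
      refine Fin.cases ?_ (fun j => ?_) j
      · simp
      · simp
    set c : ℕ → (Fin n → ℂ) → ℂ := fun k x =>
      (k.factorial : ℂ)⁻¹ * iteratedDeriv k (fun w => f (Fin.cons w x)) 0 with hc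
    have hball : ∀ σ : ℝ, 0 < σ → ENNReal.ofReal σ < R 0 →
        Metric.closedBall (0 : ℂ) σ ⊆ Metric.eball 0 (R 0) := fun σ hσ hσR w hw => by
      rw [mem_closedBall_zero_iff] at hw
      have := (ENNReal.ofReal_le_ofReal hw).trans_lt hσR
      rw [ofReal_norm] at this
      simpa using this
    have hcd : ∀ k, DifferentiableOn ℂ (c k) (polydisc R') := by
      intro k
      obtain ⟨σ, hσ, hσR⟩ := exists_radius le_rfl (R := R 0) (by simpa using hR 0)
      have h1 := differentiableOn_circleIntegral (g := fun q => f (Fin.cons q.1 q.2))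
        (U := Metric.eball 0 (R 0)) (V := polydisc R')
        Metric.isOpen_eball (isOpen_polydisc R') ?_ hσ.le
        (Metric.sphere_subset_closedBall.trans (hball σ hσ hσR))
        (h := fun w => (1 / w ^ (k + 1))) ?_
      · refine (h1.const_mul ((2 * Real.pi * Complex.I)⁻¹)).congr fun x hx => ?_
        have h2 := (DifferentiableOn.mono (hslice x hx)
          (hball σ hσ hσR)).circleIntegral_one_div_sub_center_pow_smul hσ k
        simp only [sub_zero, smul_eq_mul] at h2
        rw [h2, hc]
        have : (2 * Real.pi * Complex.I : ℂ) ≠ 0 := Complex.two_pi_I_ne_zero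
        field_simp
      · refine hf.comp (fun q _ => DifferentiableAt.differentiableWithinAt ?_) fun q hq =>
          hcons q.1 q.2 (by simpa using hq.1) hq.2
        rw [differentiableAt_pi]
        intro j
        refine Fin.cases ?_ (fun j => ?_) j
        · simp only [Fin.cons_zero]; fun_prop
        · simp only [Fin.cons_succ]; fun_prop
      · refine ContinuousOn.div continuousOn_const (by fun_prop) fun w hw => ?_
        refine pow_ne_zero _ ?_
        rintro rfl
        simp at hw
        exact hσ.ne hw
    have ih := fun k => exists_expansion_fin n R' (fun j => hR _) (c k) (hcd k)
    choose p hp1 hp2 using ih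
    have hest : ∀ ρ : Fin (n + 1) → ℝ, (∀ j, 0 < ρ j) → (∀ j, ENNReal.ofReal (ρ j) < R j) →
        ∀ M, (∀ z : Fin (n + 1) → ℂ, (∀ j, ‖z j‖ ≤ ρ j) → ‖f z‖ ≤ M) →
        ∀ α : Fin (n + 1) → ℕ, ‖p (α 0) (Fin.tail α)‖ * ∏ j, ρ j ^ α j ≤ M := by
      intro ρ h0 h1 M hM α
      have h2 := hp1 (α 0) (fun j => ρ j.succ) (fun j => h0 _) (fun j => h1 _)
        (M / ρ 0 ^ α 0) (fun x hx => ?_) (Fin.tail α)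
      · rw [Fin.prod_univ_succ]
        rw [le_div_iff₀ (pow_pos (h0 0) _)] at h2
        calc _ = _ := by
              simp only [Fin.tail]
              ring
          _ ≤ M := h2
      · have hx' : x ∈ polydisc R' := mem_polydisc_of_le (fun j => h1 _) hx
        have h3 := Complex.norm_iteratedDeriv_le_of_forall_mem_sphere_norm_le (α 0) (h0 0)
          (f := fun w => f (Fin.cons w x)) (c := 0) (C := M) ?_ ?_
        · rw [hc]
          simp only [norm_mul, norm_inv, Complex.norm_natCast]
          rw [inv_mul_le_iff₀ (by positivity)]
          calc _ ≤ _ := h3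
            _ = _ := by ring
        · refine (DifferentiableOn.mono (hslice x hx') ?_).diffContOnCl (𝕜 := ℂ)
          rw [closure_ball _ (h0 0).ne']
          exact hball _ (h0 0) (h1 0)
        · intro w hw
          refine hM _ fun j => ?_
          refine Fin.cases ?_ (fun j => ?_) j
          · simp only [Fin.cons_zero]
            simp at hw
            exact hw.le
          · simpa using hx j
    refine ⟨fun α => p (α 0) (Fin.tail α), hest, fun z hz => ?_⟩
    have hs := hasSum_of_cauchy_estimate hf.continuousOn hest hz
    have hz0 : z 0 ∈ Metric.eball (0 : ℂ) (R 0) := by simpa using hz 0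
    have hz' : Fin.tail z ∈ polydisc R' := fun j => hz j.succ
    have h1 : HasSum (fun k => c k (Fin.tail z) * z 0 ^ k) (f z) := by
      have := Complex.hasSum_taylorSeries_on_eball (hslice _ hz') hz0
      rw [Fin.cons_self_tail] at this
      convert! this using 2 with k
      simp only [hc, sub_zero, smul_eq_mul]
      ring
    have h2 := hs.hasSum
    rw [← (Fin.consEquiv fun _ : Fin (n + 1) => ℕ).hasSum_iff] at h2
    have h3 := h2.prod_fiberwise (g := fun k => c k (Fin.tail z) * z 0 ^ k) fun k => by
      have := (hp2 k _ hz').mul_right (z 0 ^ k)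
      convert! this using 2 with α
      simp [Fin.consEquiv, Fin.prod_univ_succ, Fin.tail]
      ring
    rw [h1.unique h3]
    exact hs.hasSum

/-! ### Expansions of holomorphic functions and the Euler operators -/

section Expansion

variable {I : Type*} [Fintype I] {R : I → ENNReal}

/-- The function `f` is the sum of the multivariate power series `p` on the polydisc. -/
def HasExpansion (R : I → ENNReal) (p : MvPowerSeries I ℂ) (f : (I → ℂ) → ℂ) : Prop :=
  ∀ z ∈ polydisc R, HasSum (fun α => MvPowerSeries.coeff α p * ∏ j, z j ^ α j) (f z)

theorem exists_hasExpansion (hR : ∀ j, 0 < R j) {f : (I → ℂ) → ℂ}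
    (hf : DifferentiableOn ℂ f (polydisc R)) : ∃ p, HasExpansion R p f := by
  let E := Fintype.equivFin I
  obtain ⟨p, -, hp⟩ := exists_expansion_fin (Fintype.card I) (fun k => R (E.symm k))
    (fun _ => hR _) (fun z => f fun j => z (E j)) (by
      refine hf.comp (by fun_prop) fun z hz j => ?_
      simpa using hz (E j))
  refine ⟨fun α => p fun k => α (E.symm k), fun z hz => ?_⟩
  have h := hp (fun k => z (E.symm k)) fun k => hz _
  have e : (fun j => (fun k => z (E.symm k)) (E j)) = z := by funext j; simp
  rw [e] at h
  rw [← ((Finsupp.equivFunOnFinite (α := I) (M := ℕ)).trans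
    (E.arrowCongr (Equiv.refl ℕ))).hasSum_iff] at h
  convert! h using 2 with α
  simp only [Function.comp_apply]
  congr 1
  exact Fintype.prod_equiv E _ _ (by simp [Equiv.arrowCongr])

theorem HasExpansion.eqOn {p : MvPowerSeries I ℂ} {f g : (I → ℂ) → ℂ} (h : HasExpansion R p f)
    (h' : HasExpansion R p g) : Set.EqOn f g (polydisc R) := fun z hz => (h z hz).unique (h' z hz)

theorem HasExpansion.add {p q : MvPowerSeries I ℂ} {f g : (I → ℂ) → ℂ} (hf : HasExpansion R p f)
    (hg : HasExpansion R q g) : HasExpansion R (p + q) fun z => f z + g z := fun z hz => by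
  convert! (hf z hz).add (hg z hz) using 2 with α
  simp [add_mul]

theorem HasExpansion.sub {p q : MvPowerSeries I ℂ} {f g : (I → ℂ) → ℂ} (hf : HasExpansion R p f)
    (hg : HasExpansion R q g) : HasExpansion R (p - q) fun z => f z - g z := fun z hz => by
  convert! (hf z hz).sub (hg z hz) using 2 with α
  simp [sub_mul]

theorem HasExpansion.const_mul {p : MvPowerSeries I ℂ} {f : (I → ℂ) → ℂ} (c : ℂ)
    (hf : HasExpansion R p f) : HasExpansion R (c • p) fun z => c * f z := fun z hz => by
  convert! (hf z hz).mul_left c using 2 with α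
  simp [mul_assoc]

theorem HasExpansion.sum {ι : Type*} {t : Finset ι} {p : ι → MvPowerSeries I ℂ}
    {f : ι → (I → ℂ) → ℂ} (h : ∀ i ∈ t, HasExpansion R (p i) (f i)) :
    HasExpansion R (∑ i ∈ t, p i) fun z => ∑ i ∈ t, f i z := fun z hz => by
  convert! hasSum_sum fun i hi => h i hi z hz using 2 with α
  simp [Finset.sum_mul]

theorem prod_pow_add (z : I → ℂ) (α β : I →₀ ℕ) :
    ∏ j, z j ^ (α + β) j = (∏ j, z j ^ α j) * ∏ j, z j ^ β j := by
  simp [pow_add, Finset.prod_mul_distrib]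

theorem HasExpansion.mul {p q : MvPowerSeries I ℂ} {f g : (I → ℂ) → ℂ} (hf : HasExpansion R p f)
    (hg : HasExpansion R q g) : HasExpansion R (p * q) fun z => f z * g z := fun z hz => by
  classical
  have h := ((hf z hz).summable.norm.mul_norm (hg z hz).summable.norm).of_norm
  have h1 := (hf z hz).mul (hg z hz) h
  have h2 := Finset.HasAntidiagonal.sigmaAntidiagonalEquivProd.hasSum_iff.2 h1
  have h3 := h2.sigma fun α => hasSum_fintype _
  convert! h3 using 2 with α
  rw [MvPowerSeries.coeff_mul, Finset.sum_mul, Finset.univ_eq_attach, ← Finset.sum_attach]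
  refine Finset.sum_congr rfl fun x _ => ?_
  simp only [Function.comp_apply, Finset.HasAntidiagonal.sigmaAntidiagonalEquivProd_apply]
  have e : ∏ j, z j ^ α j = (∏ j, z j ^ x.1.1 j) * ∏ j, z j ^ x.1.2 j := by
    rw [← prod_pow_add, Finset.HasAntidiagonal.mem_antidiagonal.1 x.2]
  rw [e]
  ring

/-- The growth of the derivative of a power is absorbed by a slightly larger radius. -/
theorem natCast_mul_pow_pred_le {x y : ℝ} (hx : 0 < x) (hxy : x < y) (k : ℕ) :
    k * x ^ (k - 1) ≤ y ^ k / (y - x) := by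
  rw [le_div_iff₀ (sub_pos.2 hxy)]
  rcases k with _ | k
  · simp
  have h := one_add_mul_le_pow (a := (y - x) / x)
    (by have : 0 < (y - x) / x := div_pos (sub_pos.2 hxy) hx
        linarith) (k + 1)
  have e : 1 + (y - x) / x = y / x := by field_simp; ring
  rw [e, div_pow, le_div_iff₀ (by positivity)] at h
  refine le_trans ?_ h
  have h1 : ((k + 1 : ℕ) : ℝ) * ((y - x) / x) * x ^ (k + 1) =
      (k + 1 : ℕ) * x ^ (k + 1 - 1) * (y - x) := by
    simp only [Nat.add_sub_cancel, pow_succ]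
    field_simp
  rw [add_mul, h1]
  have := pow_pos hx (k + 1)
  linarith

/-- The differential of the monomial `z ^ α`. -/
def monomialDeriv [DecidableEq I] (α : I →₀ ℕ) (z : I → ℂ) : (I → ℂ) →L[ℂ] ℂ :=
  ∑ j, (∏ i ∈ Finset.univ.erase j, z i ^ α i) •
    ((α j : ℂ) * z j ^ (α j - 1)) • ContinuousLinearMap.proj (R := ℂ) (φ := fun _ : I => ℂ) j

theorem hasFDerivAt_monomial [DecidableEq I] (α : I →₀ ℕ) (z : I → ℂ) :
    HasFDerivAt (fun w : I → ℂ => ∏ j, w j ^ α j) (monomialDeriv α z) z := by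
  refine HasFDerivAt.finsetProd fun j _ => ?_
  have h1 : HasFDerivAt (fun w : I → ℂ => w j)
    (ContinuousLinearMap.proj (R := ℂ) (φ := fun _ : I => ℂ) j) z :=
    (ContinuousLinearMap.proj (R := ℂ) (φ := fun _ : I => ℂ) j).hasFDerivAt
  have := h1.pow (α j)
  convert! this using 1
  simp

theorem mul_monomialDeriv_single [DecidableEq I] (α : I →₀ ℕ) (z : I → ℂ) (j : I) :
    z j * monomialDeriv α z (Pi.single j 1) = α j * ∏ i, z i ^ α i := by
  rw [monomialDeriv, sum_apply, Finset.sum_eq_single j]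
  · simp only [smul_apply, ContinuousLinearMap.proj_apply, Pi.single_eq_same, smul_eq_mul, mul_one]
    rw [← Finset.mul_prod_erase Finset.univ _ (Finset.mem_univ j)]
    rcases h : α j with _ | k
    · simp
    · simp only [Nat.add_sub_cancel, pow_succ]
      ring
  · intro i _ hi
    simp [Pi.single_eq_of_ne hi]
  · simp

theorem norm_monomialDeriv_le [DecidableEq I] {ρ ρ' : I → ℝ} (h0 : ∀ j, 0 < ρ j)
    (h1 : ∀ j, ρ j < ρ' j) (α : I →₀ ℕ) {z : I → ℂ} (hz : ∀ j, ‖z j‖ ≤ ρ j) :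
    ‖monomialDeriv α z‖ ≤ (∑ j, (ρ' j - ρ j)⁻¹) * ∏ j, ρ' j ^ α j := by
  rw [Finset.sum_mul]
  refine (norm_sum_le _ _).trans (Finset.sum_le_sum fun j _ => ?_)
  rw [norm_smul, norm_smul, norm_mul, norm_prod, Complex.norm_natCast, norm_pow]
  have hp : ‖ContinuousLinearMap.proj (R := ℂ) (φ := fun _ : I => ℂ) j‖ ≤ 1 :=
    ContinuousLinearMap.opNorm_le_bound _ zero_le_one fun w => by
      simpa using norm_le_pi_norm w j
  have h2 : ∏ i ∈ Finset.univ.erase j, ‖z i ^ α i‖ ≤ ∏ i ∈ Finset.univ.erase j, ρ' i ^ α i := by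
    refine Finset.prod_le_prod (fun _ _ => norm_nonneg _) fun i _ => ?_
    rw [norm_pow]
    exact pow_le_pow_left₀ (norm_nonneg _) ((hz i).trans (h1 i).le) _
  have h3 : (α j : ℝ) * ‖z j‖ ^ (α j - 1) ≤ (ρ' j - ρ j)⁻¹ * ρ' j ^ α j := by
    rw [inv_mul_eq_div]
    refine le_trans ?_ (natCast_mul_pow_pred_le (h0 j) (h1 j) (α j))
    gcongr
    exact hz j
  have h4 : 0 ≤ ∏ i ∈ Finset.univ.erase j, ρ' i ^ α i :=
    Finset.prod_nonneg fun i _ => pow_nonneg ((h0 i).trans (h1 i)).le _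
  have h5 : 0 ≤ (ρ' j - ρ j)⁻¹ * ρ' j ^ α j :=
    mul_nonneg (inv_nonneg.2 (sub_nonneg.2 (h1 j).le)) (pow_nonneg ((h0 j).trans (h1 j)).le _)
  calc _ ≤ (∏ i ∈ Finset.univ.erase j, ρ' i ^ α i) *
        (((ρ' j - ρ j)⁻¹ * ρ' j ^ α j) * 1) := by gcongr
    _ = (ρ' j - ρ j)⁻¹ * ∏ i, ρ' i ^ α i := by
      rw [← Finset.mul_prod_erase Finset.univ _ (Finset.mem_univ j)]
      ring

omit [Fintype I] in
theorem convex_polydisc_ofReal (ρ : I → ℝ) : Convex ℝ {z : I → ℂ | ∀ j, ‖z j‖ < ρ j} := by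
  have : {z : I → ℂ | ∀ j, ‖z j‖ < ρ j} = Set.pi Set.univ fun j => Metric.ball (0 : ℂ) (ρ j) := by
    ext z; simp
  rw [this]
  exact convex_pi fun j _ => convex_ball _ _

theorem isOpen_box (ρ : I → ℝ) : IsOpen {z : I → ℂ | ∀ j, ‖z j‖ < ρ j} := by
  have : {z : I → ℂ | ∀ j, ‖z j‖ < ρ j} = Set.pi Set.univ fun j => Metric.ball (0 : ℂ) (ρ j) := by
    ext z; simp
  rw [this]
  exact isOpen_set_pi Set.finite_univ fun j _ => Metric.isOpen_ball

/-- A power series can be differentiated term by term. -/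
theorem HasExpansion.hasFDerivAt [DecidableEq I] {p : MvPowerSeries I ℂ} {f : (I → ℂ) → ℂ}
    (hf : HasExpansion R p f) {z : I → ℂ} (hz : z ∈ polydisc R) :
    ∃ D : (I → ℂ) →L[ℂ] ℂ, HasFDerivAt f D z ∧
      HasSum (fun α => MvPowerSeries.coeff α p • monomialDeriv α z) D := by
  have : ∀ j, ∃ ρ, ‖z j‖ < ρ ∧ ENNReal.ofReal ρ < R j := fun j =>
    exists_radius (norm_nonneg _) (by rw [ofReal_norm]; exact hz j)
  choose ρ h1 h2 using this
  have h0 : ∀ j, 0 < ρ j := fun j => (norm_nonneg _).trans_lt (h1 j)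
  have : ∀ j, ∃ ρ', ρ j < ρ' ∧ ENNReal.ofReal ρ' < R j := fun j => exists_radius (h0 j).le (h2 j)
  choose ρ' h3 h4 using this
  have h0' : ∀ j, 0 < ρ' j := fun j => (h0 j).trans (h3 j)
  have hsub : ∀ w ∈ {w : I → ℂ | ∀ j, ‖w j‖ < ρ j}, w ∈ polydisc R := fun w hw =>
    mem_polydisc_of_le h2 fun j => (hw j).le
  have hsum : Summable fun α => ‖MvPowerSeries.coeff α p‖ *
      ((∑ j, (ρ' j - ρ j)⁻¹) * ∏ j, ρ' j ^ α j) := by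
    have := (hf (fun j => (ρ' j : ℂ)) (mem_polydisc_of_le h4 fun j => by
      simp [abs_of_pos (h0' j)])).summable.norm.mul_left (∑ j, (ρ' j - ρ j)⁻¹)
    refine this.congr fun α => ?_
    simp only [norm_mul, norm_prod, norm_pow, Complex.norm_real, Real.norm_eq_abs,
      abs_of_pos (h0' _)]
    ring
  have hb : ∀ α, ∀ w ∈ {w : I → ℂ | ∀ j, ‖w j‖ < ρ j},
      ‖MvPowerSeries.coeff α p • monomialDeriv α w‖ ≤ ‖MvPowerSeries.coeff α p‖ *
      ((∑ j, (ρ' j - ρ j)⁻¹) * ∏ j, ρ' j ^ α j) := fun α w hw => by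
    rw [norm_smul]
    gcongr
    exact norm_monomialDeriv_le h0 h3 α fun j => (hw j).le
  have hd := hasFDerivAt_tsum_of_isPreconnected (𝕜 := ℂ)
    (f := fun α (w : I → ℂ) => MvPowerSeries.coeff α p * ∏ j, w j ^ α j) hsum (isOpen_box ρ)
    (convex_polydisc_ofReal ρ).isPreconnected
    (fun α w _ => (hasFDerivAt_monomial α w).const_mul _) hb (x₀ := z) (x := z) h1
    (hf z hz).summable h1
  refine ⟨_, hd.congr_of_eventuallyEq ?_, ?_⟩
  · filter_upwards [(isOpen_box ρ).mem_nhds h1] with w hw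
    exact (hf w (hsub w hw)).tsum_eq.symm
  · exact (Summable.of_norm_bounded hsum fun α => hb α z h1).hasSum

theorem HasExpansion.differentiableOn {p : MvPowerSeries I ℂ} {f : (I → ℂ) → ℂ}
    (hf : HasExpansion R p f) : DifferentiableOn ℂ f (polydisc R) := fun z hz => by
  classical
  obtain ⟨D, hD, -⟩ := hf.hasFDerivAt hz
  exact hD.differentiableAt.differentiableWithinAt

end Expansion

section Euler

variable {I : Type*} {S : Type*}

/-- The logarithmic derivative `z_j ∂/∂z_j` of formal power series. -/
def euler [Semiring S] (j : I) (p : MvPowerSeries I S) : MvPowerSeries I S :=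
  fun α => α j • MvPowerSeries.coeff α p

theorem coeff_euler [Semiring S] (j : I) (p : MvPowerSeries I S) (α : I →₀ ℕ) :
    MvPowerSeries.coeff α (euler j p) = α j • MvPowerSeries.coeff α p := rfl

theorem euler_add [Semiring S] (j : I) (p q : MvPowerSeries I S) :
    euler j (p + q) = euler j p + euler j q := by
  ext α; simp [coeff_euler]

theorem euler_sub [Ring S] (j : I) (p q : MvPowerSeries I S) :
    euler j (p - q) = euler j p - euler j q := by
  ext α; simp [coeff_euler, smul_sub]

theorem euler_C [Semiring S] (j : I) (a : S) : euler j (MvPowerSeries.C (σ := I) a) = 0 := by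
  classical
  ext α
  rw [coeff_euler, MvPowerSeries.coeff_C]
  split_ifs with h <;> simp [h]

theorem euler_one [Semiring S] (j : I) : euler j (1 : MvPowerSeries I S) = 0 := by
  simpa using euler_C j (1 : S)

theorem euler_mul [Semiring S] (j : I) (p q : MvPowerSeries I S) :
    euler j (p * q) = euler j p * q + p * euler j q := by
  classical
  ext α
  rw [coeff_euler, map_add, MvPowerSeries.coeff_mul, MvPowerSeries.coeff_mul,
    MvPowerSeries.coeff_mul, ← Finset.sum_add_distrib, Finset.smul_sum]
  refine Finset.sum_congr rfl fun x hx => ?_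
  rw [← Finset.HasAntidiagonal.mem_antidiagonal.1 hx, coeff_euler, coeff_euler,
    Finsupp.add_apply, add_smul, smul_mul_assoc, mul_smul_comm]

theorem euler_comm [Semiring S] (i j : I) (p : MvPowerSeries I S) :
    euler i (euler j p) = euler j (euler i p) := by
  ext α
  simp only [coeff_euler]
  rw [smul_comm]

theorem euler_map {S' : Type*} [Semiring S] [Semiring S'] (φ : S →+* S') (j : I)
    (p : MvPowerSeries I S) :
    euler j (MvPowerSeries.map φ p) = MvPowerSeries.map φ (euler j p) := by
  ext α
  simp [coeff_euler, MvPowerSeries.coeff_map]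

end Euler

section Identity

variable {I : Type*} [Fintype I] {R : I → ENNReal}

/-- The function `z_j ∂f/∂z_j` has the expansion `euler j p`. -/
theorem HasExpansion.logDeriv [DecidableEq I] {p : MvPowerSeries I ℂ} {f : (I → ℂ) → ℂ}
    (hf : HasExpansion R p f) (j : I) :
    HasExpansion R (euler j p) fun z => z j * fderiv ℂ f z (Pi.single j 1) := fun z hz => by
  obtain ⟨D, hD, hs⟩ := hf.hasFDerivAt hz
  beta_reduce
  rw [hD.fderiv]
  have h := ((ContinuousLinearMap.apply ℂ ℂ (Pi.single j 1 : I → ℂ)).hasSum hs).mul_left (z j)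
  convert! h using 2 with α
  simp only [ContinuousLinearMap.apply_apply, smul_apply, smul_eq_mul]
  rw [mul_left_comm, mul_monomialDeriv_single, coeff_euler, nsmul_eq_mul]
  ring

/-- The identity theorem in one variable, with no information at the origin. -/
theorem eq_zero_of_hasSum_pow {a : ℕ → ℂ}
    (h : ∀ τ : ℂ, τ ≠ 0 → ‖τ‖ ≤ 1 → HasSum (fun n => a n * τ ^ n) 0) : a = 0 := by
  set g : ℂ → ℂ := fun τ => if τ = 0 then a 0 else 0 with hg
  have hp : HasFPowerSeriesAt g (FormalMultilinearSeries.ofScalars ℂ a) 0 := by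
    rw [hasFPowerSeriesAt_iff]
    filter_upwards [Metric.closedBall_mem_nhds (0 : ℂ) one_pos] with τ hτ
    rw [mem_closedBall_zero_iff] at hτ
    simp only [FormalMultilinearSeries.coeff_ofScalars, smul_eq_mul, zero_add, hg]
    split_ifs with h0
    · subst h0
      have := hasSum_single (f := fun n => (0 : ℂ) ^ n * a n) 0 fun n hn => by simp [hn]
      simpa using this
    · simpa [mul_comm] using h τ h0 hτ
  have h0 : g =ᶠ[nhds 0] 0 := by
    refine (hp.analyticAt.frequently_zero_iff_eventually_zero).1 ?_
    refine Filter.Eventually.frequently ?_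
    filter_upwards [self_mem_nhdsWithin] with τ hτ
    exact if_neg hτ
  have := hp.eq_zero_of_eventually h0
  funext n
  have h1 := congrArg (fun q => FormalMultilinearSeries.coeff q n) this
  rw [FormalMultilinearSeries.coeff_ofScalars] at h1
  rw [h1]
  rfl

/-- The identity theorem: a convergent power series whose sum vanishes off the coordinate
hyperplanes is zero. -/
theorem HasExpansion.eq_zero (hR : ∀ j, 0 < R j) {p : MvPowerSeries I ℂ} {f : (I → ℂ) → ℂ}
    (hf : HasExpansion R p f) (h0 : ∀ z ∈ polydisc R, (∀ j, z j ≠ 0) → f z = 0) : p = 0 := by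
  classical
  have hfin : ∀ k, Finite {α : I →₀ ℕ // Finsupp.degree α = k} := fun k => by
    refine Set.Finite.to_subtype ?_
    exact Finsupp.finite_of_degree_le k |>.subset fun α hα => le_of_eq hα
  have (k : ℕ) : Fintype {α : I →₀ ℕ // Finsupp.degree α = k} := Fintype.ofFinite _
  -- restricting to the line through `w` and `0` shows that every homogeneous part vanishes at `w`
  have hhom : ∀ w ∈ polydisc R, (∀ j, w j ≠ 0) → ∀ k,
      ∑ α : {α : I →₀ ℕ // Finsupp.degree α = k},
        MvPowerSeries.coeff α.1 p * ∏ j, w j ^ α.1 j = 0 := by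
    intro w hw hw0
    refine fun k => congrFun (eq_zero_of_hasSum_pow (a := fun k => ∑ α : {α : I →₀ ℕ //
      Finsupp.degree α = k}, MvPowerSeries.coeff α.1 p * ∏ j, w j ^ α.1 j) fun τ hτ hτ1 => ?_) k
    have hmem : (fun j => τ * w j) ∈ polydisc R := fun j => by
      refine lt_of_le_of_lt ?_ (hw j)
      rw [enorm_le_iff_norm_le, norm_mul]
      exact mul_le_of_le_one_left (norm_nonneg _) hτ1
    have h1 := hf _ hmem
    rw [h0 _ hmem fun j => mul_ne_zero hτ (hw0 j)] at h1
    rw [← (Equiv.sigmaFiberEquiv (Finsupp.degree : (I →₀ ℕ) → ℕ)).hasSum_iff] at h1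
    have h2 := h1.sigma fun k => hasSum_fintype _
    convert! h2 using 2 with k
    rw [Finset.sum_mul]
    refine Finset.sum_congr rfl fun α _ => ?_
    simp only [Function.comp_apply, Equiv.sigmaFiberEquiv_apply, mul_pow,
      Finset.prod_mul_distrib, Finset.prod_pow_eq_pow_sum]
    rw [← Finsupp.degree_eq_sum, α.2]
    ring
  ext α
  set k := Finsupp.degree α
  set q : MvPolynomial I ℂ := ∑ β : {β : I →₀ ℕ // Finsupp.degree β = k},
    MvPolynomial.monomial β.1 (MvPowerSeries.coeff β.1 p) with hq
  have hq0 : q = 0 := by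
    refine MvPolynomial.funext_set (fun j => {w : ℂ | ‖w‖ₑ < R j ∧ w ≠ 0}) (fun j => ?_)
      fun w hw => ?_
    · obtain ⟨r, hr, hrR⟩ := exists_radius le_rfl (R := R j) (by simpa using hR j)
      refine ((Set.Ioo_infinite hr).image (Complex.ofReal_injective.injOn)).mono ?_
      rintro _ ⟨x, hx, rfl⟩
      refine ⟨?_, by simpa using hx.1.ne'⟩
      rw [← ofReal_norm]
      refine lt_of_le_of_lt (ENNReal.ofReal_le_ofReal ?_) hrR
      simp [abs_of_pos hx.1, hx.2.le]
    · rw [map_zero, hq, map_sum, ← hhom w (fun j => (hw j trivial).1) (fun j => (hw j trivial).2) k]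
      refine Finset.sum_congr rfl fun β _ => ?_
      rw [MvPolynomial.eval_monomial, Finsupp.prod_fintype _ _ (by simp)]
  have := congrArg (MvPolynomial.coeff α) hq0
  rw [hq, MvPolynomial.coeff_sum, Finset.sum_eq_single ⟨α, rfl⟩] at this
  · simpa using this
  · intro β _ hβ
    rw [MvPolynomial.coeff_monomial, if_neg fun h => hβ (Subtype.ext h)]
  · simp

end Identity

/-! ### Functions with values in `S` -/

section CoefficientLemmas

variable {S : Type*} [CommRing S] [Algebra ℂ⟦X⟧ S] {e : ℕ} (s : Module.Basis (Fin e) ℂ⟦X⟧ S)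

theorem coeffA_zero (u : Fin e) (n : ℕ) : coeffA s u n 0 = 0 := by simp [coeffA]

theorem coeffA_add (u : Fin e) (n : ℕ) (x y : S) :
    coeffA s u n (x + y) = coeffA s u n x + coeffA s u n y := by simp [coeffA]

theorem coeffA_sub (u : Fin e) (n : ℕ) (x y : S) :
    coeffA s u n (x - y) = coeffA s u n x - coeffA s u n y := by simp [coeffA]

theorem coeffA_sum (u : Fin e) (n : ℕ) {ι : Type*} (t : Finset ι) (x : ι → S) :
    coeffA s u n (∑ i ∈ t, x i) = ∑ i ∈ t, coeffA s u n (x i) := by simp [coeffA]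

theorem coeffA_nsmul (u : Fin e) (n k : ℕ) (x : S) :
    coeffA s u n (k • x) = k * coeffA s u n x := by
  rw [coeffA, map_nsmul, Finsupp.smul_apply, map_nsmul, nsmul_eq_mul, coeffA]

theorem coeffA_C_smul (u : Fin e) (n : ℕ) (c : ℂ) (x : S) :
    coeffA s u n ((PowerSeries.C c : ℂ⟦X⟧) • x) = c * coeffA s u n x := by
  simp [coeffA]

theorem coeffA_ext {x y : S} (h : ∀ u n, coeffA s u n x = coeffA s u n y) : x = y := by
  refine s.ext_elem fun u => PowerSeries.ext fun n => h u n

/-- The coefficients of a product are bilinear in those of the factors, with finitely many terms;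
all analytic statements on products in `S` reduce to `ℂ` through this formula. -/
theorem coeffA_mul (w : Fin e) (n : ℕ) (x y : S) :
    coeffA s w n (x * y) = ∑ u, ∑ v, ∑ p ∈ Finset.HasAntidiagonal.antidiagonal n,
      ∑ q ∈ Finset.HasAntidiagonal.antidiagonal p.1,
        coeffA s u q.1 x * coeffA s v q.2 y * coeffA s w p.2 (s u * s v) := by
  have h : x * y = ∑ u, ∑ v, (s.repr x u * s.repr y v) • (s u * s v) := by
    conv_lhs => rw [← s.sum_repr x, ← s.sum_repr y]
    rw [Finset.sum_mul_sum]
    simp only [smul_mul_smul_comm]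
  rw [h]
  simp only [coeffA_sum]
  refine Finset.sum_congr rfl fun u _ => Finset.sum_congr rfl fun v _ => ?_
  simp [coeffA, PowerSeries.coeff_mul, Finset.sum_mul]

/-- The element of `S` with given coefficients. -/
def ofCoeffs (c : Fin e → ℕ → ℂ) : S := s.equivFun.symm fun u => PowerSeries.mk (c u)

theorem coeffA_ofCoeffs (c : Fin e → ℕ → ℂ) (u : Fin e) (n : ℕ) :
    coeffA s u n (ofCoeffs s c) = c u n := by
  simp only [coeffA, ofCoeffs, ← Module.Basis.equivFun_apply, LinearEquiv.apply_symm_apply,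
    PowerSeries.coeff_mk]

/-- The sum of the absolute values of the coefficients of order at most `n`. -/
def truncNorm (n : ℕ) (x : S) : ℝ := ∑ u, ∑ k ∈ Finset.range (n + 1), ‖coeffA s u k x‖

theorem truncNorm_nonneg (n : ℕ) (x : S) : 0 ≤ truncNorm s n x :=
  Finset.sum_nonneg fun _ _ => Finset.sum_nonneg fun _ _ => norm_nonneg _

theorem norm_coeffA_le {n k : ℕ} (h : k ≤ n) (u : Fin e) (x : S) :
    ‖coeffA s u k x‖ ≤ truncNorm s n x := by
  have h1 : ‖coeffA s u k x‖ ≤ ∑ k ∈ Finset.range (n + 1), ‖coeffA s u k x‖ :=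
    Finset.single_le_sum (f := fun k => ‖coeffA s u k x‖) (fun _ _ => norm_nonneg _)
      (Finset.mem_range.2 (Nat.lt_succ_of_le h))
  refine h1.trans ?_
  exact Finset.single_le_sum (f := fun u => ∑ k ∈ Finset.range (n + 1), ‖coeffA s u k x‖)
    (fun _ _ => by positivity) (Finset.mem_univ u)

theorem truncNorm_zero (n : ℕ) : truncNorm s n 0 = 0 := by simp [truncNorm, coeffA_zero]

theorem truncNorm_sum_le (n : ℕ) {ι : Type*} (t : Finset ι) (x : ι → S) :
    truncNorm s n (∑ i ∈ t, x i) ≤ ∑ i ∈ t, truncNorm s n (x i) := by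
  simp only [truncNorm, coeffA_sum]
  conv_rhs => rw [Finset.sum_comm]
  refine Finset.sum_le_sum fun u _ => ?_
  conv_rhs => rw [Finset.sum_comm]
  exact Finset.sum_le_sum fun k _ => norm_sum_le _ _

theorem truncNorm_C_smul (n : ℕ) (c : ℂ) (x : S) :
    truncNorm s n ((PowerSeries.C c : ℂ⟦X⟧) • x) = ‖c‖ * truncNorm s n x := by
  simp only [truncNorm, coeffA_C_smul, norm_mul, Finset.mul_sum]

theorem truncNorm_nsmul (n k : ℕ) (x : S) :
    truncNorm s n (k • x) = k * truncNorm s n x := by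
  simp only [truncNorm, coeffA_nsmul, norm_mul, Finset.mul_sum, Complex.norm_natCast]

theorem truncNorm_sub_le (n : ℕ) (x y : S) :
    truncNorm s n (x - y) ≤ truncNorm s n x + truncNorm s n y := by
  simp only [truncNorm, coeffA_sub, ← Finset.sum_add_distrib]
  exact Finset.sum_le_sum fun u _ => Finset.sum_le_sum fun k _ => norm_sub_le _ _

theorem truncNorm_add_le (n : ℕ) (x y : S) :
    truncNorm s n (x + y) ≤ truncNorm s n x + truncNorm s n y := by
  simp only [truncNorm, coeffA_add, ← Finset.sum_add_distrib]
  exact Finset.sum_le_sum fun u _ => Finset.sum_le_sum fun k _ => norm_add_le _ _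

/-- The truncated norm is submultiplicative up to a constant. -/
theorem exists_truncNorm_mul_le (n : ℕ) : ∃ K : ℝ, 0 ≤ K ∧ ∀ x y : S,
    truncNorm s n (x * y) ≤ K * truncNorm s n x * truncNorm s n y := by
  refine ⟨∑ w, ∑ k ∈ Finset.range (n + 1), ∑ u, ∑ v,
    ∑ p ∈ Finset.HasAntidiagonal.antidiagonal k,
      ∑ q ∈ Finset.HasAntidiagonal.antidiagonal p.1, ‖coeffA s w p.2 (s u * s v)‖,
    by positivity, fun x y => ?_⟩
  rw [mul_assoc]
  conv_lhs => rw [truncNorm]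
  simp only [Finset.sum_mul]
  refine Finset.sum_le_sum fun w _ => Finset.sum_le_sum fun k hk => ?_
  rw [coeffA_mul]
  refine (norm_sum_le _ _).trans (Finset.sum_le_sum fun u _ => ?_)
  refine (norm_sum_le _ _).trans (Finset.sum_le_sum fun v _ => ?_)
  refine (norm_sum_le _ _).trans (Finset.sum_le_sum fun p hp => ?_)
  refine (norm_sum_le _ _).trans (Finset.sum_le_sum fun q hq => ?_)
  have hk' : k ≤ n := Nat.lt_succ_iff.1 (Finset.mem_range.1 hk)
  have h1 := Finset.HasAntidiagonal.mem_antidiagonal.1 hp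
  have h2 := Finset.HasAntidiagonal.mem_antidiagonal.1 hq
  rw [norm_mul, norm_mul, mul_comm]
  have h3 := norm_coeffA_le s (show q.1 ≤ n by omega) u x
  have h4 := norm_coeffA_le s (show q.2 ≤ n by omega) v y
  have := truncNorm_nonneg s n x
  gcongr

/-- Coefficientwise summability in `S`. -/
def HasSumS {ι : Type*} (f : ι → S) (F : S) : Prop :=
  ∀ u n, HasSum (fun i => coeffA s u n (f i)) (coeffA s u n F)

theorem HasSumS.mul_right {ι : Type*} {f : ι → S} {F : S} (h : HasSumS s f F) (y : S) :
    HasSumS s (fun i => f i * y) (F * y) := fun w n => by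
  simp only [coeffA_mul s w n]
  exact hasSum_sum fun u _ => hasSum_sum fun v _ => hasSum_sum fun p _ => hasSum_sum fun q _ =>
    ((h u q.1).mul_right _).mul_right _

end CoefficientLemmas

section SValued

variable {I : Type*} [Fintype I] {R : I → ENNReal} {S : Type*} [CommRing S] [Algebra ℂ⟦X⟧ S]
  {e : ℕ} (s : Module.Basis (Fin e) ℂ⟦X⟧ S)

/-- The coefficient of `ϖ ^ n` in the `u`-th coordinate of a power series over `S`. -/
def coeffSeries (u : Fin e) (n : ℕ) (p : MvPowerSeries I S) : MvPowerSeries I ℂ :=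
  fun α => coeffA s u n (MvPowerSeries.coeff α p)

omit [Fintype I] in
theorem coeff_coeffSeries (u : Fin e) (n : ℕ) (p : MvPowerSeries I S) (α : I →₀ ℕ) :
    MvPowerSeries.coeff α (coeffSeries s u n p) = coeffA s u n (MvPowerSeries.coeff α p) := rfl

/-- The `S`-valued function `g` is the sum of the power series `p` on the polydisc, coefficient by
coefficient. -/
def HasExpS (R : I → ENNReal) (p : MvPowerSeries I S) (g : (I → ℂ) → S) : Prop :=
  ∀ u n, HasExpansion R (coeffSeries s u n p) fun z => coeffA s u n (g z)

variable {s}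

theorem exists_hasExpS (hR : ∀ j, 0 < R j) {g : (I → ℂ) → S}
    (hg : ∀ u n, DifferentiableOn ℂ (fun z => coeffA s u n (g z)) (polydisc R)) :
    ∃ p, HasExpS s R p g := by
  choose p hp using fun u n => exists_hasExpansion hR (hg u n)
  refine ⟨fun α => ofCoeffs s fun u n => MvPowerSeries.coeff α (p u n), fun u n => ?_⟩
  convert! hp u n using 1
  ext α
  exact coeffA_ofCoeffs s _ u n

theorem HasExpS.eqOn {p : MvPowerSeries I S} {f g : (I → ℂ) → S} (h : HasExpS s R p f)
    (h' : HasExpS s R p g) : Set.EqOn f g (polydisc R) := fun _ hz =>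
  coeffA_ext s fun u n => (h u n).eqOn (h' u n) hz

theorem HasExpS.sub {p q : MvPowerSeries I S} {f g : (I → ℂ) → S} (hf : HasExpS s R p f)
    (hg : HasExpS s R q g) : HasExpS s R (p - q) fun z => f z - g z := fun u n => by
  simp only [coeffA_sub]
  convert! (hf u n).sub (hg u n) using 1
  ext α
  simp [coeff_coeffSeries, coeffA_sub]

theorem HasExpS.add {p q : MvPowerSeries I S} {f g : (I → ℂ) → S} (hf : HasExpS s R p f)
    (hg : HasExpS s R q g) : HasExpS s R (p + q) fun z => f z + g z := fun u n => by
  simp only [coeffA_add]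
  convert! (hf u n).add (hg u n) using 1
  ext α
  simp [coeff_coeffSeries, coeffA_add]

theorem HasExpS.sum {ι : Type*} {t : Finset ι} {p : ι → MvPowerSeries I S}
    {f : ι → (I → ℂ) → S} (h : ∀ i ∈ t, HasExpS s R (p i) (f i)) :
    HasExpS s R (∑ i ∈ t, p i) fun z => ∑ i ∈ t, f i z := fun u n => by
  simp only [coeffA_sum]
  convert! HasExpansion.sum fun i hi => h i hi u n using 1
  ext α
  simp [coeff_coeffSeries, coeffA_sum]

theorem HasExpS.mul {p q : MvPowerSeries I S} {f g : (I → ℂ) → S} (hf : HasExpS s R p f)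
    (hg : HasExpS s R q g) : HasExpS s R (p * q) fun z => f z * g z := fun w n => by
  classical
  have h : HasExpansion R (∑ u, ∑ v, ∑ x ∈ Finset.HasAntidiagonal.antidiagonal n,
      ∑ y ∈ Finset.HasAntidiagonal.antidiagonal x.1,
        coeffA s w x.2 (s u * s v) • (coeffSeries s u y.1 p * coeffSeries s v y.2 q))
      fun z => ∑ u, ∑ v, ∑ x ∈ Finset.HasAntidiagonal.antidiagonal n,
      ∑ y ∈ Finset.HasAntidiagonal.antidiagonal x.1,
        coeffA s w x.2 (s u * s v) * (coeffA s u y.1 (f z) * coeffA s v y.2 (g z)) :=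
    HasExpansion.sum fun u _ => HasExpansion.sum fun v _ => HasExpansion.sum fun x _ =>
      HasExpansion.sum fun y _ => ((hf u y.1).mul (hg v y.2)).const_mul _
  convert! h using 1
  · ext α
    simp only [coeff_coeffSeries, MvPowerSeries.coeff_mul, coeffA_sum, coeffA_mul s w n, map_sum,
      map_smul, smul_eq_mul, Finset.mul_sum]
    rw [Finset.sum_comm]
    refine Finset.sum_congr rfl fun u _ => ?_
    rw [Finset.sum_comm]
    refine Finset.sum_congr rfl fun v _ => ?_
    rw [Finset.sum_comm]
    refine Finset.sum_congr rfl fun x _ => ?_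
    rw [Finset.sum_comm]
    refine Finset.sum_congr rfl fun y _ => Finset.sum_congr rfl fun a _ => ?_
    ring
  · funext z
    rw [coeffA_mul]
    refine Finset.sum_congr rfl fun u _ => Finset.sum_congr rfl fun v _ =>
      Finset.sum_congr rfl fun x _ => Finset.sum_congr rfl fun y _ => ?_
    ring

theorem HasExpS.eq_zero (hR : ∀ j, 0 < R j) {p : MvPowerSeries I S} {f : (I → ℂ) → S}
    (hf : HasExpS s R p f) (h0 : ∀ z ∈ polydisc R, (∀ j, z j ≠ 0) → f z = 0) : p = 0 := by
  ext α
  refine coeffA_ext s fun u n => ?_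
  have := (hf u n).eq_zero hR fun z hz hz0 => by rw [h0 z hz hz0, coeffA_zero]
  rw [← coeff_coeffSeries, this, map_zero, map_zero, coeffA_zero]

omit [Fintype I] in
theorem zero_mem_polydisc (hR : ∀ j, 0 < R j) : (0 : I → ℂ) ∈ polydisc R := fun j => by
  simpa using hR j

theorem HasExpS.apply_zero (hR : ∀ j, 0 < R j) {p : MvPowerSeries I S} {f : (I → ℂ) → S}
    (hf : HasExpS s R p f) : f 0 = MvPowerSeries.coeff 0 p := by
  refine coeffA_ext s fun u n => ?_
  refine (hf u n 0 (zero_mem_polydisc hR)).unique ?_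
  have := hasSum_single (f := fun α : I →₀ ℕ => MvPowerSeries.coeff α (coeffSeries s u n p) *
      ∏ j, (0 : I → ℂ) j ^ α j) 0 fun α hα => by
    obtain ⟨j, hj⟩ := Finsupp.ne_iff.1 hα
    rw [Finset.prod_eq_zero (Finset.mem_univ j), mul_zero]
    simpa using hj
  simpa only [coeff_coeffSeries, Finsupp.coe_zero, Pi.zero_apply, pow_zero, Finset.prod_const_one,
    mul_one] using this

/-- The sum of a power series over `S`, coefficient by coefficient. -/
def evalS (s : Module.Basis (Fin e) ℂ⟦X⟧ S) (p : MvPowerSeries I S) (z : I → ℂ) : S :=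
  ofCoeffs s fun u n => ∑' α, coeffA s u n (MvPowerSeries.coeff α p) * ∏ j, z j ^ α j

theorem hasExpS_evalS {p : MvPowerSeries I S} (h : ∀ u n, ∀ z ∈ polydisc R,
    Summable fun α => coeffA s u n (MvPowerSeries.coeff α p) * ∏ j, z j ^ α j) :
    HasExpS s R p (evalS s p) := fun u n z hz => by
  simp only [evalS, coeffA_ofCoeffs]
  exact (h u n z hz).hasSum

/-- The sum of the series `euler j p` exists wherever that of `p` does. -/
theorem HasExpS.logDeriv {p : MvPowerSeries I S} {f : (I → ℂ) → S} (hf : HasExpS s R p f) (j : I) :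
    HasExpS s R (euler j p) (evalS s (euler j p)) := by
  classical
  refine hasExpS_evalS fun u n z hz => ?_
  refine ((hf u n).logDeriv j z hz).summable.congr fun α => ?_
  rw [coeff_euler, coeff_euler, coeffA_nsmul, nsmul_eq_mul, coeff_coeffSeries]

/-- The `S`-valued function `g` has logarithmic partial derivatives `g' j` at `ζ`, coefficient by
coefficient. -/
def HasDlog (s : Module.Basis (Fin e) ℂ⟦X⟧ S) (g : (I → ℂ) → S) (g' : I → S) (ζ : I → ℂ) : Prop :=
  ∀ u n, HasFDerivAt (𝕜 := ℂ) (fun ξ => coeffA s u n (g ξ))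
    (dlogForm fun j => coeffA s u n (g' j)) ζ

theorem hasDlog_const (x : S) (ζ : I → ℂ) : HasDlog s (fun _ => x) 0 ζ := fun u n =>
  (hasFDerivAt_const (𝕜 := ℂ) (coeffA s u n x) ζ).congr_fderiv <| by
    ext v; simp [dlogForm_apply, coeffA_zero]

theorem HasDlog.sum {ι : Type*} {t : Finset ι} {g : ι → (I → ℂ) → S} {g' : ι → I → S} {ζ : I → ℂ}
    (h : ∀ i ∈ t, HasDlog s (g i) (g' i) ζ) :
    HasDlog s (fun ξ => ∑ i ∈ t, g i ξ) (fun j => ∑ i ∈ t, g' i j) ζ := fun u n => by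
  simp only [coeffA_sum]
  refine (HasFDerivAt.fun_sum fun i hi => h i hi u n).congr_fderiv ?_
  ext v
  simp only [sum_apply, dlogForm_apply, Finset.sum_mul]
  rw [Finset.sum_comm]

theorem dlogForm_sum {ι : Type*} (t : Finset ι) (a : ι → I → ℂ) :
    dlogForm (fun j => ∑ i ∈ t, a i j) = ∑ i ∈ t, dlogForm (a i) := by
  ext v
  simp only [sum_apply, dlogForm_apply, Finset.sum_mul]
  rw [Finset.sum_comm]

theorem HasDlog.mul {f g : (I → ℂ) → S} {f' g' : I → S} {ζ : I → ℂ} (hf : HasDlog s f f' ζ)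
    (hg : HasDlog s g g' ζ) :
    HasDlog s (fun ξ => f ξ * g ξ) (fun j => f' j * g ζ + f ζ * g' j) ζ := fun w n => by
  simp only [coeffA_add, coeffA_mul s w n]
  refine (HasFDerivAt.fun_sum fun u _ => HasFDerivAt.fun_sum fun v _ => HasFDerivAt.fun_sum
    fun p _ => HasFDerivAt.fun_sum fun q _ =>
      ((hf u q.1).mul (hg v q.2)).mul_const _).congr_fderiv ?_
  simp only [← Finset.sum_add_distrib, dlogForm_sum]
  refine Finset.sum_congr rfl fun u _ => Finset.sum_congr rfl fun v _ =>
    Finset.sum_congr rfl fun p _ => Finset.sum_congr rfl fun q _ => ?_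
  ext x
  simp only [smul_apply, add_apply, dlogForm_apply, smul_eq_mul, Finset.mul_sum,
    ← Finset.sum_add_distrib]
  refine Finset.sum_congr rfl fun j _ => ?_
  ring

theorem HasDlog.congr_deriv {f : (I → ℂ) → S} {f' g' : I → S} {ζ : I → ℂ} (hf : HasDlog s f f' ζ)
    (h : ∀ j, f' j = g' j) : HasDlog s f g' ζ := by rwa [← funext h]

theorem HasDlog.unique {f : (I → ℂ) → S} {f' g' : I → S} {ζ : I → ℂ} (hf : HasDlog s f f' ζ)
    (hg : HasDlog s f g' ζ) : f' = g' := by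
  classical
  funext j
  refine coeffA_ext s fun u n => ?_
  have := congrArg (fun D => D (Pi.single j 1)) ((hf u n).unique (hg u n))
  simpa [dlogForm_apply, Pi.single_apply] using this

theorem hasFDerivAt_expMap (ζ : I → ℂ) : HasFDerivAt (𝕜 := ℂ) (expMap (I := I))
    (ContinuousLinearMap.pi fun j => Complex.exp (ζ j) •
      ContinuousLinearMap.proj (R := ℂ) (φ := fun _ : I => ℂ) j) ζ := by
  rw [hasFDerivAt_pi]
  intro j
  exact ((ContinuousLinearMap.proj (R := ℂ) (φ := fun _ : I => ℂ) j).hasFDerivAt (x := ζ)).cexp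

theorem HasExpS.coeffA_evalS_euler [DecidableEq I] {p : MvPowerSeries I S} {f : (I → ℂ) → S}
    (hf : HasExpS s R p f) (j : I) {z : I → ℂ} (hz : z ∈ polydisc R) (u : Fin e) (n : ℕ) :
    coeffA s u n (evalS s (euler j p) z) =
      z j * fderiv ℂ (fun z => coeffA s u n (f z)) z (Pi.single j 1) := by
  refine (hf.logDeriv j u n _ hz).unique ?_
  convert! (hf u n).logDeriv j _ hz using 2 with α
  rw [coeff_euler, coeff_coeffSeries, coeff_euler, coeffA_nsmul, nsmul_eq_mul, coeff_coeffSeries]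

/-- In the coordinates `ζ`, the derivative `∂/∂ζ_j` is `z_j ∂/∂z_j`. -/
theorem HasExpS.hasDlog {p : MvPowerSeries I S} {f : (I → ℂ) → S} (hf : HasExpS s R p f)
    {ζ : I → ℂ} (hζ : ζ ∈ logCover R) :
    HasDlog s (fun ξ => f (expMap ξ)) (fun j => evalS s (euler j p) (expMap ζ)) ζ := fun u n => by
  classical
  have hd := ((hf u n).differentiableOn.differentiableAt
    ((isOpen_polydisc R).mem_nhds hζ)).hasFDerivAt
  refine (hd.comp ζ (hasFDerivAt_expMap ζ)).congr_fderiv ?_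
  ext v
  rw [dlogForm_apply]
  have h1 := fun j => hf.coeffA_evalS_euler j hζ u n
  simp only [h1, ContinuousLinearMap.comp_apply]
  set D := fderiv ℂ (fun z => coeffA s u n (f z)) (expMap ζ)
  have h2 : (ContinuousLinearMap.pi fun j => Complex.exp (ζ j) •
      ContinuousLinearMap.proj (R := ℂ) (φ := fun _ : I => ℂ) j) v =
      ∑ j, (expMap ζ j * v j) • (Pi.single j 1 : I → ℂ) := by
    funext i
    simp [Pi.single_apply, expMap]
  rw [h2, map_sum]
  refine Finset.sum_congr rfl fun j _ => ?_
  rw [map_smul, smul_eq_mul]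
  ring

end SValued

/-! ### The exponential in `S` -/

section Exponential

variable {I : Type*} [Fintype I] {S : Type*} [CommRing S] [Algebra ℂ⟦X⟧ S]
  {d e : ℕ} (s : Module.Basis (Fin e) ℂ⟦X⟧ S)

theorem exists_truncNorm_pow_mul_le (n : ℕ) : ∃ K : ℝ, 0 ≤ K ∧ ∀ (k : ℕ) (x y : S),
    truncNorm s n (x ^ k * y) ≤ (K * truncNorm s n x) ^ k * truncNorm s n y := by
  obtain ⟨K, hK, h⟩ := exists_truncNorm_mul_le s n
  refine ⟨K, hK, fun k x y => ?_⟩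
  induction k with
  | zero => simp
  | succ k ih =>
    rw [pow_succ', mul_assoc, pow_succ', mul_assoc]
    refine (h _ _).trans ?_
    have := mul_nonneg hK (truncNorm_nonneg s n x)
    gcongr

theorem norm_coeffA_pow_mul_le {n : ℕ} {K : ℝ}
    (h : ∀ (k : ℕ) (x y : S), truncNorm s n (x ^ k * y) ≤
      (K * truncNorm s n x) ^ k * truncNorm s n y) (u : Fin e) (k : ℕ) (x y : S) :
    ‖coeffA s u n (x ^ k * y)‖ ≤ (K * truncNorm s n x) ^ k * truncNorm s n y :=
  (norm_coeffA_le s le_rfl u _).trans (h k x y)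

/-- The exponential series converges in every coefficient, since each coefficient of `x ^ k` grows
at most geometrically in `k`. -/
theorem hasSumS_expS (x : S) :
    HasSumS s (fun k : ℕ => (PowerSeries.C ((k.factorial : ℂ)⁻¹) : ℂ⟦X⟧) • x ^ k) (expS s x) := by
  intro u n
  obtain ⟨K, hK, h⟩ := exists_truncNorm_pow_mul_le s n
  have h1 : coeffA s u n (expS s x) = ∑' k : ℕ, coeffA s u n (x ^ k) / (k.factorial : ℂ) :=
    coeffA_ofCoeffs s _ u n
  rw [h1]
  simp only [coeffA_C_smul, inv_mul_eq_div]
  refine (Summable.of_norm_bounded ((Real.summable_pow_div_factorial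
    (K * truncNorm s n x)).mul_right (truncNorm s n 1)) fun k => ?_).hasSum
  have := norm_coeffA_pow_mul_le s h u k x 1
  rw [mul_one] at this
  rw [norm_div, Complex.norm_natCast, div_mul_eq_mul_div]
  gcongr

theorem expS_zero : expS s 0 = 1 := by
  refine coeffA_ext s fun u n => (hasSumS_expS s 0 u n).unique ?_
  have := hasSum_single (f := fun k : ℕ => coeffA s u n
    ((PowerSeries.C ((k.factorial : ℂ)⁻¹) : ℂ⟦X⟧) • (0 : S) ^ k)) 0 fun k hk => by
      simp [hk, coeffA_zero]
  simpa using this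

variable {s} in
theorem HasDlog.pow {g : (I → ℂ) → S} {g' : I → S} {ζ : I → ℂ} (hg : HasDlog s g g' ζ) (k : ℕ) :
    HasDlog s (fun ξ => g ξ ^ k) (fun j => k • (g ζ ^ (k - 1) * g' j)) ζ := by
  induction k with
  | zero =>
    simp only [pow_zero, zero_smul]
    exact hasDlog_const 1 ζ
  | succ k ih =>
    simp only [pow_succ]
    refine (ih.mul hg).congr_deriv fun j => ?_
    rcases k with _ | k
    · simp
    · simp only [Nat.add_sub_cancel, nsmul_eq_mul, pow_succ]
      push_cast
      ring

theorem hasDlog_linear (m : I → S) (ζ : I → ℂ) :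
    HasDlog s (fun ξ => ∑ j, algebraMap ℂ⟦X⟧ S (PowerSeries.C (ξ j)) * m j) m ζ := fun u n => by
  simp only [coeffA_sum, ← Algebra.smul_def, coeffA_C_smul]
  refine (HasFDerivAt.fun_sum fun j _ =>
    ((ContinuousLinearMap.proj (R := ℂ) (φ := fun _ : I => ℂ) j).hasFDerivAt
      (x := ζ)).mul_const _).congr_fderiv ?_
  ext v
  simp [dlogForm_apply]

theorem norm_dlogForm_le (a : I → ℂ) : ‖dlogForm a‖ ≤ ∑ j, ‖a j‖ := by
  refine (norm_sum_le _ _).trans (Finset.sum_le_sum fun j _ => ?_)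
  rw [norm_smul]
  refine mul_le_of_le_one_right (norm_nonneg _) ?_
  exact ContinuousLinearMap.opNorm_le_bound _ zero_le_one fun w => by
      simpa using norm_le_pi_norm w j

/-- The exponential of a linear form is differentiable, term by term. -/
theorem hasDlog_expS (m : I → S) (ζ : I → ℂ) :
    HasDlog s (fun ξ => expS s (∑ j, algebraMap ℂ⟦X⟧ S (PowerSeries.C (ξ j)) * m j))
      (fun j => expS s (∑ j, algebraMap ℂ⟦X⟧ S (PowerSeries.C (ζ j)) * m j) * m j) ζ := by
  intro u n
  set x : (I → ℂ) → S := fun ξ => ∑ j, algebraMap ℂ⟦X⟧ S (PowerSeries.C (ξ j)) * m j with hx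
  obtain ⟨K, hK, h⟩ := exists_truncNorm_pow_mul_le s n
  set ρ : ℝ := ‖ζ‖ + 1
  have hρ : 0 < ρ := by positivity
  set M : ℝ := ∑ j, ρ * truncNorm s n (m j) with hM
  have hxM : ∀ ξ ∈ Metric.ball (0 : I → ℂ) ρ, truncNorm s n (x ξ) ≤ M := fun ξ hξ => by
    refine (truncNorm_sum_le s n _ _).trans (Finset.sum_le_sum fun j _ => ?_)
    rw [← Algebra.smul_def, truncNorm_C_smul]
    have := truncNorm_nonneg s n (m j)
    gcongr
    exact (norm_le_pi_norm ξ j).trans (mem_ball_zero_iff.1 hξ).le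
  have hM0 : 0 ≤ M := Finset.sum_nonneg fun j _ => mul_nonneg hρ.le (truncNorm_nonneg s n _)
  have hterm : ∀ (k : ℕ) (ξ : I → ℂ), HasFDerivAt (𝕜 := ℂ)
      (fun ξ => coeffA s u n ((PowerSeries.C ((k.factorial : ℂ)⁻¹) : ℂ⟦X⟧) • x ξ ^ k))
      (dlogForm fun j => (k.factorial : ℂ)⁻¹ * coeffA s u n (k • (x ξ ^ (k - 1) * m j))) ξ := by
    intro k ξ
    simp only [coeffA_C_smul]
    refine (((hasDlog_linear s m ξ).pow k u n).const_mul _).congr_fderiv ?_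
    ext v
    simp [dlogForm_apply, Finset.mul_sum, hx, mul_assoc]
  have hbound : ∀ (k : ℕ), ∀ ξ ∈ Metric.ball (0 : I → ℂ) ρ,
      ‖dlogForm fun j => (k.factorial : ℂ)⁻¹ * coeffA s u n (k • (x ξ ^ (k - 1) * m j))‖ ≤
        ((k.factorial : ℝ)⁻¹ * (k * (K * M) ^ (k - 1))) * ∑ j, truncNorm s n (m j) := by
    intro k ξ hξ
    refine (norm_dlogForm_le _).trans ?_
    rw [Finset.mul_sum]
    refine Finset.sum_le_sum fun j _ => ?_
    rw [coeffA_nsmul, norm_mul, norm_mul, norm_inv, Complex.norm_natCast, Complex.norm_natCast,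
      mul_assoc, mul_assoc]
    have h1 := norm_coeffA_pow_mul_le s h u (k - 1) (x ξ) (m j)
    have h2 := hxM ξ hξ
    have h3 := truncNorm_nonneg s n (x ξ)
    have h4 := truncNorm_nonneg s n (m j)
    refine mul_le_mul_of_nonneg_left (mul_le_mul_of_nonneg_left ?_ (by positivity)) (by positivity)
    refine h1.trans ?_
    gcongr
  have hsum : Summable fun k : ℕ =>
      ((k.factorial : ℝ)⁻¹ * (k * (K * M) ^ (k - 1))) * ∑ j, truncNorm s n (m j) := by
    refine Summable.mul_right _ ?_
    rw [← summable_nat_add_iff 1]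
    refine (Real.summable_pow_div_factorial (K * M)).congr fun k => ?_
    rw [Nat.factorial_succ, Nat.add_sub_cancel]
    push_cast
    field_simp
  have hζ : ζ ∈ Metric.ball (0 : I → ℂ) ρ := by simp [ρ]
  have hd := hasFDerivAt_tsum_of_isPreconnected (𝕜 := ℂ) hsum Metric.isOpen_ball
    (convex_ball (0 : I → ℂ) ρ).isPreconnected (fun k ξ _ => hterm k ξ) hbound hζ
    (hasSumS_expS s (x ζ) u n).summable hζ
  have he : (fun ξ => ∑' k : ℕ, coeffA s u n
      ((PowerSeries.C ((k.factorial : ℂ)⁻¹) : ℂ⟦X⟧) • x ξ ^ k)) =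
      fun ξ => coeffA s u n (expS s (x ξ)) :=
    funext fun ξ => (hasSumS_expS s (x ξ) u n).tsum_eq
  rw [he] at hd
  refine hd.congr_fderiv ?_
  ext v
  have hs1 := (Summable.of_norm_bounded hsum fun k => hbound k ζ hζ).hasSum
  have hs2 := (ContinuousLinearMap.apply ℂ ℂ v).hasSum hs1
  refine hs2.unique ?_
  simp only [ContinuousLinearMap.apply_apply, dlogForm_apply]
  refine hasSum_sum fun j _ => ?_
  refine HasSum.mul_right _ ?_
  rw [← hasSum_nat_add_iff' 1]
  have := (hasSumS_expS s (x ζ)).mul_right s (m j) u n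
  convert! this using 2 with k
  · beta_reduce
    rw [Nat.add_sub_cancel, smul_mul_assoc, coeffA_C_smul, coeffA_nsmul, Nat.factorial_succ]
    push_cast
    have : (k : ℂ) + 1 ≠ 0 := by exact_mod_cast Nat.succ_ne_zero k
    field_simp
  · simp [coeffA_zero, hx]

theorem hasDlog_zPow (m : Fin d → I → S) (r : Fin d) (ζ : I → ℂ) :
    HasDlog s (zPow s m r) (fun j => zPow s m r ζ * m r j) ζ :=
  hasDlog_expS s (m r) ζ

theorem zPow_mul_zPow_neg (m : Fin d → I → S) (r : Fin d) (ζ : I → ℂ) :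
    zPow s m r ζ * zPow s (-m) r ζ = 1 := by
  refine coeffA_ext s fun u n => ?_
  have h : ∀ ξ, HasDlog s (fun ξ => zPow s m r ξ * zPow s (-m) r ξ) 0 ξ := fun ξ =>
    ((hasDlog_zPow s m r ξ).mul (hasDlog_zPow s (-m) r ξ)).congr_deriv fun j => by
      simp only [Pi.neg_apply, Pi.zero_apply]
      ring
  have h0 : ∀ ξ, HasFDerivAt (𝕜 := ℂ) (fun ξ => coeffA s u n (zPow s m r ξ * zPow s (-m) r ξ))
      (0 : (I → ℂ) →L[ℂ] ℂ) ξ := fun ξ => (h ξ u n).congr_fderiv <| by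
    ext v; simp [dlogForm_apply, coeffA_zero]
  have := is_const_of_fderiv_eq_zero (𝕜 := ℂ) (fun ξ => (h0 ξ).differentiableAt)
    (fun ξ => (h0 ξ).fderiv) ζ 0
  rw [this]
  simp [zPow, expS_zero]

end Exponential

/-! ### Formal solutions of a connection with logarithmic poles -/

section FormalPrelims

variable {I : Type*}

/-- Well-founded recursion along multi-indices, as an existence statement. -/
theorem exists_multiindex_rec {X : Type*} [Inhabited X] (Φ : (I →₀ ℕ) → ((I →₀ ℕ) → X) → X)
    (hΦ : ∀ α f g, (∀ β < α, f β = g β) → Φ α f = Φ α g) : ∃ f, ∀ α, f α = Φ α f := by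
  classical
  let f : (I →₀ ℕ) → X := WellFounded.fix (r := (· < ·)) wellFounded_lt fun α ih =>
    Φ α fun β => if h : β < α then ih β h else default
  refine ⟨f, fun α => ?_⟩
  rw [show f α = _ from WellFounded.fix_eq _ _ _]
  refine hΦ _ _ _ fun β hβ => ?_
  simp only [hβ, dite_true]
  rfl

theorem multiindex_induction {C : (I →₀ ℕ) → Prop} (h : ∀ α, (∀ β < α, C β) → C α) (α : I →₀ ℕ) :
    C α := WellFounded.induction (r := (· < ·)) wellFounded_lt α h

variable [DecidableEq I]

theorem fst_lt_of_mem_antidiagonal {α : I →₀ ℕ} {x : (I →₀ ℕ) × (I →₀ ℕ)}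
    (hx : x ∈ Finset.HasAntidiagonal.antidiagonal α) (h : x.2 ≠ 0) : x.1 < α := by
  rw [← Finset.HasAntidiagonal.mem_antidiagonal.1 hx]
  exact lt_add_of_pos_right _ (pos_iff_ne_zero.2 h)

theorem snd_lt_of_mem_antidiagonal {α : I →₀ ℕ} {x : (I →₀ ℕ) × (I →₀ ℕ)}
    (hx : x ∈ Finset.HasAntidiagonal.antidiagonal α) (h : x.1 ≠ 0) : x.2 < α := by
  rw [← Finset.HasAntidiagonal.mem_antidiagonal.1 hx]
  exact lt_add_of_pos_left _ (pos_iff_ne_zero.2 h)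

theorem sum_antidiagonal_eq_add {M : Type*} [AddCommMonoid M] (α : I →₀ ℕ)
    (f : (I →₀ ℕ) × (I →₀ ℕ) → M) :
    ∑ x ∈ Finset.HasAntidiagonal.antidiagonal α, f x = f (0, α) +
      ∑ x ∈ Finset.HasAntidiagonal.antidiagonal α with x.2 < α, f x := by
  classical
  rw [← Finset.sum_filter_add_sum_filter_not _ (fun x => x.2 < α), add_comm]
  congr 1
  rw [Finset.sum_eq_single (0, α)]
  · rintro x hx hx0
    obtain ⟨hx1, hx2⟩ := Finset.mem_filter.1 hx
    by_cases h : x.1 = 0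
    · refine absurd (Prod.ext h ?_) hx0
      have := Finset.HasAntidiagonal.mem_antidiagonal.1 hx1
      rwa [h, zero_add] at this
    · exact absurd (snd_lt_of_mem_antidiagonal hx1 h) hx2
  · intro h
    simp at h

theorem sum_antidiagonal_eq_add_add {M : Type*} [AddCommMonoid M] {α : I →₀ ℕ} (hα : α ≠ 0)
    (f : (I →₀ ℕ) × (I →₀ ℕ) → M) :
    ∑ x ∈ Finset.HasAntidiagonal.antidiagonal α, f x = f (0, α) + f (α, 0) +
      ∑ x ∈ Finset.HasAntidiagonal.antidiagonal α with x.1 < α ∧ x.2 < α, f x := by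
  classical
  rw [sum_antidiagonal_eq_add, add_assoc]
  congr 1
  rw [← Finset.sum_filter_add_sum_filter_not _ (fun x => x.1 < α), add_comm, Finset.filter_filter,
    Finset.filter_filter]
  congr 1
  · rw [Finset.sum_eq_single (α, 0)]
    · rintro x hx hx0
      obtain ⟨hx1, hx2, hx3⟩ := Finset.mem_filter.1 hx
      by_cases h : x.2 = 0
      · refine absurd (Prod.ext ?_ h) hx0
        have := Finset.HasAntidiagonal.mem_antidiagonal.1 hx1
        rwa [h, add_zero] at this
      · exact absurd (fst_lt_of_mem_antidiagonal hx1 h) hx3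
    · intro h
      simp [pos_iff_ne_zero, hα] at h
  · refine Finset.sum_congr (Finset.filter_congr fun x _ => and_comm) fun _ _ => rfl

theorem coeff_mul_of_forall_lt {S : Type*} [Semiring S] {p q : MvPowerSeries I S} {α : I →₀ ℕ}
    (h : ∀ β < α, MvPowerSeries.coeff β q = 0) : MvPowerSeries.coeff α (p * q) =
      MvPowerSeries.coeff 0 p * MvPowerSeries.coeff α q := by
  classical
  rw [MvPowerSeries.coeff_mul, sum_antidiagonal_eq_add, Finset.sum_eq_zero, add_zero]
  intro x hx
  rw [h _ (Finset.mem_filter.1 hx).2, mul_zero]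

omit [DecidableEq I] in
theorem coeff_zero_mul_eq {S : Type*} [Semiring S] (p q : MvPowerSeries I S) :
    MvPowerSeries.coeff 0 (p * q) = MvPowerSeries.coeff 0 p * MvPowerSeries.coeff 0 q := by
  classical
  exact coeff_mul_of_forall_lt fun β hβ => absurd hβ not_lt_zero

end FormalPrelims

section FormalSolution

variable {I ι : Type*} [Fintype ι] [DecidableEq ι] {T : Type*} [CommRing T]

/-- The connection `X ↦ z_j ∂_j X - M_j X + X D` on matrix-valued formal power series. -/
def formalConn (M : I → MvPowerSeries I (Matrix ι ι T)) (l : ι → I → T) (j : I)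
    (X : MvPowerSeries I (Matrix ι ι T)) : MvPowerSeries I (Matrix ι ι T) :=
  euler j X - M j * X + X * MvPowerSeries.C (Matrix.diagonal fun r => l r j)

/-- For a flat connection the operators `formalConn` commute. -/
theorem formalConn_comm {M : I → MvPowerSeries I (Matrix ι ι T)} {l : ι → I → T}
    (hflat : ∀ i j, euler i (M j) - euler j (M i) = M i * M j - M j * M i) (i j : I)
    (X : MvPowerSeries I (Matrix ι ι T)) :
    formalConn M l i (formalConn M l j X) = formalConn M l j (formalConn M l i X) := by
  have hD : (MvPowerSeries.C (σ := I) (Matrix.diagonal fun r => l r j)) *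
      MvPowerSeries.C (Matrix.diagonal fun r => l r i) =
      MvPowerSeries.C (Matrix.diagonal fun r => l r i) *
      MvPowerSeries.C (Matrix.diagonal fun r => l r j) := by
    rw [← map_mul, ← map_mul, Matrix.diagonal_mul_diagonal, Matrix.diagonal_mul_diagonal]
    simp only [mul_comm]
  simp only [formalConn, euler_add, euler_sub, euler_mul, euler_C, mul_zero, add_zero]
  rw [euler_comm i j]
  set Di := MvPowerSeries.C (σ := I) (Matrix.diagonal fun r => l r i)
  set Dj := MvPowerSeries.C (σ := I) (Matrix.diagonal fun r => l r j)
  rw [← sub_eq_zero]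
  have h1 : (euler i (M j) - euler j (M i) - (M i * M j - M j * M i)) * X = 0 := by
    rw [hflat, sub_self, zero_mul]
  have h2 : X * (Dj * Di - Di * Dj) = 0 := by rw [hD, sub_self, mul_zero]
  calc _ = -((euler i (M j) - euler j (M i) - (M i * M j - M j * M i)) * X) +
        X * (Dj * Di - Di * Dj) := by noncomm_ring
    _ = 0 := by rw [h1, h2, neg_zero, add_zero]

/-- On a series starting in degree `α`, the connection acts on the leading coefficient by the
scalars `α_j - l_{rj} + l_{tj}`. -/
theorem coeff_formalConn {M : I → MvPowerSeries I (Matrix ι ι T)} {l : ι → I → T}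
    (hM : ∀ j, MvPowerSeries.coeff 0 (M j) = Matrix.diagonal fun r => l r j) {j : I}
    {X : MvPowerSeries I (Matrix ι ι T)} {α : I →₀ ℕ} (hX : ∀ β < α, MvPowerSeries.coeff β X = 0)
    (r t : ι) : MvPowerSeries.coeff α (formalConn M l j X) r t =
      ((α j : T) - l r j + l t j) * MvPowerSeries.coeff α X r t := by
  classical
  rw [formalConn, map_add, map_sub, coeff_mul_of_forall_lt hX, hM, coeff_euler,
    MvPowerSeries.coeff_mul_C, Matrix.add_apply, Matrix.sub_apply, Matrix.diagonal_mul,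
    Matrix.mul_diagonal, Matrix.smul_apply, nsmul_eq_mul]
  ring

/-- A flat section of the formal connection with vanishing constant term is zero, when no exponent
difference is a nonzero integer. -/
theorem eq_zero_of_formalConn_eq_zero {M : I → MvPowerSeries I (Matrix ι ι T)} {l : ι → I → T}
    (hM : ∀ j, MvPowerSeries.coeff 0 (M j) = Matrix.diagonal fun r => l r j)
    (hreg : ∀ (j : I) (r t : ι) (k : ℕ), k ≠ 0 → ∀ x, ((k : T) - l r j + l t j) * x = 0 → x = 0)
    {X : MvPowerSeries I (Matrix ι ι T)} (hX0 : MvPowerSeries.coeff 0 X = 0)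
    (hX : ∀ j, formalConn M l j X = 0) : X = 0 := by
  ext α : 1
  rw [map_zero]
  induction α using multiindex_induction with
  | h α ih =>
    by_cases hα : α = 0
    · rw [hα, hX0]
    · obtain ⟨j, hj⟩ := Finsupp.ne_iff.1 hα
      ext r t
      refine hreg j r t (α j) hj _ ?_
      rw [← coeff_formalConn hM ih, hX j]
      simp

/-- The formal fundamental solution. The coefficient of index `α` is determined by the equation in
one direction `j` with `α j ≠ 0`; flatness propagates the equation to all other directions. -/
theorem exists_formal_solution {M : I → MvPowerSeries I (Matrix ι ι T)} {l : ι → I → T}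
    (hM : ∀ j, MvPowerSeries.coeff 0 (M j) = Matrix.diagonal fun r => l r j)
    (hflat : ∀ i j, euler i (M j) - euler j (M i) = M i * M j - M j * M i)
    (hunit : ∀ (j : I) (r t : ι) (k : ℕ), k ≠ 0 → IsUnit ((k : T) - l r j + l t j)) :
    ∃ H : MvPowerSeries I (Matrix ι ι T), MvPowerSeries.coeff 0 H = 1 ∧
      ∀ j, formalConn M l j H = 0 := by
  classical
  have : Inhabited (Matrix ι ι T) := ⟨0⟩
  obtain ⟨h, hh⟩ := exists_multiindex_rec (X := Matrix ι ι T)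
    (fun α f => if h : α = 0 then 1 else Matrix.of fun r t =>
      Ring.inverse ((α (Finsupp.ne_iff.1 h).choose : T) - l r (Finsupp.ne_iff.1 h).choose +
          l t (Finsupp.ne_iff.1 h).choose) *
        (∑ x ∈ Finset.HasAntidiagonal.antidiagonal α with x.2 < α,
          MvPowerSeries.coeff x.1 (M (Finsupp.ne_iff.1 h).choose) * f x.2) r t) (by
      intro α f g hfg
      by_cases h : α = 0
      · simp only [h, dite_true]
      · simp only [h, dite_false]
        have : ∀ x ∈ (Finset.HasAntidiagonal.antidiagonal α).filter fun x => x.2 < α,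
            MvPowerSeries.coeff x.1 (M (Finsupp.ne_iff.1 h).choose) * f x.2 =
            MvPowerSeries.coeff x.1 (M (Finsupp.ne_iff.1 h).choose) * g x.2 := fun x hx => by
          rw [hfg _ (Finset.mem_filter.1 hx).2]
        rw [Finset.sum_congr rfl this])
  obtain ⟨H, hc⟩ : ∃ H : MvPowerSeries I (Matrix ι ι T), ∀ α, h α = MvPowerSeries.coeff α H :=
    ⟨h, fun _ => rfl⟩
  simp only [hc] at hh
  have hH0 : MvPowerSeries.coeff 0 H = 1 := by rw [hh]; simp
  -- the equation in the chosen direction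
  have hchosen : ∀ (α : I →₀ ℕ) (h : α ≠ 0), MvPowerSeries.coeff α
      (formalConn M l (Finsupp.ne_iff.1 h).choose H) = 0 := by
    intro α h
    set j := (Finsupp.ne_iff.1 h).choose with hj
    have hj0 : α j ≠ 0 := (Finsupp.ne_iff.1 h).choose_spec
    have hα := hh α
    rw [dif_neg h] at hα
    ext r t
    rw [formalConn, map_add, map_sub, MvPowerSeries.coeff_mul, sum_antidiagonal_eq_add, hM,
      coeff_euler, MvPowerSeries.coeff_mul_C, Matrix.add_apply, Matrix.sub_apply, Matrix.add_apply,
      Matrix.diagonal_mul, Matrix.mul_diagonal, Matrix.smul_apply, nsmul_eq_mul]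
    have h1 : ((α j : T) - l r j + l t j) * MvPowerSeries.coeff α H r t =
        (∑ x ∈ Finset.HasAntidiagonal.antidiagonal α with x.2 < α,
          MvPowerSeries.coeff x.1 (M j) * MvPowerSeries.coeff x.2 H) r t := by
      rw [hα, Matrix.of_apply, ← hj, Ring.mul_inverse_cancel_left _ _ (hunit j r t _ hj0)]
    rw [Matrix.zero_apply]
    rw [← h1]
    ring
  refine ⟨H, hH0, ?_⟩
  have key : ∀ α i, MvPowerSeries.coeff α (formalConn M l i H) = 0 := by
    intro α
    induction α using multiindex_induction with
    | h α ih =>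
      intro i
      by_cases hα : α = 0
      · subst hα
        ext r t
        rw [coeff_formalConn hM (fun β hβ => absurd hβ not_lt_zero), hH0]
        by_cases hrt : r = t
        · simp [hrt]
        · simp [hrt]
      · have hj := hchosen α hα
        have hj0 : α (Finsupp.ne_iff.1 hα).choose ≠ 0 := (Finsupp.ne_iff.1 hα).choose_spec
        set j := (Finsupp.ne_iff.1 hα).choose
        ext r t
        have h1 := coeff_formalConn hM (j := j) (X := formalConn M l i H) (α := α)
          (fun β hβ => ih β hβ i) r t
        have h2 := coeff_formalConn hM (j := i) (X := formalConn M l j H) (α := α)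
          (fun β hβ => ih β hβ j) r t
        rw [formalConn_comm hflat, h2, hj] at h1
        rw [Matrix.zero_apply, mul_zero] at h1
        rw [Matrix.zero_apply]
        exact ((hunit j r t _ hj0).mul_right_eq_zero).1 h1.symm
  exact fun i => MvPowerSeries.ext fun α => by rw [key, map_zero]

end FormalSolution

/-! ### Resonances and the formal normal form -/

section Resonance

variable {I ι κ : Type*} [Field κ]

/-- The matrix entry `(r, t)` is resonant in degree `α` if `μ_r - μ_t = α`. -/
def IsResonant (μ : ι → I → κ) (α : I →₀ ℕ) (r t : ι) : Prop := ∀ j, μ r j - μ t j = α j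

theorem isResonant_zero (μ : ι → I → κ) (r : ι) : IsResonant μ 0 r r := fun j => by simp

theorem IsResonant.add {μ : ι → I → κ} {α β : I →₀ ℕ} {r k t : ι} (h : IsResonant μ α r k)
    (h' : IsResonant μ β k t) : IsResonant μ (α + β) r t := fun j => by
  rw [Finsupp.add_apply, Nat.cast_add, ← h j, ← h' j]
  ring

theorem IsResonant.unique [CharZero κ] {μ : ι → I → κ} {α β : I →₀ ℕ} {r t : ι}
    (h : IsResonant μ α r t) (h' : IsResonant μ β r t) : α = β :=
  Finsupp.ext fun j => Nat.cast_injective ((h j).symm.trans (h' j))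

variable {T : Type*} [CommRing T] [Fintype ι] [DecidableEq ι]

/-- A matrix-valued power series all of whose nonresonant coefficients vanish. -/
def ResSupported (μ : ι → I → κ) (X : MvPowerSeries I (Matrix ι ι T)) : Prop :=
  ∀ α r t, ¬IsResonant μ α r t → MvPowerSeries.coeff α X r t = 0

theorem ResSupported.add {μ : ι → I → κ}
    {X Y : MvPowerSeries I (Matrix ι ι T)}
    (hX : ResSupported μ X) (hY : ResSupported μ Y) : ResSupported μ (X + Y) := fun α r t h => by
  rw [map_add, Matrix.add_apply, hX α r t h, hY α r t h, add_zero]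

theorem ResSupported.mul {μ : ι → I → κ}
    {X Y : MvPowerSeries I (Matrix ι ι T)} (hX : ResSupported μ X) (hY : ResSupported μ Y) :
    ResSupported μ (X * Y) := fun α r t h => by
  classical
  rw [MvPowerSeries.coeff_mul, Matrix.sum_apply]
  refine Finset.sum_eq_zero fun x hx => ?_
  rw [Matrix.mul_apply]
  refine Finset.sum_eq_zero fun k _ => ?_
  by_cases h1 : IsResonant μ x.1 r k
  · by_cases h2 : IsResonant μ x.2 k t
    · refine absurd ?_ h
      rw [← Finset.HasAntidiagonal.mem_antidiagonal.1 hx]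
      exact h1.add h2
    · rw [hY _ _ _ h2, mul_zero]
  · rw [hX _ _ _ h1, zero_mul]

theorem ResSupported.euler {μ : ι → I → κ}
    {X : MvPowerSeries I (Matrix ι ι T)} (hX : ResSupported μ X) (j : I) :
    ResSupported μ (euler j X) := fun α r t h => by
  rw [coeff_euler, Matrix.smul_apply, hX α r t h, smul_zero]

theorem resSupported_C_diagonal (μ : ι → I → κ) (l : ι → T) :
    ResSupported μ (MvPowerSeries.C (σ := I) (Matrix.diagonal l)) := fun α r t h => by
  classical
  rw [MvPowerSeries.coeff_C]
  split_ifs with hα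
  · subst hα
    refine Matrix.diagonal_apply_ne _ ?_
    rintro rfl
    exact h (isResonant_zero μ r)
  · rfl

theorem ResSupported.invOfUnit {μ : ι → I → κ}
    {X : MvPowerSeries I (Matrix ι ι T)} (hX : ResSupported μ X) :
    ResSupported μ (X.invOfUnit 1) := fun α => by
  classical
  induction α using multiindex_induction with
  | h α ih =>
    intro r t h
    rw [MvPowerSeries.coeff_invOfUnit]
    split_ifs with hα
    · subst hα
      rw [inv_one, Units.val_one]
      refine Matrix.one_apply_ne ?_
      rintro rfl
      exact h (isResonant_zero μ r)
    · rw [inv_one, Units.val_one, neg_mul, one_mul, Matrix.neg_apply, Matrix.sum_apply,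
        neg_eq_zero]
      refine Finset.sum_eq_zero fun x hx => ?_
      split_ifs with hx2
      · rw [Matrix.mul_apply]
        refine Finset.sum_eq_zero fun k _ => ?_
        by_cases h1 : IsResonant μ x.1 r k
        · by_cases h2 : IsResonant μ x.2 k t
          · refine absurd ?_ h
            rw [← Finset.HasAntidiagonal.mem_antidiagonal.1 hx]
            exact h1.add h2
          · rw [ih _ hx2 _ _ h2, mul_zero]
        · rw [hX _ _ _ h1, zero_mul]
      · rfl

/-- Every matrix-valued power series `H` with constant term `1` is a product `P Z`, where `Z` is
supported in the resonant entries and `P` in the nonresonant ones (in positive degree). -/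
theorem exists_resonant_factorization (μ : ι → I → κ) {H : MvPowerSeries I (Matrix ι ι T)}
    (hH : MvPowerSeries.coeff 0 H = 1) :
    ∃ P Z : MvPowerSeries I (Matrix ι ι T), MvPowerSeries.coeff 0 P = 1 ∧
      MvPowerSeries.coeff 0 Z = 1 ∧ ResSupported μ Z ∧
      (∀ α ≠ 0, ∀ r t, IsResonant μ α r t → MvPowerSeries.coeff α P r t = 0) ∧ P * Z = H := by
  classical
  have : Inhabited (Matrix ι ι T × Matrix ι ι T) := ⟨0⟩
  obtain ⟨f, hf⟩ := exists_multiindex_rec (X := Matrix ι ι T × Matrix ι ι T) (fun α f =>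
    if α = 0 then (1, 1) else
      let Y := MvPowerSeries.coeff α H -
        ∑ x ∈ Finset.HasAntidiagonal.antidiagonal α with x.1 < α ∧ x.2 < α, (f x.1).1 * (f x.2).2
      (Matrix.of fun r t => if IsResonant μ α r t then 0 else Y r t,
        Matrix.of fun r t => if IsResonant μ α r t then Y r t else 0)) (by
    intro α f g hfg
    have : ∀ x ∈ (Finset.HasAntidiagonal.antidiagonal α).filter fun x => x.1 < α ∧ x.2 < α,
        (f x.1).1 * (f x.2).2 = (g x.1).1 * (g x.2).2 := fun x hx => by
      rw [hfg _ (Finset.mem_filter.1 hx).2.1, hfg _ (Finset.mem_filter.1 hx).2.2]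
    simp only [Finset.sum_congr rfl this])
  obtain ⟨P, hP⟩ : ∃ P : MvPowerSeries I (Matrix ι ι T),
      ∀ α, (f α).1 = MvPowerSeries.coeff α P := ⟨fun α => (f α).1, fun _ => rfl⟩
  obtain ⟨Z, hZ⟩ : ∃ Z : MvPowerSeries I (Matrix ι ι T),
      ∀ α, (f α).2 = MvPowerSeries.coeff α Z := ⟨fun α => (f α).2, fun _ => rfl⟩
  simp only [hP, hZ] at hf
  have hf1 : ∀ α, MvPowerSeries.coeff α P = _ := fun α => (hP α).symm.trans
    (congrArg Prod.fst (hf α))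
  have hf2 : ∀ α, MvPowerSeries.coeff α Z = _ := fun α => (hZ α).symm.trans
    (congrArg Prod.snd (hf α))
  have hP0 : MvPowerSeries.coeff 0 P = 1 := by rw [hf1, if_pos rfl]
  have hZ0 : MvPowerSeries.coeff 0 Z = 1 := by rw [hf2, if_pos rfl]
  refine ⟨P, Z, hP0, hZ0, fun α r t h => ?_, fun α hα r t h => ?_, ?_⟩
  · by_cases hα : α = 0
    · subst hα
      rw [hZ0]
      refine Matrix.one_apply_ne ?_
      rintro rfl
      exact h (isResonant_zero μ r)
    · rw [hf2, if_neg hα]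
      simp only [Matrix.of_apply, if_neg h]
  · rw [hf1, if_neg hα]
    simp only [Matrix.of_apply, if_pos h]
  · ext α : 1
    by_cases hα : α = 0
    · rw [hα, hH, coeff_zero_mul_eq, hP0, hZ0, one_mul]
    · rw [MvPowerSeries.coeff_mul, sum_antidiagonal_eq_add_add hα]
      simp only [hP0, hZ0, one_mul, mul_one]
      have h1 := hf1 α
      have h2 := hf2 α
      rw [if_neg hα] at h1 h2
      ext r t
      rw [Matrix.add_apply, Matrix.add_apply]
      have h3 := congrFun (congrFun h1 r) t
      have h4 := congrFun (congrFun h2 r) t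
      simp only [Matrix.of_apply] at h3 h4
      rw [h3, h4]
      split_ifs <;> simp

end Resonance

section Integrality

variable {I ι κ : Type*} [Field κ] [Fintype ι] [DecidableEq ι] {S T : Type*} [CommRing S]
  [CommRing T]

omit [DecidableEq ι] in
theorem mul_apply_mem_range {φ : S →+* T} {X Y : Matrix ι ι T}
    (hX : ∀ r t, X r t ∈ φ.range) (hY : ∀ r t, Y r t ∈ φ.range) (r t : ι) :
    (X * Y) r t ∈ φ.range := by
  rw [Matrix.mul_apply]
  exact sum_mem fun k _ => mul_mem (hX r k) (hY k t)

theorem map_mapMatrix_injective {φ : S →+* T} (hφ : Function.Injective φ) :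
    Function.Injective (MvPowerSeries.map (σ := I) (φ.mapMatrix (m := ι))) := fun X Y hXY => by
  ext α r t
  refine hφ ?_
  have := congrArg (fun W : MvPowerSeries I (Matrix ι ι T) => MvPowerSeries.coeff α W r t) hXY
  simpa only [MvPowerSeries.coeff_map, RingHom.mapMatrix_apply, Matrix.map_apply] using this

/-- The normal form of an integrable connection with a logarithmic singularity: after a gauge
transformation `P` defined over `S` only resonant terms `B` remain, and these are removed over the
larger ring `T` by a resonant gauge transformation `Z`. -/
theorem exists_normal_form (μ : ι → I → κ) {φ : S →+* T} (hφ : Function.Injective φ)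
    {A : I → MvPowerSeries I (Matrix ι ι S)} {m : ι → I → S}
    (hA : ∀ j, MvPowerSeries.coeff 0 (A j) = Matrix.diagonal fun r => m r j)
    (hflat : ∀ i j, euler i (A j) - euler j (A i) = A i * A j - A j * A i)
    (hunit : ∀ (j : I) (r t : ι) (k : ℕ), k ≠ 0 → IsUnit ((k : T) - φ (m r j) + φ (m t j)))
    (hunitS : ∀ (α : I →₀ ℕ) (r t : ι), ¬IsResonant μ α r t →
      ∃ j, IsUnit ((α j : S) - m r j + m t j)) :
    ∃ (P : MvPowerSeries I (Matrix ι ι S)) (B : I → MvPowerSeries I (Matrix ι ι S))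
      (Z : MvPowerSeries I (Matrix ι ι T)),
      MvPowerSeries.coeff 0 P = 1 ∧ (∀ j, euler j P = A j * P - P * B j) ∧
      (∀ j, ResSupported μ (B j)) ∧ MvPowerSeries.coeff 0 Z = 1 ∧ ResSupported μ Z ∧
      ∀ j, formalConn (fun j => MvPowerSeries.map φ.mapMatrix (A j)) (fun r j => φ (m r j)) j
        (MvPowerSeries.map φ.mapMatrix P * Z) = 0 := by
  classical
  set M : I → MvPowerSeries I (Matrix ι ι T) := fun j =>
    MvPowerSeries.map φ.mapMatrix (A j) with hMdef
  set l : ι → I → T := fun r j => φ (m r j) with hl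
  have hM : ∀ j, MvPowerSeries.coeff 0 (M j) = Matrix.diagonal fun r => l r j := fun j => by
    rw [hMdef, MvPowerSeries.coeff_map, hA, RingHom.mapMatrix_apply,
      Matrix.diagonal_map (map_zero φ)]
  obtain ⟨H, hH0, hH⟩ := exists_formal_solution hM (fun i j => by
    simp only [hMdef, euler_map, ← map_mul, ← map_sub, hflat]) hunit
  obtain ⟨P, Z, hP0, hZ0, hZ, hP, rfl⟩ := exists_resonant_factorization μ hH0
  set D : I → MvPowerSeries I (Matrix ι ι T) := fun j =>
    MvPowerSeries.C (Matrix.diagonal fun r => l r j) with hD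
  set B : I → MvPowerSeries I (Matrix ι ι T) := fun j =>
    (euler j Z + Z * D j) * Z.invOfUnit 1 with hBdef
  have hZinv : Z * Z.invOfUnit 1 = 1 := MvPowerSeries.mul_invOfUnit _ _ (by simpa using hZ0)
  have hB : ∀ j, ResSupported μ (B j) := fun j =>
    ((hZ.euler j).add (hZ.mul (resSupported_C_diagonal μ _))).mul hZ.invOfUnit
  have hPB : ∀ j, euler j P = M j * P - P * B j := fun j => by
    have h1 := congrArg (· * Z.invOfUnit 1) (hH j)
    simp only [formalConn, euler_mul, zero_mul] at h1
    change (_ - _ + _ * D j) * _ = 0 at h1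
    have h2 : (euler j P * Z + P * euler j Z - M j * (P * Z) + P * Z * D j) * Z.invOfUnit 1 =
        euler j P * (Z * Z.invOfUnit 1) - M j * P * (Z * Z.invOfUnit 1) + P * B j := by
      rw [hBdef]
      noncomm_ring
    rw [h2, hZinv, mul_one, mul_one] at h1
    rw [← sub_eq_zero, ← h1]
    noncomm_ring
  have hB0 : ∀ j, MvPowerSeries.coeff 0 (B j) = Matrix.diagonal fun r => l r j := fun j => by
    have := congrArg (MvPowerSeries.coeff 0) (hPB j)
    rw [coeff_euler, map_sub, coeff_zero_mul_eq, coeff_zero_mul_eq, hP0, hM,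
      mul_one, one_mul, Finsupp.coe_zero, Pi.zero_apply, zero_smul] at this
    exact (sub_eq_zero.1 this.symm).symm
  have hMint : ∀ j α r t, MvPowerSeries.coeff α (M j) r t ∈ φ.range := fun j α r t =>
    ⟨MvPowerSeries.coeff α (A j) r t, by simp [hMdef]⟩
  -- By induction on `α`, the coefficients of `P` and `B` come from `S`. In each entry one of the
  -- two vanishes; the equation then gives the other one, up to the factor `α_j - m_{rj} + m_{tj}`
  -- in the case of `P`, and in that case the factor is invertible in `S` for a suitable `j`.
  have key : ∀ α, (∀ r t, MvPowerSeries.coeff α P r t ∈ φ.range) ∧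
      ∀ j r t, MvPowerSeries.coeff α (B j) r t ∈ φ.range := by
    intro α
    induction α using multiindex_induction with
    | h α ih =>
      by_cases hα : α = 0
      · subst hα
        refine ⟨fun r t => ?_, fun j r t => ?_⟩
        · rw [hP0, Matrix.one_apply]
          split_ifs
          · exact one_mem _
          · exact zero_mem _
        · rw [hB0, ← hM]
          exact hMint j 0 r t
      have hQ : ∀ j r t, ((α j : T) - l r j + l t j) * MvPowerSeries.coeff α P r t +
          MvPowerSeries.coeff α (B j) r t ∈ φ.range := by
        intro j r t
        have h1 := congrArg (MvPowerSeries.coeff α) (hPB j)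
        rw [coeff_euler, map_sub, MvPowerSeries.coeff_mul, MvPowerSeries.coeff_mul,
          sum_antidiagonal_eq_add, sum_antidiagonal_eq_add_add hα] at h1
        simp only [hM, hP0, hB0, one_mul] at h1
        have h2 := congrFun (congrFun h1 r) t
        simp only [Matrix.sub_apply, Matrix.add_apply, Matrix.smul_apply, Matrix.diagonal_mul,
          Matrix.mul_diagonal, nsmul_eq_mul] at h2
        have h3 : (∑ x ∈ Finset.HasAntidiagonal.antidiagonal α with x.2 < α,
            MvPowerSeries.coeff x.1 (M j) * MvPowerSeries.coeff x.2 P) r t ∈ φ.range := by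
          rw [Matrix.sum_apply]
          exact sum_mem fun x hx => mul_apply_mem_range (hMint j _)
            (ih _ (Finset.mem_filter.1 hx).2).1 r t
        have h4 : (∑ x ∈ Finset.HasAntidiagonal.antidiagonal α with x.1 < α ∧ x.2 < α,
            MvPowerSeries.coeff x.1 P * MvPowerSeries.coeff x.2 (B j)) r t ∈ φ.range := by
          rw [Matrix.sum_apply]
          exact sum_mem fun x hx => mul_apply_mem_range (ih _ (Finset.mem_filter.1 hx).2.1).1
            ((ih _ (Finset.mem_filter.1 hx).2.2).2 j) r t
        convert! sub_mem h3 h4 using 1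
        linear_combination h2
      have hsplit : ∀ r t, MvPowerSeries.coeff α P r t ∈ φ.range ∧
          ∀ j, MvPowerSeries.coeff α (B j) r t ∈ φ.range := by
        intro r t
        by_cases h : IsResonant μ α r t
        · have h0 := hP α hα r t h
          refine ⟨by rw [h0]; exact zero_mem _, fun j => ?_⟩
          have := hQ j r t
          rwa [h0, mul_zero, zero_add] at this
        · refine ⟨?_, fun j => by rw [hB j α r t h]; exact zero_mem _⟩
          obtain ⟨j, u, hu⟩ := hunitS α r t h
          obtain ⟨q, hq⟩ := hQ j r t
          refine ⟨↑u⁻¹ * q, ?_⟩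
          rw [map_mul, hq, hB j α r t h, add_zero]
          have : ((α j : T) - l r j + l t j) = φ u := by rw [hu]; simp [hl]
          rw [this, ← mul_assoc, ← map_mul, Units.inv_mul, map_one, one_mul]
      exact ⟨fun r t => (hsplit r t).1, fun j r t => (hsplit r t).2 j⟩
  have hlift : ∀ X : MvPowerSeries I (Matrix ι ι T),
      (∀ α r t, MvPowerSeries.coeff α X r t ∈ φ.range) →
      ∃ Y : MvPowerSeries I (Matrix ι ι S), MvPowerSeries.map φ.mapMatrix Y = X := fun X hX => by
    choose y hy using hX
    refine ⟨fun α => Matrix.of (y α), ?_⟩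
    ext α r t
    exact hy α r t
  have hinj := map_mapMatrix_injective (I := I) (ι := ι) hφ
  obtain ⟨P', hP'⟩ := hlift P fun α => (key α).1
  choose B' hB' using fun j => hlift (B j) fun α => (key α).2 j
  refine ⟨P', B', Z, ?_, fun j => hinj ?_, fun j α r t h => hφ ?_, hZ0, hZ, fun j => ?_⟩
  · ext r t
    refine hφ ?_
    have := congrFun (congrFun hP0 r) t
    rw [← hP'] at this
    simp only [MvPowerSeries.coeff_map, RingHom.mapMatrix_apply, Matrix.map_apply] at this
    rw [this, Matrix.one_apply, Matrix.one_apply]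
    split_ifs <;> simp
  · rw [← euler_map, map_sub, map_mul, map_mul, hP', hB', hPB]
  · have := hB j α r t h
    rw [← hB'] at this
    simpa using this
  · rw [hP']
    exact hH j

end Integrality

/-! ### Convergence of formal solutions -/

section Majorant

variable {I : Type*} [Fintype I]

theorem finite_degree_le (K : ℕ) : {α : I →₀ ℕ | Finsupp.degree α ≤ K}.Finite :=
  Finsupp.finite_of_degree_le K

omit [Fintype I] in
theorem degree_le_of_antidiagonal [DecidableEq I] {α : I →₀ ℕ} {x : (I →₀ ℕ) × (I →₀ ℕ)}
    (hx : x ∈ Finset.HasAntidiagonal.antidiagonal α) :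
    Finsupp.degree x.1 ≤ Finsupp.degree α ∧ Finsupp.degree x.2 ≤ Finsupp.degree α := by
  rw [← Finset.HasAntidiagonal.mem_antidiagonal.1 hx, map_add]
  exact ⟨Nat.le_add_right _ _, Nat.le_add_left _ _⟩

omit [Fintype I] in
theorem sum_antidiagonal_swap [DecidableEq I] {M : Type*} [AddCommMonoid M] (α : I →₀ ℕ)
    (f : (I →₀ ℕ) × (I →₀ ℕ) → M) :
    ∑ x ∈ Finset.HasAntidiagonal.antidiagonal α, f x.swap =
      ∑ x ∈ Finset.HasAntidiagonal.antidiagonal α, f x := by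
  conv_rhs => rw [← Finset.HasAntidiagonal.map_swap_antidiagonal, Finset.sum_map]
  rfl

/-- The majorant argument: `|α| y_α ≤ ∑ a_β y_γ` over `β + γ = α`, with `a` summable, makes `y`
summable, because the factor `|α|` eventually exceeds twice the sum of `a`. -/
theorem summable_of_degree_mul_le [DecidableEq I] {a y : (I →₀ ℕ) → ℝ} (ha0 : ∀ α, 0 ≤ a α)
    (hy0 : ∀ α, 0 ≤ y α) (ha : Summable a)
    (h : ∀ α, ((Finsupp.degree α : ℕ) : ℝ) * y α ≤
      ∑ x ∈ Finset.HasAntidiagonal.antidiagonal α, a x.1 * y x.2) : Summable y := by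
  classical
  set M := ∑' α, a α
  have hM0 : 0 ≤ M := tsum_nonneg ha0
  obtain ⟨k, hk⟩ := exists_nat_ge (2 * M + 1)
  set F : ℕ → Finset (I →₀ ℕ) := fun K => (finite_degree_le K).toFinset with hF
  have hmem : ∀ K α, α ∈ F K ↔ Finsupp.degree α ≤ K := fun K α => by simp [hF]
  set C := ∑ α ∈ F k, y α
  have hC0 : 0 ≤ C := Finset.sum_nonneg fun α _ => hy0 α
  have hbound : ∀ K, ∑ α ∈ F K, y α ≤ 2 * C := by
    intro K
    have h1 : ∑ α ∈ F K, ((Finsupp.degree α : ℕ) : ℝ) * y α ≤ M * ∑ α ∈ F K, y α := by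
      calc _ ≤ ∑ α ∈ F K, ∑ x ∈ Finset.HasAntidiagonal.antidiagonal α, a x.1 * y x.2 :=
            Finset.sum_le_sum fun α _ => h α
        _ = ∑ x ∈ (F K).biUnion Finset.HasAntidiagonal.antidiagonal, a x.1 * y x.2 := by
            rw [Finset.sum_biUnion]
            intro α _ β _ hαβ
            rw [Function.onFun, Finset.disjoint_left]
            intro x hx hx'
            exact hαβ ((Finset.HasAntidiagonal.mem_antidiagonal.1 hx).symm.trans
              (Finset.HasAntidiagonal.mem_antidiagonal.1 hx'))
        _ ≤ ∑ x ∈ F K ×ˢ F K, a x.1 * y x.2 := by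
            refine Finset.sum_le_sum_of_subset_of_nonneg (fun x hx => ?_)
              fun x _ _ => mul_nonneg (ha0 _) (hy0 _)
            obtain ⟨α, hα, hx⟩ := Finset.mem_biUnion.1 hx
            have := degree_le_of_antidiagonal hx
            rw [hmem] at hα
            rw [Finset.mem_product, hmem, hmem]
            omega
        _ = (∑ α ∈ F K, a α) * ∑ α ∈ F K, y α := by
            rw [Finset.sum_product, Finset.sum_mul_sum]
        _ ≤ M * ∑ α ∈ F K, y α := by
            have := ha.sum_le_tsum (F K) fun α _ => ha0 α
            have := Finset.sum_nonneg fun α (_ : α ∈ F K) => hy0 α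
            gcongr
    have h2 : (k : ℝ) * (∑ α ∈ F K, y α - C) ≤ ∑ α ∈ F K, ((Finsupp.degree α : ℕ) : ℝ) * y α := by
      have h3 : ∑ α ∈ F K, y α - C ≤ ∑ α ∈ F K with ¬ Finsupp.degree α ≤ k, y α := by
        rw [← Finset.sum_filter_add_sum_filter_not (F K) (fun α => Finsupp.degree α ≤ k)]
        have : ∑ α ∈ F K with Finsupp.degree α ≤ k, y α ≤ C :=
          Finset.sum_le_sum_of_subset_of_nonneg
            (fun α hα => (hmem _ _).2 (Finset.mem_filter.1 hα).2) fun α _ _ => hy0 α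
        linarith
      calc _ ≤ (k : ℝ) * ∑ α ∈ F K with ¬ Finsupp.degree α ≤ k, y α := by gcongr
        _ ≤ ∑ α ∈ F K with ¬ Finsupp.degree α ≤ k, ((Finsupp.degree α : ℕ) : ℝ) * y α := by
            rw [Finset.mul_sum]
            refine Finset.sum_le_sum fun α hα => ?_
            have := hy0 α
            have : k ≤ Finsupp.degree α := (not_le.1 (Finset.mem_filter.1 hα).2).le
            gcongr
        _ ≤ _ := Finset.sum_le_sum_of_subset_of_nonneg (Finset.filter_subset _ _)
            fun α _ _ => mul_nonneg (Nat.cast_nonneg _) (hy0 α)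
    have h4 := Finset.sum_nonneg fun α (_ : α ∈ F K) => hy0 α
    nlinarith
  refine summable_of_sum_le hy0 (c := 2 * C) fun u => ?_
  refine le_trans (Finset.sum_le_sum_of_subset_of_nonneg (fun α hα => ?_) fun α _ _ => hy0 α)
    (hbound (u.sup Finsupp.degree))
  exact (hmem _ _).2 (Finset.le_sup (f := Finsupp.degree) hα)

end Majorant

section MatrixSeries

variable {I : Type*} [Fintype I] {R : I → ENNReal} {S : Type*} [CommRing S] [Algebra ℂ⟦X⟧ S]
  {d e : ℕ} (s : Module.Basis (Fin e) ℂ⟦X⟧ S)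

/-- The sum of the truncated norms of the entries. -/
def matNorm (n : ℕ) (X : Matrix (Fin d) (Fin d) S) : ℝ := ∑ r, ∑ t, truncNorm s n (X r t)

theorem matNorm_nonneg (n : ℕ) (X : Matrix (Fin d) (Fin d) S) : 0 ≤ matNorm s n X :=
  Finset.sum_nonneg fun _ _ => Finset.sum_nonneg fun _ _ => truncNorm_nonneg s n _

theorem truncNorm_le_matNorm (n : ℕ) (X : Matrix (Fin d) (Fin d) S) (r t : Fin d) :
    truncNorm s n (X r t) ≤ matNorm s n X := by
  have h1 : truncNorm s n (X r t) ≤ ∑ t, truncNorm s n (X r t) :=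
    Finset.single_le_sum (f := fun t => truncNorm s n (X r t))
      (fun _ _ => truncNorm_nonneg s n _) (Finset.mem_univ t)
  refine h1.trans ?_
  exact Finset.single_le_sum (f := fun r => ∑ t, truncNorm s n (X r t))
    (fun _ _ => Finset.sum_nonneg fun _ _ => truncNorm_nonneg s n _) (Finset.mem_univ r)

theorem matNorm_zero (n : ℕ) : matNorm s n (0 : Matrix (Fin d) (Fin d) S) = 0 := by
  simp [matNorm, truncNorm_zero]

theorem matNorm_nsmul (n k : ℕ) (X : Matrix (Fin d) (Fin d) S) :
    matNorm s n (k • X) = k * matNorm s n X := by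
  simp only [matNorm, Matrix.smul_apply, truncNorm_nsmul, Finset.mul_sum]

theorem matNorm_sub_le (n : ℕ) (X Y : Matrix (Fin d) (Fin d) S) :
    matNorm s n (X - Y) ≤ matNorm s n X + matNorm s n Y := by
  simp only [matNorm, ← Finset.sum_add_distrib]
  exact Finset.sum_le_sum fun r _ => Finset.sum_le_sum fun t _ => truncNorm_sub_le s n _ _

theorem matNorm_sum_le (n : ℕ) {ι : Type*} (F : Finset ι) (X : ι → Matrix (Fin d) (Fin d) S) :
    matNorm s n (∑ i ∈ F, X i) ≤ ∑ i ∈ F, matNorm s n (X i) := by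
  classical
  induction F using Finset.induction_on with
  | empty => simp [matNorm_zero]
  | insert i F hi ih =>
    rw [Finset.sum_insert hi, Finset.sum_insert hi]
    have : matNorm s n (X i + ∑ i ∈ F, X i) ≤ matNorm s n (X i) + matNorm s n (∑ i ∈ F, X i) := by
      simp only [matNorm, ← Finset.sum_add_distrib]
      exact Finset.sum_le_sum fun r _ => Finset.sum_le_sum fun t _ => truncNorm_add_le s n _ _
    linarith

theorem exists_matNorm_mul_le (n : ℕ) : ∃ K : ℝ, 0 ≤ K ∧ ∀ X Y : Matrix (Fin d) (Fin d) S,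
    matNorm s n (X * Y) ≤ K * matNorm s n X * matNorm s n Y := by
  obtain ⟨K, hK, h⟩ := exists_truncNorm_mul_le s n
  refine ⟨K, hK, fun X Y => ?_⟩
  have h1 : ∀ r t, truncNorm s n ((X * Y) r t) ≤
      ∑ k, K * truncNorm s n (X r k) * truncNorm s n (Y k t) := fun r t => by
    rw [Matrix.mul_apply]
    exact (truncNorm_sum_le s n _ _).trans (Finset.sum_le_sum fun k _ => h _ _)
  calc matNorm s n (X * Y) ≤ ∑ r, ∑ t, ∑ k, K * truncNorm s n (X r k) * truncNorm s n (Y k t) :=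
        Finset.sum_le_sum fun r _ => Finset.sum_le_sum fun t _ => h1 r t
    _ = ∑ r, ∑ k, K * truncNorm s n (X r k) * ∑ t, truncNorm s n (Y k t) := by
        refine Finset.sum_congr rfl fun r _ => ?_
        rw [Finset.sum_comm]
        simp only [Finset.mul_sum]
    _ ≤ ∑ r, ∑ k, K * truncNorm s n (X r k) * matNorm s n Y := by
        refine Finset.sum_le_sum fun r _ => Finset.sum_le_sum fun k _ => ?_
        refine mul_le_mul_of_nonneg_left ?_ (mul_nonneg hK (truncNorm_nonneg s n _))
        exact Finset.single_le_sum (f := fun k => ∑ t, truncNorm s n (Y k t))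
          (fun _ _ => Finset.sum_nonneg fun _ _ => truncNorm_nonneg s n _) (Finset.mem_univ k)
    _ = _ := by
        rw [show matNorm s n X = ∑ r, ∑ k, truncNorm s n (X r k) from rfl]
        simp only [Finset.mul_sum, Finset.sum_mul]

/-- Absolute convergence of a matrix-valued power series on the polydisc, in every coefficient. -/
def IsConvergent (R : I → ENNReal) (p : MvPowerSeries I (Matrix (Fin d) (Fin d) S)) : Prop :=
  ∀ n, ∀ z ∈ polydisc R,
    Summable fun α => matNorm s n (MvPowerSeries.coeff α p) * ∏ j, ‖z j‖ ^ α j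

/-- The series of `(r, t)`-entries. -/
def entrySeries (r t : Fin d) (p : MvPowerSeries I (Matrix (Fin d) (Fin d) S)) :
    MvPowerSeries I S := fun α => MvPowerSeries.coeff α p r t

omit [Fintype I] [Algebra ℂ⟦X⟧ S] in
theorem coeff_entrySeries (r t : Fin d) (p : MvPowerSeries I (Matrix (Fin d) (Fin d) S))
    (α : I →₀ ℕ) :
    MvPowerSeries.coeff α (entrySeries r t p) = MvPowerSeries.coeff α p r t := rfl

omit [Fintype I] [Algebra ℂ⟦X⟧ S] in
theorem entrySeries_mul (r t : Fin d) (p q : MvPowerSeries I (Matrix (Fin d) (Fin d) S)) :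
    entrySeries r t (p * q) = ∑ k, entrySeries r k p * entrySeries k t q := by
  classical
  ext α
  rw [coeff_entrySeries, MvPowerSeries.coeff_mul, Matrix.sum_apply, map_sum]
  simp only [MvPowerSeries.coeff_mul, Matrix.mul_apply, coeff_entrySeries]
  rw [Finset.sum_comm]

/-- The matrix-valued function `B` is the sum of the power series `p` on the polydisc. -/
def HasExpM (R : I → ENNReal) (p : MvPowerSeries I (Matrix (Fin d) (Fin d) S))
    (B : (I → ℂ) → Matrix (Fin d) (Fin d) S) : Prop :=
  ∀ r t, HasExpS s R (entrySeries r t p) fun z => B z r t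

/-- The sum of a matrix-valued power series. -/
def evalM (p : MvPowerSeries I (Matrix (Fin d) (Fin d) S)) (z : I → ℂ) :
    Matrix (Fin d) (Fin d) S := Matrix.of fun r t => evalS s (entrySeries r t p) z

variable {s}

theorem HasExpM.isConvergent {p : MvPowerSeries I (Matrix (Fin d) (Fin d) S)}
    {B : (I → ℂ) → Matrix (Fin d) (Fin d) S} (h : HasExpM s R p B) : IsConvergent s R p := by
  intro n z hz
  simp only [matNorm, truncNorm, Finset.sum_mul]
  refine summable_sum fun r _ => summable_sum fun t _ => summable_sum fun u _ =>
    summable_sum fun k _ => ?_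
  refine (h r t u k z hz).summable.norm.congr fun α => ?_
  rw [norm_mul, norm_prod]
  simp only [norm_pow, coeff_coeffSeries, coeff_entrySeries]

theorem IsConvergent.hasExpM {p : MvPowerSeries I (Matrix (Fin d) (Fin d) S)}
    (h : IsConvergent s R p) : HasExpM s R p (evalM s p) := fun r t =>
  hasExpS_evalS fun u n z hz => Summable.of_norm_bounded (h n z hz) fun α => by
    rw [norm_mul, norm_prod]
    simp only [norm_pow]
    gcongr
    exact (norm_coeffA_le s le_rfl u _).trans (truncNorm_le_matNorm s n _ r t)

theorem HasExpM.mul {p q : MvPowerSeries I (Matrix (Fin d) (Fin d) S)}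
    {B C : (I → ℂ) → Matrix (Fin d) (Fin d) S} (hp : HasExpM s R p B) (hq : HasExpM s R q C) :
    HasExpM s R (p * q) fun z => B z * C z := fun r t => by
  rw [entrySeries_mul]
  simp only [Matrix.mul_apply]
  exact HasExpS.sum fun k _ => (hp r k).mul (hq k t)

theorem HasExpM.sub {p q : MvPowerSeries I (Matrix (Fin d) (Fin d) S)}
    {B C : (I → ℂ) → Matrix (Fin d) (Fin d) S} (hp : HasExpM s R p B) (hq : HasExpM s R q C) :
    HasExpM s R (p - q) fun z => B z - C z := fun r t => (hp r t).sub (hq r t)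

theorem HasExpM.eqOn {p : MvPowerSeries I (Matrix (Fin d) (Fin d) S)}
    {B C : (I → ℂ) → Matrix (Fin d) (Fin d) S} (hp : HasExpM s R p B) (hq : HasExpM s R p C) :
    Set.EqOn B C (polydisc R) := fun z hz => by
  ext r t
  exact (hp r t).eqOn (hq r t) hz

theorem HasExpM.eq_zero (hR : ∀ j, 0 < R j) {p : MvPowerSeries I (Matrix (Fin d) (Fin d) S)}
    {B : (I → ℂ) → Matrix (Fin d) (Fin d) S} (hp : HasExpM s R p B)
    (h0 : ∀ z ∈ polydisc R, (∀ j, z j ≠ 0) → B z = 0) : p = 0 := by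
  ext α r t
  have := (hp r t).eq_zero hR fun z hz hz0 => by rw [h0 z hz hz0, Matrix.zero_apply]
  rw [← coeff_entrySeries, this]
  simp

theorem HasExpM.apply_zero (hR : ∀ j, 0 < R j) {p : MvPowerSeries I (Matrix (Fin d) (Fin d) S)}
    {B : (I → ℂ) → Matrix (Fin d) (Fin d) S} (hp : HasExpM s R p B) :
    B 0 = MvPowerSeries.coeff 0 p := by
  ext r t
  exact (hp r t).apply_zero hR

theorem hasExpM_C (hX : Matrix (Fin d) (Fin d) S) :
    HasExpM s R (MvPowerSeries.C hX) fun _ => hX := fun r t u n z _ => by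
  classical
  have := hasSum_single (f := fun α : I →₀ ℕ => MvPowerSeries.coeff α (coeffSeries s u n
    (entrySeries r t (MvPowerSeries.C hX))) * ∏ j, z j ^ α j) 0 fun α hα => by
      rw [coeff_coeffSeries, coeff_entrySeries, MvPowerSeries.coeff_C, if_neg hα,
        Matrix.zero_apply, coeffA_zero, zero_mul]
  simpa only [coeff_coeffSeries, coeff_entrySeries, MvPowerSeries.coeff_C, if_true,
    Finsupp.coe_zero, Pi.zero_apply, pow_zero, Finset.prod_const_one, mul_one] using this

theorem isConvergent_of_finite {p : MvPowerSeries I (Matrix (Fin d) (Fin d) S)}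
    (h : {α | MvPowerSeries.coeff α p ≠ 0}.Finite) : IsConvergent s R p := fun n z _ =>
  summable_of_hasFiniteSupport <| h.subset fun α hα h0 => hα <| by
    simp only [h0, matNorm_zero, zero_mul]

/-- A formal solution of a linear system with logarithmic poles converges wherever the system does.
-/
theorem isConvergent_of_euler {M N : I → MvPowerSeries I (Matrix (Fin d) (Fin d) S)}
    (hM : ∀ j, IsConvergent s R (M j)) (hN : ∀ j, IsConvergent s R (N j))
    {P : MvPowerSeries I (Matrix (Fin d) (Fin d) S)} (hP : ∀ j, euler j P = M j * P - P * N j) :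
    IsConvergent s R P := by
  classical
  intro n z hz
  obtain ⟨K, hK, hmul⟩ := exists_matNorm_mul_le (d := d) s n
  have hw : ∀ α : I →₀ ℕ, 0 ≤ ∏ j, ‖z j‖ ^ α j := fun α =>
    Finset.prod_nonneg fun j _ => pow_nonneg (norm_nonneg _) _
  have hw2 : ∀ {α : I →₀ ℕ} {x : (I →₀ ℕ) × (I →₀ ℕ)},
      x ∈ Finset.HasAntidiagonal.antidiagonal α → ∏ j, ‖z j‖ ^ α j =
      (∏ j, ‖z j‖ ^ x.1 j) * ∏ j, ‖z j‖ ^ x.2 j := fun hx => by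
    rw [← Finset.HasAntidiagonal.mem_antidiagonal.1 hx, ← Finset.prod_mul_distrib]
    exact Finset.prod_congr rfl fun j _ => by rw [Finsupp.add_apply, pow_add]
  refine summable_of_degree_mul_le (a := fun α => ∑ j, (K * (matNorm s n
    (MvPowerSeries.coeff α (M j)) * ∏ i, ‖z i‖ ^ α i) + K * (matNorm s n
    (MvPowerSeries.coeff α (N j)) * ∏ i, ‖z i‖ ^ α i))) (fun α => ?_)
    (fun α => mul_nonneg (matNorm_nonneg s n _) (hw α)) ?_ fun α => ?_
  · exact Finset.sum_nonneg fun j _ => add_nonneg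
      (mul_nonneg hK (mul_nonneg (matNorm_nonneg s n _) (hw α)))
      (mul_nonneg hK (mul_nonneg (matNorm_nonneg s n _) (hw α)))
  · exact summable_sum fun j _ => ((hM j n z hz).mul_left K).add ((hN j n z hz).mul_left K)
  · have h1 : ∀ j, (α j : ℝ) * matNorm s n (MvPowerSeries.coeff α P) ≤
        ∑ x ∈ Finset.HasAntidiagonal.antidiagonal α, (K * matNorm s n
          (MvPowerSeries.coeff x.1 (M j)) * matNorm s n (MvPowerSeries.coeff x.2 P) +
          K * matNorm s n (MvPowerSeries.coeff x.1 (N j)) *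
            matNorm s n (MvPowerSeries.coeff x.2 P)) := by
      intro j
      have h2 := congrArg (MvPowerSeries.coeff α) (hP j)
      rw [coeff_euler, map_sub, MvPowerSeries.coeff_mul, MvPowerSeries.coeff_mul] at h2
      rw [← matNorm_nsmul, h2, Finset.sum_add_distrib]
      refine (matNorm_sub_le s n _ _).trans (add_le_add ?_ ?_)
      · exact (matNorm_sum_le s n _ _).trans (Finset.sum_le_sum fun x _ => hmul _ _)
      · refine (matNorm_sum_le s n _ _).trans ?_
        rw [← sum_antidiagonal_swap]
        refine Finset.sum_le_sum fun x _ => (hmul _ _).trans (le_of_eq ?_)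
        simp only [Prod.fst_swap, Prod.snd_swap]
        ring
    rw [Finsupp.degree_eq_sum, Nat.cast_sum, ← mul_assoc, Finset.sum_mul, Finset.sum_mul]
    calc _ ≤ ∑ j, (∑ x ∈ Finset.HasAntidiagonal.antidiagonal α, (K * matNorm s n
          (MvPowerSeries.coeff x.1 (M j)) * matNorm s n (MvPowerSeries.coeff x.2 P) +
          K * matNorm s n (MvPowerSeries.coeff x.1 (N j)) *
            matNorm s n (MvPowerSeries.coeff x.2 P))) * ∏ j, ‖z j‖ ^ α j :=
          Finset.sum_le_sum fun j _ => mul_le_mul_of_nonneg_right (h1 j) (hw α)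
      _ = _ := by
          simp only [Finset.sum_mul]
          rw [Finset.sum_comm]
          refine Finset.sum_congr rfl fun x hx => Finset.sum_congr rfl fun j _ => ?_
          rw [hw2 hx]
          ring

end MatrixSeries

/-! ### Continuation of vanishing along the universal cover -/

section Geometry

variable {I : Type*} {R : I → ENNReal}

theorem continuous_expMap : Continuous (expMap (I := I)) :=
  continuous_pi fun j => Complex.continuous_exp.comp (continuous_apply j)

theorem isOpen_logCover [Finite I] (R : I → ENNReal) : IsOpen (logCover R) :=
  (isOpen_polydisc R).preimage continuous_expMap

theorem convex_logCover (R : I → ENNReal) : Convex ℝ (logCover R) := by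
  intro ζ hζ ξ hξ a b ha hb hab j
  have h1 := hζ j
  have h2 := hξ j
  rw [← ofReal_norm] at h1 h2 ⊢
  simp only [expMap, Complex.norm_exp] at h1 h2 ⊢
  have h3 : ((a • ζ + b • ξ) j).re ≤ max (ζ j).re (ξ j).re := by
    have h4 : ((a • ζ + b • ξ) j).re = a * (ζ j).re + b * (ξ j).re := by simp
    have h5 := mul_le_mul_of_nonneg_left (le_max_left (ζ j).re (ξ j).re) ha
    have h6 := mul_le_mul_of_nonneg_left (le_max_right (ζ j).re (ξ j).re) hb
    rw [h4]
    calc _ ≤ (a + b) * max (ζ j).re (ξ j).re := by linarith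
      _ = _ := by rw [hab, one_mul]
  have h7 := ENNReal.ofReal_le_ofReal (Real.exp_le_exp.2 h3)
  rcases max_choice (ζ j).re (ξ j).re with h | h <;> rw [h] at h7
  · exact h7.trans_lt h1
  · exact h7.trans_lt h2

theorem nonempty_logCover [Finite I] (hR : ∀ j, 0 < R j) : (logCover R).Nonempty := by
  have : ∀ j, ∃ ρ : ℝ, 0 < ρ ∧ ENNReal.ofReal ρ < R j := fun j =>
    exists_radius le_rfl (by simpa using hR j)
  choose ρ h0 h1 using this
  refine ⟨fun j => (Real.log (ρ j) : ℂ), fun j => ?_⟩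
  rw [← ofReal_norm, expMap, Complex.norm_exp, Complex.ofReal_re, Real.exp_log (h0 j)]
  exact h1 j

theorem exists_log {z : I → ℂ} (hz : z ∈ polydisc R) (h0 : ∀ j, z j ≠ 0) :
    ∃ ζ ∈ logCover R, expMap ζ = z := by
  have : expMap (fun j => Complex.log (z j)) = z := funext fun j => Complex.exp_log (h0 j)
  exact ⟨_, by rwa [logCover, Set.mem_ofPred_eq, this], this⟩

end Geometry

section Gronwall

variable {I : Type*} [Fintype I] {R : I → ENNReal} {S : Type*} [CommRing S] [Algebra ℂ⟦X⟧ S]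
  {d e : ℕ} {s : Module.Basis (Fin e) ℂ⟦X⟧ S}

/-- A horizontal section whose coefficients of order at most `n` vanish at one point has vanishing
coefficients of order at most `n` everywhere: along a segment, these finitely many coefficients
satisfy a homogeneous linear differential equation. -/
theorem coeffA_eq_zero_of_horizontal {A : I → (I → ℂ) → Matrix (Fin d) (Fin d) S}
    (hA : ∀ j, IsHolomorphicA s (polydisc R) (A j)) {g : (I → ℂ) → Fin d → S}
    (hg : ∀ ζ ∈ logCover R, ∀ r,
      HasDlog s (fun ξ => g ξ r) (fun j => (A j (expMap ζ)).mulVec (g ζ) r) ζ)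
    {ζ₀ : I → ℂ} (hζ₀ : ζ₀ ∈ logCover R) {n : ℕ} (h0 : ∀ r u, ∀ k ≤ n, coeffA s u k (g ζ₀ r) = 0)
    {ζ : I → ℂ} (hζ : ζ ∈ logCover R) : ∀ r u, ∀ k ≤ n, coeffA s u k (g ζ r) = 0 := by
  set γ : ℝ → I → ℂ := fun t => ζ₀ + t • (ζ - ζ₀) with hγ
  have hγmem : ∀ t ∈ Set.Icc (0 : ℝ) 1, γ t ∈ logCover R := fun t ht =>
    (convex_logCover R).add_smul_sub_mem hζ₀ hζ ht
  have hγd : ∀ t, HasDerivAt γ (ζ - ζ₀) t := fun t => by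
    have h := ((hasDerivAt_id t).smul_const (ζ - ζ₀)).const_add ζ₀
    rw [one_smul] at h
    exact h
  have hγc : Continuous γ := continuous_iff_continuousAt.2 fun t => (hγd t).continuousAt
  set y : ℝ → (Fin d × Fin e × Fin (n + 1) → ℂ) := fun t i => coeffA s i.2.1 i.2.2 (g (γ t) i.1)
    with hy
  set y' : ℝ → (Fin d × Fin e × Fin (n + 1) → ℂ) := fun t i => ∑ j,
    coeffA s i.2.1 i.2.2 ((A j (expMap (γ t))).mulVec (g (γ t)) i.1) * (ζ - ζ₀) j with hy'
  have hyd : ∀ t ∈ Set.Icc (0 : ℝ) 1, HasDerivAt y (y' t) t := fun t ht => by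
    rw [hasDerivAt_pi]
    intro i
    have h1 := ((hg (γ t) (hγmem t ht) i.1 i.2.1 i.2.2).restrictScalars ℝ).comp_hasDerivAt t
      (hγd t)
    convert! h1 using 1
    simp only [ContinuousLinearMap.coe_restrictScalars', dlogForm_apply, hy']
  obtain ⟨K, hK, hmul⟩ := exists_truncNorm_mul_le s n
  -- a bound for the coefficients of the connection along the segment
  have hAb : ∃ C, 0 ≤ C ∧ ∀ t ∈ Set.Icc (0 : ℝ) 1, ∀ j, matNorm s n (A j (expMap (γ t))) ≤ C := by
    have hc : ContinuousOn (fun t => ∑ j, matNorm s n (A j (expMap (γ t))))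
        (Set.Icc (0 : ℝ) 1) := by
      simp only [matNorm, truncNorm]
      refine continuousOn_finsetSum _ fun j _ => continuousOn_finsetSum _ fun r _ =>
        continuousOn_finsetSum _ fun t _ => continuousOn_finsetSum _ fun u _ =>
        continuousOn_finsetSum _ fun k _ => ContinuousOn.norm ?_
      exact (hA j r t u k).continuousOn.comp (continuous_expMap.comp hγc).continuousOn
        fun t ht => hγmem t ht
    obtain ⟨C, hC⟩ := isCompact_Icc.exists_bound_of_continuousOn hc
    refine ⟨C, (norm_nonneg _).trans (hC 0 (by simp)), fun t ht j => ?_⟩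
    refine le_trans ?_ ((le_abs_self _).trans (hC t ht))
    exact Finset.single_le_sum (f := fun j => matNorm s n (A j (expMap (γ t))))
      (fun _ _ => matNorm_nonneg s n _) (Finset.mem_univ j)
  obtain ⟨C, hC0, hC⟩ := hAb
  have htr : ∀ t k, truncNorm s n (g (γ t) k) ≤ e * (n + 1) * ‖y t‖ := fun t k => by
    have : ∀ u, ∀ l ∈ Finset.range (n + 1), ‖coeffA s u l (g (γ t) k)‖ ≤ ‖y t‖ := fun u l hl => by
      have h := norm_le_pi_norm (y t) (k, u, ⟨l, Finset.mem_range.1 hl⟩)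
      simpa only [hy] using h
    have h2 : ∑ _u : Fin e, ∑ _l ∈ Finset.range (n + 1), ‖y t‖ = e * (n + 1) * ‖y t‖ := by
      simp only [Finset.sum_const, Finset.card_univ, Fintype.card_fin, Finset.card_range,
        nsmul_eq_mul, Nat.cast_add, Nat.cast_one, mul_assoc]
    rw [← h2]
    exact Finset.sum_le_sum fun u _ => Finset.sum_le_sum fun l hl => this u l hl
  have hb : ∀ t ∈ Set.Ico (0 : ℝ) 1, ‖y' t‖ ≤
      (∑ j, (∑ _k : Fin d, K * C * (e * (n + 1))) * ‖(ζ - ζ₀) j‖) * ‖y t‖ := by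
    intro t ht
    refine (pi_norm_le_iff_of_nonneg (by positivity)).2 fun i => ?_
    refine (norm_sum_le _ _).trans ?_
    rw [Finset.sum_mul]
    refine Finset.sum_le_sum fun j _ => ?_
    rw [norm_mul, mul_right_comm]
    refine mul_le_mul_of_nonneg_right ?_ (norm_nonneg _)
    refine (norm_coeffA_le s (Nat.lt_succ_iff.1 i.2.2.2) _ _).trans ?_
    rw [Matrix.mulVec, dotProduct]
    refine (truncNorm_sum_le s n _ _).trans ?_
    rw [Finset.sum_mul]
    refine Finset.sum_le_sum fun k _ => (hmul _ _).trans ?_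
    have h1 := (truncNorm_le_matNorm s n _ i.1 k).trans (hC t (Set.Ico_subset_Icc_self ht) j)
    have h2 := htr t k
    have h3 := truncNorm_nonneg s n (g (γ t) k)
    calc _ ≤ K * C * (e * (n + 1) * ‖y t‖) := by gcongr
      _ = _ := by ring
  have hy0 : y 0 = 0 := by
    funext i
    have : γ 0 = ζ₀ := by simp [hγ]
    simp only [hy, this]
    exact h0 _ _ _ (Nat.lt_succ_iff.1 i.2.2.2)
  have h1 := eq_zero_of_abs_deriv_le_mul_abs_self_of_eq_zero_right
    (fun t ht => (hyd t ht).continuousAt.continuousWithinAt)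
    (fun t ht => (hyd t (Set.Ico_subset_Icc_self ht)).hasDerivWithinAt) hy0 hb 1 (by simp)
  intro r u k hk
  have h2 := congrFun h1 (r, u, ⟨k, Nat.lt_succ_of_le hk⟩)
  have h3 : γ 1 = ζ := by simp [hγ]
  simpa only [hy, h3, Pi.zero_apply] using h2

end Gronwall

/-! ### The generic fibre and the residue field -/

section Scalars

variable {S : Type*} [CommRing S] [Algebra ℂ⟦X⟧ S] {e : ℕ}

variable (S) in
/-- The power `ϖ ^ N` in `S`. -/
def powS (N : ℕ) : S := algebraMap ℂ⟦X⟧ S (PowerSeries.X ^ N)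

theorem powS_add (N N' : ℕ) : powS S (N + N') = powS S N * powS S N' := by
  rw [powS, pow_add, map_mul]
  rfl

theorem coeffA_powS_mul (s : Module.Basis (Fin e) ℂ⟦X⟧ S) (u : Fin e) (n N : ℕ) (x : S) :
    coeffA s u n (powS S N * x) = if N ≤ n then coeffA s u (n - N) x else 0 := by
  rw [powS, ← Algebra.smul_def, coeffA, map_smul, Finsupp.smul_apply, smul_eq_mul,
    PowerSeries.coeff_X_pow_mul', coeffA]

/-- The quotient by `ϖ ^ N`, omitting the coefficients of order less than `N`. -/
def divS (s : Module.Basis (Fin e) ℂ⟦X⟧ S) (N : ℕ) (x : S) : S :=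
  ofCoeffs s fun u n => coeffA s u (n + N) x

theorem divS_powS_mul (s : Module.Basis (Fin e) ℂ⟦X⟧ S) (N : ℕ) (x : S) :
    divS s N (powS S N * x) = x := coeffA_ext s fun u n => by
  rw [divS, coeffA_ofCoeffs, coeffA_powS_mul, if_pos (Nat.le_add_left _ _), Nat.add_sub_cancel]

theorem powS_mul_divS (s : Module.Basis (Fin e) ℂ⟦X⟧ S) {N : ℕ} {x : S}
    (hx : ∀ u, ∀ k < N, coeffA s u k x = 0) : powS S N * divS s N x = x :=
  coeffA_ext s fun u n => by
    rw [coeffA_powS_mul, divS, coeffA_ofCoeffs]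
    split_ifs with h
    · rw [Nat.sub_add_cancel h]
    · rw [hx u n (not_le.1 h)]

/-- The properties of the ring `S_F` that matter here, with respect to the map `S → S_F`, the powers
`ϖ ^ (-N)` and the coefficient functions of `S_F`. -/
structure LaurentExtension (s : Module.Basis (Fin e) ℂ⟦X⟧ S) (T : Type*) [CommRing T] where
  /-- The map `S → S_F`. -/
  map : S →+* T
  /-- The element `ϖ ^ (-N)`. -/
  inv : ℕ → T
  /-- The coefficient of `ϖ ^ n` in the `u`-th coordinate. -/
  coeff : Fin e → ℤ → T → ℂ
  inv_mul_map_powS : ∀ N, inv N * map (powS S N) = 1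
  coeff_natCast : ∀ u (n N : ℕ) x, coeff u (n - N) (inv N * map x) = coeffA s u n x
  coeff_of_lt : ∀ u (n : ℤ) (N : ℕ) x, n < -N → coeff u n (inv N * map x) = 0
  exists_of_coeff : ∀ (N : ℕ) y, (∀ u (n : ℤ), n < -N → coeff u n y = 0) → ∃ x, y = inv N * map x
  exists_eq : ∀ y, ∃ N x, y = inv N * map x

namespace LaurentExtension

variable {s : Module.Basis (Fin e) ℂ⟦X⟧ S} {T : Type*} [CommRing T] (E : LaurentExtension s T)

theorem inv_mul_map_injective (N : ℕ) {x y : S} (h : E.inv N * E.map x = E.inv N * E.map y) :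
    x = y := coeffA_ext s fun u n => by
  rw [← E.coeff_natCast u n N, h, E.coeff_natCast]

theorem map_injective : Function.Injective E.map := fun x y h =>
  E.inv_mul_map_injective 0 (by rw [h])

theorem inv_add (N N' : ℕ) : E.inv (N + N') = E.inv N * E.inv N' := by
  have h1 := E.inv_mul_map_powS (N + N')
  rw [powS_add, map_mul] at h1
  linear_combination (-E.inv (N + N')) * E.inv_mul_map_powS N * E.inv N' * E.map (powS S N') -
    E.inv (N + N') * E.inv_mul_map_powS N' + E.inv N * E.inv N' * h1

theorem exists_of_le {N N' : ℕ} (h : N ≤ N') (x : S) :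
    ∃ x', E.inv N * E.map x = E.inv N' * E.map x' := by
  obtain ⟨k, rfl⟩ := Nat.exists_eq_add_of_le h
  refine ⟨powS S k * x, ?_⟩
  rw [map_mul, inv_add]
  linear_combination (-(E.inv N * E.map x)) * E.inv_mul_map_powS k

/-- A finite family of elements of `S_F` has a common denominator. -/
theorem exists_common_denominator {ι : Type*} [Finite ι] (y : ι → T) :
    ∃ N, ∃ x : ι → S, ∀ i, y i = E.inv N * E.map (x i) := by
  have := Fintype.ofFinite ι
  choose N x hx using fun i => E.exists_eq (y i)
  choose x' hx' using fun i => E.exists_of_le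
    (Finset.single_le_sum (f := N) (fun _ _ => Nat.zero_le _) (Finset.mem_univ i)) (x i)
  exact ⟨∑ i, N i, x', fun i => (hx i).trans (hx' i)⟩

theorem hasDlog_iff {I : Type*} [Fintype I] (N : ℕ) {g : (I → ℂ) → S} {g' : I → S} {ζ : I → ℂ} :
    HasDlog s g g' ζ ↔ ∀ u n, HasFDerivAt (𝕜 := ℂ) (fun ξ => E.coeff u n (E.inv N * E.map (g ξ)))
      (dlogForm fun j => E.coeff u n (E.inv N * E.map (g' j))) ζ := by
  constructor
  · intro h u n
    by_cases hn : n < -N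
    · simp only [E.coeff_of_lt u n N _ hn]
      refine (hasFDerivAt_const (𝕜 := ℂ) (0 : ℂ) ζ).congr_fderiv ?_
      ext v
      simp [dlogForm_apply]
    · obtain ⟨k, rfl⟩ : ∃ k : ℕ, n = k - N := ⟨(n + N).toNat, by omega⟩
      simp only [E.coeff_natCast]
      exact h u k
  · intro h u n
    simpa only [E.coeff_natCast] using h u (n - N)

end LaurentExtension

/-- The element `ϖ ^ (-N)` of `S_F`. -/
def invPow (S : Type*) [CommRing S] [Algebra ℂ⟦X⟧ S] (N : ℕ) : GenericFibre S :=
  (HahnSeries.single (-(N : ℤ)) (1 : ℂ) : ℂ⸨X⸩) ⊗ₜ[ℂ⟦X⟧] (1 : S)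

theorem invPow_mul_toGeneric (N : ℕ) (x : S) : invPow S N * toGeneric S x =
    (HahnSeries.single (-(N : ℤ)) (1 : ℂ) : ℂ⸨X⸩) ⊗ₜ[ℂ⟦X⟧] x := by
  change (_ ⊗ₜ[ℂ⟦X⟧] (1 : S)) * ((1 : ℂ⸨X⸩) ⊗ₜ[ℂ⟦X⟧] x) = _
  rw [Algebra.TensorProduct.tmul_mul_tmul, one_mul]
  congr 1
  exact mul_one _

variable (s : Module.Basis (Fin e) ℂ⟦X⟧ S)

theorem coeffF_invPow_mul_toGeneric (u : Fin e) (n : ℤ) (N : ℕ) (x : S) :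
    coeffF s u n (invPow S N * toGeneric S x) =
      if n + N < 0 then 0 else coeffA s u (n + N).natAbs x := by
  have h : (s.baseChange ℂ⸨X⸩).repr (invPow S N * toGeneric S x) u =
      HahnSeries.single (-(N : ℤ)) (1 : ℂ) * ((s.repr x u : ℂ⟦X⟧) : ℂ⸨X⸩) := by
    rw [invPow_mul_toGeneric, Module.Basis.baseChange_repr_tmul, Algebra.smul_def, mul_comm]
    rfl
  have h2 := HahnSeries.coeff_single_mul_add (r := (1 : ℂ))
    (x := ((s.repr x u : ℂ⟦X⟧) : ℂ⸨X⸩)) (a := n + N) (b := -(N : ℤ))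
  rw [one_mul, add_neg_cancel_right] at h2
  rw [coeffF, h, h2, PowerSeries.coeff_coe, coeffA]

theorem invPow_mul_toGeneric_powS (N : ℕ) : invPow S N * toGeneric S (powS S N) = 1 := by
  rw [invPow_mul_toGeneric, powS, Algebra.algebraMap_eq_smul_one, TensorProduct.tmul_smul,
    TensorProduct.smul_tmul', Algebra.smul_def, Algebra.TensorProduct.one_def]
  congr 1
  change ((PowerSeries.X ^ N : ℂ⟦X⟧) : ℂ⸨X⸩) * _ = _
  rw [PowerSeries.coe_pow, PowerSeries.coe_X, HahnSeries.single_pow, HahnSeries.single_mul_single]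
  simp

theorem coeffF_ext {x y : GenericFibre S} (h : ∀ u n, coeffF s u n x = coeffF s u n y) : x = y :=
  (s.baseChange ℂ⸨X⸩).ext_elem fun u => HahnSeries.ext (funext fun n => h u n)

theorem exists_eq_invPow_mul_of_coeffF (N : ℕ) {y : GenericFibre S}
    (h : ∀ u (n : ℤ), n < -N → coeffF s u n y = 0) : ∃ x, y = invPow S N * toGeneric S x := by
  refine ⟨ofCoeffs s fun u n => coeffF s u (n - N) y, coeffF_ext s fun u n => ?_⟩
  rw [coeffF_invPow_mul_toGeneric, coeffA_ofCoeffs]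
  split_ifs with hn
  · exact h u n (by omega)
  · congr 1
    omega

include s in
theorem exists_eq_invPow_mul (y : GenericFibre S) : ∃ N, ∃ x, y = invPow S N * toGeneric S x := by
  set c := fun u => (s.baseChange ℂ⸨X⸩).repr y u
  refine ⟨∑ u, (c u).order.natAbs, exists_eq_invPow_mul_of_coeffF s _ fun u n hn => ?_⟩
  refine HahnSeries.coeff_eq_zero_of_lt_order ?_
  have h : (c u).order.natAbs ≤ ∑ u, (c u).order.natAbs :=
    Finset.single_le_sum (f := fun u => (c u).order.natAbs) (fun _ _ => Nat.zero_le _)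
      (Finset.mem_univ u)
  change n < (c u).order
  omega

/-- The generic fibre is a Laurent extension. -/
def genericExtension : LaurentExtension s (GenericFibre S) where
  map := toGeneric S
  inv := invPow S
  coeff := coeffF s
  inv_mul_map_powS := invPow_mul_toGeneric_powS
  coeff_natCast u n N x := by
    refine (coeffF_invPow_mul_toGeneric s u _ N x).trans ?_
    rw [sub_add_cancel, if_neg (by omega), Int.natAbs_natCast]
  coeff_of_lt u n N x hn := by
    refine (coeffF_invPow_mul_toGeneric s u _ N x).trans ?_
    rw [if_pos (by omega)]
  exists_of_coeff N _ h := exists_eq_invPow_mul_of_coeffF s N h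
  exists_eq := exists_eq_invPow_mul s

end Scalars

section Residue

variable {S : Type*} [CommRing S] [Algebra ℂ⟦X⟧ S] [IsLocalRing (SpecialFibre S)]

/-- The residue field contains `ℂ`. -/
theorem charZero_residueField : CharZero (IsLocalRing.ResidueField (SpecialFibre S)) :=
  charZero_of_injective_ringHom
    ((residueMap S).comp ((algebraMap ℂ⟦X⟧ S).comp PowerSeries.C)).injective

/-- `S` is local: an element with nonzero residue is invertible, by Nakayama's lemma. -/
theorem isUnit_of_residueMap_ne_zero [Module.Finite ℂ⟦X⟧ S] {x : S} (hx : residueMap S x ≠ 0) :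
    IsUnit x := by
  have h1 : IsUnit (Ideal.Quotient.mk (Ideal.span {algebraMap ℂ⟦X⟧ S PowerSeries.X}) x) :=
    (IsLocalRing.residue_ne_zero_iff_isUnit _).1 hx
  obtain ⟨y, hy⟩ := h1.exists_right_inv
  obtain ⟨y, rfl⟩ := Ideal.Quotient.mk_surjective y
  rw [← map_mul, ← map_one (Ideal.Quotient.mk _), Ideal.Quotient.eq,
    Ideal.mem_span_singleton'] at hy
  obtain ⟨w, hw⟩ := hy
  have h2 : (⊤ : Submodule ℂ⟦X⟧ S) ≤ (Ideal.span {x}).restrictScalars ℂ⟦X⟧ := by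
    refine Submodule.le_of_le_smul_of_le_jacobson_bot (I := Ideal.span {PowerSeries.X})
      Module.Finite.fg_top ?_ fun c _ => ?_
    · rw [← PowerSeries.maximalIdeal_eq_span_X]
      exact IsLocalRing.maximalIdeal_le_jacobson _
    · have : c = c * y * x + (PowerSeries.X : ℂ⟦X⟧) • (-(c * w)) := by
        rw [Algebra.smul_def]
        linear_combination c * hw
      rw [this]
      exact Submodule.add_mem_sup (Ideal.mul_mem_left _ _ (Ideal.mem_span_singleton_self x))
        (Submodule.smul_mem_smul (Ideal.mem_span_singleton_self _) trivial)
  have h3 := h2 (x := 1) trivial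
  rw [Submodule.restrictScalars_mem, Ideal.mem_span_singleton] at h3
  exact isUnit_of_dvd_one h3

end Residue

/-! ### Normalized solutions and their formal expansions -/

section FormalLinear

variable {I ι : Type*} [Fintype ι] [DecidableEq ι] {T : Type*} [CommRing T]

theorem formalConn_sub (M : I → MvPowerSeries I (Matrix ι ι T)) (l : ι → I → T) (j : I)
    (X Y : MvPowerSeries I (Matrix ι ι T)) :
    formalConn M l j (X - Y) = formalConn M l j X - formalConn M l j Y := by
  simp only [formalConn, euler_sub, mul_sub, sub_mul]
  abel

theorem formalConn_smul (M : I → MvPowerSeries I (Matrix ι ι T)) (l : ι → I → T) (j : I) (c : T)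
    (X : MvPowerSeries I (Matrix ι ι T)) :
    formalConn M l j (c • X) = c • formalConn M l j X := by
  have h : euler j (c • X) = c • euler j X := by
    ext α : 1
    have hc : ∀ Y : MvPowerSeries I (Matrix ι ι T),
        MvPowerSeries.coeff α (c • Y) = c • MvPowerSeries.coeff α Y := fun _ => rfl
    rw [coeff_euler, hc, hc, coeff_euler, smul_comm]
  simp only [formalConn, h, mul_smul_comm, smul_mul_assoc, smul_add, smul_sub]

theorem formalConn_map {S : Type*} [CommRing S] (φ : S →+* T)
    (M : I → MvPowerSeries I (Matrix ι ι S)) (l : ι → I → S) (j : I)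
    (X : MvPowerSeries I (Matrix ι ι S)) :
    formalConn (fun j => MvPowerSeries.map φ.mapMatrix (M j)) (fun r j => φ (l r j)) j
      (MvPowerSeries.map φ.mapMatrix X) = MvPowerSeries.map φ.mapMatrix (formalConn M l j X) := by
  have h : (Matrix.diagonal fun r => φ (l r j)) = φ.mapMatrix (Matrix.diagonal fun r => l r j) := by
    rw [RingHom.mapMatrix_apply, Matrix.diagonal_map (map_zero φ)]
  rw [formalConn, formalConn, map_add, map_sub, map_mul, map_mul, euler_map, MvPowerSeries.map_C, h]

end FormalLinear

section FormalAnalytic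

variable {I : Type*} [Fintype I] {R : I → ENNReal} {S : Type*} [CommRing S] [Algebra ℂ⟦X⟧ S]
  {d e : ℕ} {s : Module.Basis (Fin e) ℂ⟦X⟧ S}

theorem exists_hasExpM (hR : ∀ j, 0 < R j) {B : (I → ℂ) → Matrix (Fin d) (Fin d) S}
    (hB : IsHolomorphicA s (polydisc R) B) : ∃ p, HasExpM s R p B := by
  choose p hp using fun r t => exists_hasExpS hR (hB r t)
  exact ⟨fun α => Matrix.of fun r t => MvPowerSeries.coeff α (p r t), hp⟩

theorem HasExpM.add {p q : MvPowerSeries I (Matrix (Fin d) (Fin d) S)}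
    {B C : (I → ℂ) → Matrix (Fin d) (Fin d) S} (hp : HasExpM s R p B) (hq : HasExpM s R q C) :
    HasExpM s R (p + q) fun z => B z + C z := fun r t => (hp r t).add (hq r t)

omit [Fintype I] [Algebra ℂ⟦X⟧ S] in
theorem entrySeries_euler (j : I) (r t : Fin d)
    (p : MvPowerSeries I (Matrix (Fin d) (Fin d) S)) :
    entrySeries r t (euler j p) = euler j (entrySeries r t p) := by
  ext α
  rw [coeff_entrySeries, coeff_euler, coeff_euler, coeff_entrySeries, Matrix.smul_apply]

theorem HasExpM.logDeriv {p : MvPowerSeries I (Matrix (Fin d) (Fin d) S)}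
    {B : (I → ℂ) → Matrix (Fin d) (Fin d) S} (hp : HasExpM s R p B) (j : I) :
    HasExpM s R (euler j p) (evalM s (euler j p)) := fun r t => by
  simp only [evalM, Matrix.of_apply, entrySeries_euler]
  exact (hp r t).logDeriv j

/-- Flatness of the connection, as an identity of formal power series. -/
theorem flat_of_isIntegrable [DecidableEq I] (hR : ∀ j, 0 < R j)
    {A : I → (I → ℂ) → Matrix (Fin d) (Fin d) S} (hflat : IsIntegrable s (polydisc R) A)
    {a : I → MvPowerSeries I (Matrix (Fin d) (Fin d) S)} (ha : ∀ j, HasExpM s R (a j) (A j))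
    (i j : I) : euler i (a j) - euler j (a i) = a i * a j - a j * a i := by
  rw [← sub_eq_zero]
  refine ((((ha j).logDeriv i).sub ((ha i).logDeriv j)).sub
    (((ha i).mul (ha j)).sub ((ha j).mul (ha i)))).eq_zero hR fun z hz _ => ?_
  rw [sub_eq_zero]
  ext r t
  refine coeffA_ext s fun u n => ?_
  rw [← hflat i j z hz r t u n, ← (ha j r t).coeffA_evalS_euler i hz,
    ← (ha i r t).coeffA_evalS_euler j hz, Matrix.sub_apply, coeffA_sub, evalM, evalM,
    Matrix.of_apply, Matrix.of_apply, entrySeries_euler, entrySeries_euler]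

theorem hasExpM_formalConn {A : I → (I → ℂ) → Matrix (Fin d) (Fin d) S}
    {a : I → MvPowerSeries I (Matrix (Fin d) (Fin d) S)} (ha : ∀ j, HasExpM s R (a j) (A j))
    (m : Fin d → I → S) {K : MvPowerSeries I (Matrix (Fin d) (Fin d) S)}
    {f : (I → ℂ) → Matrix (Fin d) (Fin d) S} (hK : HasExpM s R K f) (j : I) :
    HasExpM s R (formalConn a m j K) fun z =>
      evalM s (euler j K) z - A j z * f z + f z * Matrix.diagonal fun r => m r j :=
  ((hK.logDeriv j).sub ((ha j).mul hK)).add (hK.mul (hasExpM_C _))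

/-- The logarithmic derivatives of `f z ^ {A_0}` in terms of the expansion of `f`. -/
theorem hasDlog_mul_zPow (m : Fin d → I → S) {K : MvPowerSeries I (Matrix (Fin d) (Fin d) S)}
    {f : (I → ℂ) → Matrix (Fin d) (Fin d) S} (hK : HasExpM s R K f) {ζ : I → ℂ}
    (hζ : ζ ∈ logCover R) (r t : Fin d) :
    HasDlog s (fun ξ => (f (expMap ξ) * Matrix.diagonal fun t => zPow s m t ξ) r t)
      (fun j => ((evalM s (euler j K) (expMap ζ) +
        f (expMap ζ) * Matrix.diagonal fun r => m r j) *
          Matrix.diagonal fun t => zPow s m t ζ) r t) ζ := by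
  simp only [Matrix.mul_diagonal, Matrix.add_apply]
  refine (((hK r t).hasDlog hζ).mul (hasDlog_zPow s m t ζ)).congr_deriv fun j => ?_
  rw [evalM, Matrix.of_apply, entrySeries_euler]
  ring

theorem diagonal_zPow_mul_neg (m : Fin d → I → S) (ζ : I → ℂ) :
    (Matrix.diagonal fun t => zPow s m t ζ) * (Matrix.diagonal fun t => zPow s (-m) t ζ) = 1 := by
  simp only [Matrix.diagonal_mul_diagonal, zPow_mul_zPow_neg, Matrix.diagonal_one]

variable {A : I → (I → ℂ) → Matrix (Fin d) (Fin d) S}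
  {a : I → MvPowerSeries I (Matrix (Fin d) (Fin d) S)} (ha : ∀ j, HasExpM s R (a j) (A j))
  {m : Fin d → I → S} {K : MvPowerSeries I (Matrix (Fin d) (Fin d) S)}
  {f : (I → ℂ) → Matrix (Fin d) (Fin d) S} (hK : HasExpM s R K f)

include ha hK

/-- A formal solution of the gauge equation gives a horizontal matrix `f z ^ {A_0}`. -/
theorem hasDlog_of_formalConn_eq_zero (h : ∀ j, formalConn a m j K = 0) {ζ : I → ℂ}
    (hζ : ζ ∈ logCover R) (r t : Fin d) :
    HasDlog s (fun ξ => (f (expMap ξ) * Matrix.diagonal fun t => zPow s m t ξ) r t)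
      (fun j => (A j (expMap ζ) * (f (expMap ζ) * Matrix.diagonal fun t => zPow s m t ζ)) r t)
      ζ := by
  refine (hasDlog_mul_zPow m hK hζ r t).congr_deriv fun j => ?_
  have h1 := (hasExpM_formalConn ha m hK j).eqOn (C := fun _ => 0)
    (by rw [h j]; simpa using hasExpM_C (s := s) (R := R) (0 : Matrix (Fin d) (Fin d) S)) hζ
  beta_reduce at h1
  have h2 : evalM s (euler j K) (expMap ζ) + f (expMap ζ) * (Matrix.diagonal fun r => m r j) =
      A j (expMap ζ) * f (expMap ζ) := by
    rw [← sub_eq_zero, ← h1]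
    abel
  rw [h2, mul_assoc]

/-- Conversely, if `f z ^ {A_0}` is horizontal, the expansion of `f` solves the gauge equation. -/
theorem formalConn_eq_zero_of_hasDlog (hR : ∀ j, 0 < R j)
    (h : ∀ ζ ∈ logCover R, ∀ r t,
      HasDlog s (fun ξ => (f (expMap ξ) * Matrix.diagonal fun t => zPow s m t ξ) r t)
        (fun j => (A j (expMap ζ) * (f (expMap ζ) * Matrix.diagonal fun t => zPow s m t ζ)) r t)
        ζ) (j : I) : formalConn a m j K = 0 := by
  refine (hasExpM_formalConn ha m hK j).eq_zero hR fun z hz hz0 => ?_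
  obtain ⟨ζ, hζ, rfl⟩ := exists_log hz hz0
  have h1 : (evalM s (euler j K) (expMap ζ) + f (expMap ζ) * Matrix.diagonal fun r => m r j) *
      (Matrix.diagonal fun t => zPow s m t ζ) =
      A j (expMap ζ) * (f (expMap ζ) * Matrix.diagonal fun t => zPow s m t ζ) := by
    ext r t
    exact congrFun ((hasDlog_mul_zPow m hK hζ r t).unique (h ζ hζ r t)) j
  have h2 := congrArg (· * Matrix.diagonal fun t => zPow s (-m) t ζ) h1
  simp only [mul_assoc, diagonal_zPow_mul_neg, mul_one] at h2
  rw [sub_add_eq_add_sub, sub_eq_zero, h2]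

end FormalAnalytic

section NormalizedSolutions

variable {I : Type*} [Fintype I] {S : Type*} [CommRing S] [Algebra ℂ⟦X⟧ S]
  {d e : ℕ} {s : Module.Basis (Fin e) ℂ⟦X⟧ S} {T : Type*} [CommRing T]

namespace LaurentExtension

variable (E : LaurentExtension s T)

/-- The matrix `H z ^ {A_0}` over a Laurent extension. -/
def fundMatrix (m : Fin d → I → S) (H : (I → ℂ) → Matrix (Fin d) (Fin d) T) (ζ : I → ℂ) :
    Matrix (Fin d) (Fin d) T :=
  H (expMap ζ) * Matrix.diagonal fun r => E.map (zPow s m r ζ)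

/-- The counterpart of `IsNormalizedSolution` over a Laurent extension. -/
structure IsSolution (R : I → ENNReal) (A : I → (I → ℂ) → Matrix (Fin d) (Fin d) S)
    (m : Fin d → I → S) (H : (I → ℂ) → Matrix (Fin d) (Fin d) T) : Prop where
  holomorphic : ∀ (r t : Fin d) (u : Fin e) (n : ℤ),
    DifferentiableOn ℂ (fun z => E.coeff u n (H z r t)) (polydisc R)
  bounded : ∃ N : ℤ, ∀ z ∈ polydisc R, ∀ (r t : Fin d) (u : Fin e) (n : ℤ), n < N →
    E.coeff u n (H z r t) = 0
  map_zero : H 0 = 1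
  horizontal : ∀ ζ ∈ logCover R, ∀ (r t : Fin d) (u : Fin e) (n : ℤ),
    HasFDerivAt (𝕜 := ℂ) (fun ξ => E.coeff u n (E.fundMatrix m H ξ r t))
      (dlogForm fun j => E.coeff u n (((A j (expMap ζ)).map E.map * E.fundMatrix m H ζ) r t)) ζ

/-- The matrix `ϖ ^ (-N) X` over `S_F`. -/
def scaled (N : ℕ) (X : Matrix (Fin d) (Fin d) S) : Matrix (Fin d) (Fin d) T :=
  E.inv N • X.map E.map

theorem scaled_apply (N : ℕ) (X : Matrix (Fin d) (Fin d) S) (r t : Fin d) :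
    E.scaled N X r t = E.inv N * E.map (X r t) := rfl

theorem scaled_mul_map (N : ℕ) (X Y : Matrix (Fin d) (Fin d) S) :
    E.scaled N X * Y.map E.map = E.scaled N (X * Y) := by
  rw [scaled, scaled, Matrix.map_mul, smul_mul_assoc]

theorem map_mul_scaled (N : ℕ) (X Y : Matrix (Fin d) (Fin d) S) :
    X.map E.map * E.scaled N Y = E.scaled N (X * Y) := by
  rw [scaled, scaled, Matrix.map_mul, mul_smul_comm]

theorem scaled_mul_scaled (N N' : ℕ) (X Y : Matrix (Fin d) (Fin d) S) :
    E.scaled N X * E.scaled N' Y = E.scaled (N + N') (X * Y) := by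
  rw [scaled, scaled, scaled, Matrix.map_mul, smul_mul_smul_comm, inv_add]

theorem scaled_powS_smul (N : ℕ) (X : Matrix (Fin d) (Fin d) S) :
    E.scaled N (powS S N • X) = X.map E.map := by
  ext r t
  rw [scaled_apply, Matrix.smul_apply, smul_eq_mul, map_mul, ← mul_assoc, inv_mul_map_powS,
    one_mul, Matrix.map_apply]

theorem scaled_injective (N : ℕ) {X Y : Matrix (Fin d) (Fin d) S}
    (h : E.scaled N X = E.scaled N Y) : X = Y := by
  ext r t
  exact E.inv_mul_map_injective N (congrFun (congrFun h r) t)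

theorem fundMatrix_of_eq_scaled {m : Fin d → I → S} {H : (I → ℂ) → Matrix (Fin d) (Fin d) T}
    {N : ℕ} {ζ : I → ℂ} {X : Matrix (Fin d) (Fin d) S} (h : H (expMap ζ) = E.scaled N X) :
    E.fundMatrix m H ζ = E.scaled N (X * Matrix.diagonal fun r => zPow s m r ζ) := by
  rw [← scaled_mul_map, fundMatrix, h, Matrix.diagonal_map (map_zero E.map)]

variable {R : I → ENNReal} {A : I → (I → ℂ) → Matrix (Fin d) (Fin d) S}
  {a : I → MvPowerSeries I (Matrix (Fin d) (Fin d) S)} {m : Fin d → I → S}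

/-- A convergent solution of the gauge equation over `S` with constant term `ϖ ^ N` becomes a
normalized solution after division by `ϖ ^ N`. -/
theorem isSolution_scaled (hR : ∀ j, 0 < R j) (ha : ∀ j, HasExpM s R (a j) (A j)) {N : ℕ}
    {K : MvPowerSeries I (Matrix (Fin d) (Fin d) S)} {f : (I → ℂ) → Matrix (Fin d) (Fin d) S}
    (hK : HasExpM s R K f) (hK0 : MvPowerSeries.coeff 0 K = powS S N • 1)
    (h : ∀ j, formalConn a m j K = 0) : E.IsSolution R A m fun z => E.scaled N (f z) where
  holomorphic r t u n := by
    simp only [scaled_apply]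
    by_cases hn : n < -N
    · simp only [E.coeff_of_lt u n N _ hn]
      exact differentiableOn_const _
    · obtain ⟨k, rfl⟩ : ∃ k : ℕ, n = k - N := ⟨(n + N).toNat, by omega⟩
      simp only [E.coeff_natCast]
      exact (hK r t u k).differentiableOn
  bounded := ⟨-N, fun z _ r t u n hn => E.coeff_of_lt u n N _ hn⟩
  map_zero := by
    rw [hK.apply_zero hR, hK0, scaled_powS_smul]
    exact Matrix.map_one _ (map_zero _) (map_one _)
  horizontal ζ hζ r t u n := by
    have h0 : ∀ ξ, E.fundMatrix m (fun z => E.scaled N (f z)) ξ =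
        E.scaled N (f (expMap ξ) * Matrix.diagonal fun r => zPow s m r ξ) := fun ξ =>
      E.fundMatrix_of_eq_scaled rfl
    simp only [h0, map_mul_scaled]
    exact (E.hasDlog_iff N).1 (hasDlog_of_formalConn_eq_zero ha hK h hζ r t) u n

/-- Conversely, the product of a normalized solution with a large power of `ϖ` has an expansion over
`S`, which solves the gauge equation. -/
theorem IsSolution.exists_formal {H : (I → ℂ) → Matrix (Fin d) (Fin d) T}
    (hH : E.IsSolution R A m H) (hR : ∀ j, 0 < R j) (ha : ∀ j, HasExpM s R (a j) (A j)) :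
    ∃ N₀, ∀ N ≥ N₀, ∃ (K : MvPowerSeries I (Matrix (Fin d) (Fin d) S))
      (f : (I → ℂ) → Matrix (Fin d) (Fin d) S), HasExpM s R K f ∧
      (∀ z ∈ polydisc R, H z = E.scaled N (f z)) ∧ MvPowerSeries.coeff 0 K = powS S N • 1 ∧
      ∀ j, formalConn a m j K = 0 := by
  obtain ⟨N₁, hN₁⟩ := hH.bounded
  refine ⟨N₁.natAbs, fun N hN => ?_⟩
  have h1 : ∀ z r t, ∃ x, z ∈ polydisc R → H z r t = E.inv N * E.map x := fun z r t => by
    by_cases hz : z ∈ polydisc R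
    · obtain ⟨x, hx⟩ := E.exists_of_coeff N (H z r t) fun u n hn => hN₁ z hz r t u n (by omega)
      exact ⟨x, fun _ => hx⟩
    · exact ⟨0, fun h => absurd h hz⟩
  choose g hg using h1
  set f : (I → ℂ) → Matrix (Fin d) (Fin d) S := fun z => Matrix.of fun r t => g z r t with hf
  have hHf : ∀ z ∈ polydisc R, H z = E.scaled N (f z) := fun z hz => by
    ext r t
    exact hg z r t hz
  have hfA : IsHolomorphicA s (polydisc R) f := fun r t u n =>
    (hH.holomorphic r t u (n - N)).congr fun z hz => by
      rw [hHf z hz, scaled_apply, E.coeff_natCast]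
  obtain ⟨K, hK⟩ := exists_hasExpM hR hfA
  refine ⟨K, f, hK, hHf, ?_, formalConn_eq_zero_of_hasDlog ha hK hR fun ζ hζ r t => ?_⟩
  · refine E.scaled_injective N ?_
    rw [← hK.apply_zero hR, ← hHf 0 (zero_mem_polydisc hR), hH.map_zero, scaled_powS_smul]
    exact (Matrix.map_one _ (_root_.map_zero _) (map_one _)).symm
  · refine (E.hasDlog_iff N).2 fun u n => ?_
    have h2 := hH.horizontal ζ hζ r t u n
    rw [E.fundMatrix_of_eq_scaled (hHf _ hζ)] at h2
    simp only [map_mul_scaled] at h2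
    refine h2.congr_of_eventuallyEq ?_
    filter_upwards [(isOpen_logCover R).mem_nhds hζ] with ξ hξ
    rw [E.fundMatrix_of_eq_scaled (hHf _ hξ), scaled_apply]

/-- Normalized solutions are unique: the difference of two of them has a formal expansion without
constant term that solves the gauge equation. -/
theorem IsSolution.unique (hR : ∀ j, 0 < R j) (ha : ∀ j, HasExpM s R (a j) (A j))
    (hA0 : ∀ j, MvPowerSeries.coeff 0 (a j) = Matrix.diagonal fun r => m r j)
    (hunit : ∀ (j : I) (r t : Fin d) (k : ℕ), k ≠ 0 →
      IsUnit ((k : T) - E.map (m r j) + E.map (m t j)))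
    {H H' : (I → ℂ) → Matrix (Fin d) (Fin d) T} (hH : E.IsSolution R A m H)
    (hH' : E.IsSolution R A m H') : Set.EqOn H H' (polydisc R) := by
  obtain ⟨N, hN⟩ := hH.exists_formal E hR ha
  obtain ⟨N', hN'⟩ := hH'.exists_formal E hR ha
  obtain ⟨K, f, hK, hf, hK0, hKc⟩ := hN (max N N') (le_max_left _ _)
  obtain ⟨K', f', hK', hf', hK0', hKc'⟩ := hN' (max N N') (le_max_right _ _)
  have h1 : K - K' = 0 := by
    refine eq_zero_of_formalConn_eq_zero hA0 (fun j r t k hk x hx => ?_)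
      (by rw [map_sub, hK0, hK0', sub_self]) fun j => ?_
    · refine E.map_injective ((hunit j r t k hk).mul_left_cancel ?_)
      rw [_root_.map_zero, mul_zero, ← map_natCast E.map, ← map_sub, ← map_add, ← map_mul, hx,
        _root_.map_zero]
    · rw [formalConn_sub, hKc, hKc', sub_zero]
  intro z hz
  rw [hf z hz, hf' z hz, hK.eqOn (sub_eq_zero.1 h1 ▸ hK') hz]

end LaurentExtension

end NormalizedSolutions

/-! ### The convergent normal form -/

section UnitriangularInverse

/-- A matrix that is unitriangular for a strict partial order has a unitriangular inverse. -/
theorem exists_unitriangular_inverse {ι T : Type*} [Fintype ι] [DecidableEq ι] [CommRing T]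
    {lt : ι → ι → Prop} (htrans : ∀ {a b c}, lt a b → lt b c → lt a c) (hirrefl : ∀ a, ¬lt a a)
    {Q : Matrix ι ι T} (hQ1 : ∀ r, Q r r = 1) (hQ : ∀ r t, r ≠ t → Q r t ≠ 0 → lt t r) :
    ∃ Q' : Matrix ι ι T, Q * Q' = 1 ∧ (∀ r, Q' r r = 1) ∧ ∀ r t, r ≠ t → Q' r t ≠ 0 → lt t r := by
  classical
  have : IsTrans ι lt := ⟨fun _ _ _ => htrans⟩
  have : Std.Irrefl lt := ⟨hirrefl⟩
  have hwf : WellFounded lt := Finite.wellFounded_of_trans_of_irrefl lt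
  obtain ⟨f, hf⟩ : ∃ f : ι → ι → T, ∀ r t, f r t = (1 : Matrix ι ι T) r t -
      ∑ k, if lt k r then Q r k * f k t else 0 := by
    refine ⟨hwf.fix fun r ih t => (1 : Matrix ι ι T) r t -
      ∑ k, if h : lt k r then Q r k * ih k h t else 0, fun r t => ?_⟩
    rw [WellFounded.fix_eq]
    congr 1
  have hsupp : ∀ r t, r ≠ t → f r t ≠ 0 → lt t r := fun r => by
    induction r using hwf.induction with
    | _ r ih =>
      intro t hrt h0
      rw [hf, Matrix.one_apply_ne hrt, zero_sub, neg_ne_zero] at h0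
      obtain ⟨k, _, hk⟩ := Finset.exists_ne_zero_of_sum_ne_zero h0
      split_ifs at hk with hkr
      · by_cases hkt : k = t
        · rwa [← hkt]
        · exact htrans (ih k hkr t hkt (right_ne_zero_of_mul hk)) hkr
      · exact absurd rfl hk
  refine ⟨Matrix.of f, ?_, fun r => ?_, fun r t => hsupp r t⟩
  · ext r t
    rw [Matrix.mul_apply, ← Finset.add_sum_erase _ _ (Finset.mem_univ r), hQ1, one_mul,
      Matrix.of_apply, hf, sub_add_eq_add_sub, sub_eq_iff_eq_add,
      ← Finset.add_sum_erase _ _ (Finset.mem_univ r), if_neg (hirrefl r), zero_add]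
    congr 1
    refine Finset.sum_congr rfl fun k hk => ?_
    split_ifs with h
    · rfl
    · rw [by_contra fun h0 => h (hQ r k (Finset.ne_of_mem_erase hk).symm h0), zero_mul]
  · rw [Matrix.of_apply, hf, Matrix.one_apply_eq, sub_eq_self]
    refine Finset.sum_eq_zero fun k _ => ?_
    split_ifs with h
    · have hkr : k ≠ r := fun hkr => hirrefl r (hkr ▸ h)
      rw [by_contra fun h0 => hirrefl r (htrans (hsupp k r hkr h0) h), mul_zero]
    · rfl

end UnitriangularInverse

section NormalForm

variable {I : Type*} [Fintype I] {S : Type*} [CommRing S] [Algebra ℂ⟦X⟧ S]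
  {d e : ℕ} {s : Module.Basis (Fin e) ℂ⟦X⟧ S} {T : Type*} [CommRing T]
  {κ : Type*} [Field κ] [CharZero κ]

omit [Fintype I] in
theorem finite_isResonant (μ : Fin d → I → κ) : {α | ∃ r t, IsResonant μ α r t}.Finite := by
  have h : {α | ∃ r t, IsResonant μ α r t} = ⋃ r, ⋃ t, {α | IsResonant μ α r t} := by
    ext α
    simp
  rw [h]
  exact Set.finite_iUnion fun r => Set.finite_iUnion fun t =>
    Set.Subsingleton.finite fun α hα β hβ => IsResonant.unique hα hβ

omit [Fintype I] in
theorem ResSupported.finite {μ : Fin d → I → κ} {X : MvPowerSeries I (Matrix (Fin d) (Fin d) T)}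
    (hX : ResSupported μ X) : {α | MvPowerSeries.coeff α X ≠ 0}.Finite := by
  refine (finite_isResonant μ).subset fun α hα => ?_
  by_contra h
  refine hα (Matrix.ext fun r t => hX α r t fun h' => h ⟨r, t, h'⟩)

omit [Fintype I] in
/-- A resonant series over `S_F` has a common denominator. -/
theorem ResSupported.exists_denominator (E : LaurentExtension s T) {μ : Fin d → I → κ}
    {Z : MvPowerSeries I (Matrix (Fin d) (Fin d) T)} (hZ : ResSupported μ Z) :
    ∃ (N : ℕ) (Z' : MvPowerSeries I (Matrix (Fin d) (Fin d) S)), ResSupported μ Z' ∧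
      MvPowerSeries.map E.map.mapMatrix Z' = E.map (powS S N) • Z := by
  classical
  have := (finite_isResonant μ).to_subtype
  obtain ⟨N, x, hx⟩ := E.exists_common_denominator
    (fun i : {α | ∃ r t, IsResonant μ α r t} × Fin d × Fin d =>
      MvPowerSeries.coeff i.1.1 Z i.2.1 i.2.2)
  obtain ⟨Z', hZ'⟩ : ∃ Z' : MvPowerSeries I (Matrix (Fin d) (Fin d) S),
      ∀ α r t, MvPowerSeries.coeff α Z' r t =
        if h : IsResonant μ α r t then x ⟨⟨α, r, t, h⟩, r, t⟩ else 0 :=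
    ⟨fun α => Matrix.of fun r t => if h : IsResonant μ α r t then x ⟨⟨α, r, t, h⟩, r, t⟩ else 0,
      fun _ _ _ => rfl⟩
  refine ⟨N, Z', fun α r t h => by rw [hZ', dif_neg h], ?_⟩
  ext α r t
  have h1 : MvPowerSeries.coeff α (E.map (powS S N) • Z) r t =
      E.map (powS S N) * MvPowerSeries.coeff α Z r t := rfl
  rw [h1, MvPowerSeries.coeff_map, RingHom.mapMatrix_apply, Matrix.map_apply, hZ']
  split_ifs with h
  · have := hx ⟨⟨α, r, t, h⟩, r, t⟩
    simp only at this
    rw [this, ← mul_assoc, mul_comm (E.map _), E.inv_mul_map_powS, one_mul]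
  · rw [hZ α r t h, map_zero, mul_zero]

/-- The analytic normal form: over `S`, an invertible convergent gauge transformation `P` followed
by a resonant polynomial matrix `Z` with constant term `ϖ ^ N`. -/
theorem exists_convergent_solution [DecidableEq I] {R : I → ENNReal} (E : LaurentExtension s T)
    (μ : Fin d → I → κ) {a : I → MvPowerSeries I (Matrix (Fin d) (Fin d) S)} {m : Fin d → I → S}
    (hconv : ∀ j, IsConvergent s R (a j))
    (hA : ∀ j, MvPowerSeries.coeff 0 (a j) = Matrix.diagonal fun r => m r j)
    (hflat : ∀ i j, euler i (a j) - euler j (a i) = a i * a j - a j * a i)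
    (hunit : ∀ (j : I) (r t : Fin d) (k : ℕ), k ≠ 0 →
      IsUnit ((k : T) - E.map (m r j) + E.map (m t j)))
    (hunitS : ∀ (α : I →₀ ℕ) (r t : Fin d), ¬IsResonant μ α r t →
      ∃ j, IsUnit ((α j : S) - m r j + m t j)) :
    ∃ (N : ℕ) (P P' Z : MvPowerSeries I (Matrix (Fin d) (Fin d) S)),
      IsConvergent s R P ∧ IsConvergent s R P' ∧ P * P' = 1 ∧ MvPowerSeries.coeff 0 P = 1 ∧
      IsConvergent s R Z ∧ ResSupported μ Z ∧ MvPowerSeries.coeff 0 Z = powS S N • 1 ∧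
      ∀ j, formalConn a m j (P * Z) = 0 := by
  obtain ⟨P, B, Z, hP0, hP, hB, hZ0, hZ, hPZ⟩ :=
    exists_normal_form μ E.map_injective hA hflat hunit hunitS
  obtain ⟨N, Z', hZ', hmap⟩ := hZ.exists_denominator E
  have hBc : ∀ j, IsConvergent s R (B j) := fun j => isConvergent_of_finite (hB j).finite
  have hPP : P * P.invOfUnit 1 = 1 := MvPowerSeries.mul_invOfUnit P 1 hP0
  have hPP' : P.invOfUnit 1 * P = 1 := MvPowerSeries.invOfUnit_mul P 1 hP0
  refine ⟨N, P, P.invOfUnit 1, Z', isConvergent_of_euler hconv hBc hP,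
    isConvergent_of_euler hBc hconv fun j => ?_, hPP, hP0, isConvergent_of_finite hZ'.finite, hZ',
    ?_, fun j => ?_⟩
  · have h1 := congrArg (euler j) hPP
    rw [euler_mul, euler_one, hP j] at h1
    have h2 := congrArg (P.invOfUnit 1 * ·) h1
    simp only [mul_add, sub_mul, mul_sub, ← mul_assoc, hPP', one_mul, mul_zero] at h2
    rw [mul_assoc _ P, hPP, mul_one] at h2
    rw [← sub_eq_zero, ← h2]
    abel
  · ext r t
    refine E.map_injective ?_
    have h1 := congrArg
      (fun W : MvPowerSeries I (Matrix (Fin d) (Fin d) T) => MvPowerSeries.coeff 0 W r t) hmap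
    have h2 : MvPowerSeries.coeff 0 (E.map (powS S N) • Z) r t =
      E.map (powS S N) * MvPowerSeries.coeff 0 Z r t := rfl
    simp only [h2, hZ0, MvPowerSeries.coeff_map, RingHom.mapMatrix_apply, Matrix.map_apply] at h1
    rw [h1, Matrix.smul_apply, smul_eq_mul, map_mul, Matrix.one_apply, Matrix.one_apply]
    split_ifs <;> simp
  · refine map_mapMatrix_injective E.map_injective ?_
    rw [← formalConn_map, map_mul, hmap, mul_smul_comm, formalConn_smul, hPZ, smul_zero, map_zero]

end NormalForm

/-! ### Horizontal matrices and bases of horizontal sections -/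

section HorizontalBasis

variable {I : Type*} [Fintype I] {R : I → ENNReal} {S : Type*} [CommRing S] [Algebra ℂ⟦X⟧ S]
  {d e : ℕ} {s : Module.Basis (Fin e) ℂ⟦X⟧ S} {A : I → (I → ℂ) → Matrix (Fin d) (Fin d) S}

theorem HasDlog.congr_of_isOpen {U : Set (I → ℂ)} (hU : IsOpen U) {f g : (I → ℂ) → S} {f' : I → S}
    {ζ : I → ℂ} (hf : HasDlog s f f' ζ) (hζ : ζ ∈ U) (hfg : ∀ ξ ∈ U, g ξ = f ξ) :
    HasDlog s g f' ζ := fun u n => (hf u n).congr_of_eventuallyEq <| by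
  filter_upwards [hU.mem_nhds hζ] with ξ hξ
  rw [hfg ξ hξ]

theorem HasDlog.mul_const {f : (I → ℂ) → S} {f' : I → S} {ζ : I → ℂ} (hf : HasDlog s f f' ζ)
    (x : S) : HasDlog s (fun ξ => f ξ * x) (fun j => f' j * x) ζ :=
  (hf.mul (hasDlog_const x ζ)).congr_deriv fun j => by simp

/-- Multiplying a horizontal matrix by a constant matrix on the right keeps it horizontal. -/
theorem hasDlog_mul_const {W : (I → ℂ) → Matrix (Fin d) (Fin d) S} {ζ : I → ℂ}
    (hW : ∀ r t, HasDlog s (fun ξ => W ξ r t) (fun j => (A j (expMap ζ) * W ζ) r t) ζ)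
    (X : Matrix (Fin d) (Fin d) S) (r t : Fin d) :
    HasDlog s (fun ξ => (W ξ * X) r t) (fun j => (A j (expMap ζ) * (W ζ * X)) r t) ζ := by
  have h1 : ∀ Y : Matrix (Fin d) (Fin d) S, (Y * X) r t = ∑ k, Y r k * X k t := fun _ =>
    Matrix.mul_apply
  simp only [← mul_assoc, h1]
  exact HasDlog.sum fun k _ => (hW r k).mul_const _

theorem hasDlog_mulVec_const {W : (I → ℂ) → Matrix (Fin d) (Fin d) S} {ζ : I → ℂ}
    (hW : ∀ r t, HasDlog s (fun ξ => W ξ r t) (fun j => (A j (expMap ζ) * W ζ) r t) ζ)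
    (v : Fin d → S) (r : Fin d) :
    HasDlog s (fun ξ => (W ξ).mulVec v r) (fun j => (A j (expMap ζ)).mulVec ((W ζ).mulVec v) r)
      ζ := by
  simp only [Matrix.mulVec_mulVec]
  simp only [Matrix.mulVec, dotProduct]
  exact HasDlog.sum fun k _ => (hW r k).mul_const _

/-- A horizontal section is determined by its value at one point. -/
theorem eq_zero_of_horizontal (hA : ∀ j, IsHolomorphicA s (polydisc R) (A j))
    (g : horizontalSections s R A) {ζ₀ : I → ℂ} (hζ₀ : ζ₀ ∈ logCover R) (h0 : g.1 ζ₀ = 0) :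
    g = 0 := by
  refine Subtype.ext (funext fun ζ => ?_)
  by_cases hζ : ζ ∈ logCover R
  · funext r
    refine coeffA_ext s fun u n => ?_
    rw [coeffA_eq_zero_of_horizontal hA (fun ζ hζ r u n => g.2.2 ζ hζ r u n) hζ₀ (n := n)
      (fun r u k _ => by rw [h0, Pi.zero_apply, coeffA_zero]) hζ r u n le_rfl]
    exact (coeffA_zero s u n).symm
  · exact g.2.1 ζ hζ

/-- A horizontal matrix that is invertible at one point gives a basis of the module of horizontal
sections. -/
theorem exists_basis_horizontalSections (hA : ∀ j, IsHolomorphicA s (polydisc R) (A j))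
    {W : (I → ℂ) → Matrix (Fin d) (Fin d) S}
    (hW : ∀ ζ ∈ logCover R, ∀ r t,
      HasDlog s (fun ξ => W ξ r t) (fun j => (A j (expMap ζ) * W ζ) r t) ζ)
    {ζ₀ : I → ℂ} (hζ₀ : ζ₀ ∈ logCover R) {Y : Matrix (Fin d) (Fin d) S} (hY : W ζ₀ * Y = 1) :
    ∃ b : Module.Basis (Fin d × Fin e) ℂ⟦X⟧ (horizontalSections s R A),
      ∀ r u, ∀ ζ ∈ logCover R, ∀ i, (b (r, u)).1 ζ i = W ζ i r * s u := by
  classical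
  let Φ : (Fin d → S) →ₗ[ℂ⟦X⟧] horizontalSections s R A :=
    { toFun := fun v => ⟨fun ζ => if ζ ∈ logCover R then (W ζ).mulVec v else 0,
        fun ζ hζ => if_neg hζ, fun ζ hζ r u n => by
          have h := (hasDlog_mulVec_const (hW ζ hζ) v r).congr_of_isOpen (isOpen_logCover R) hζ
            (g := fun ξ => (if ξ ∈ logCover R then (W ξ).mulVec v else 0) r)
            fun ξ hξ => by rw [if_pos hξ]
          simpa only [if_pos hζ] using h u n⟩
      map_add' := fun v w => Subtype.ext <| funext fun ζ => by
        by_cases hζ : ζ ∈ logCover R <;> simp [hζ, Matrix.mulVec_add]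
      map_smul' := fun p v => Subtype.ext <| funext fun ζ => by
        by_cases hζ : ζ ∈ logCover R <;> simp [hζ, Matrix.mulVec_smul] }
  have hΦ : ∀ v, ∀ ζ ∈ logCover R, (Φ v).1 ζ = (W ζ).mulVec v := fun v ζ hζ => if_pos hζ
  have hY' : Y * W ζ₀ = 1 := mul_eq_one_comm.1 hY
  have hbij : Function.Bijective Φ := by
    constructor
    · rw [← LinearMap.ker_eq_bot, LinearMap.ker_eq_bot']
      intro v hv
      have h1 := hΦ v ζ₀ hζ₀
      rw [hv] at h1
      rw [← Matrix.one_mulVec v, ← hY', ← Matrix.mulVec_mulVec, ← h1]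
      exact Matrix.mulVec_zero _
    · intro g
      refine ⟨Y.mulVec (g.1 ζ₀), ?_⟩
      rw [← sub_eq_zero]
      refine eq_zero_of_horizontal hA _ hζ₀ ?_
      change (Φ _).1 ζ₀ - g.1 ζ₀ = 0
      rw [hΦ _ ζ₀ hζ₀, Matrix.mulVec_mulVec, hY, Matrix.one_mulVec, sub_self]
  refine ⟨((Pi.basis fun _ : Fin d => s).reindex (Equiv.sigmaEquivProd _ _)).map
    (LinearEquiv.ofBijective Φ hbij), fun r u ζ hζ i => ?_⟩
  rw [Module.Basis.map_apply, Module.Basis.reindex_apply, LinearEquiv.ofBijective_apply, hΦ _ ζ hζ]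
  simp [Pi.basis_apply, Matrix.mulVec_single]

end HorizontalBasis

section Assembly

variable {I : Type*} [Fintype I] [DecidableEq I] {R : I → ENNReal} {S : Type*} [CommRing S]
  [Algebra ℂ⟦X⟧ S] {d e : ℕ} {s : Module.Basis (Fin e) ℂ⟦X⟧ S} {T : Type*} [CommRing T]
  {A : I → (I → ℂ) → Matrix (Fin d) (Fin d) S}

omit [DecidableEq I] in
/-- A horizontal matrix that is divisible by `ϖ ^ N` at one point is divisible by `ϖ ^ N`
everywhere, and the quotient is horizontal. -/
theorem exists_horizontal_quotient (hA : ∀ j, IsHolomorphicA s (polydisc R) (A j)) (N : ℕ)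
    {B : (I → ℂ) → Matrix (Fin d) (Fin d) S}
    (hB : ∀ ζ ∈ logCover R, ∀ r t,
      HasDlog s (fun ξ => B ξ r t) (fun j => (A j (expMap ζ) * B ζ) r t) ζ)
    {ζ₀ : I → ℂ} (hζ₀ : ζ₀ ∈ logCover R) {Y : Matrix (Fin d) (Fin d) S}
    (hY : B ζ₀ = powS S N • Y) :
    ∃ W : (I → ℂ) → Matrix (Fin d) (Fin d) S, W ζ₀ = Y ∧
      (∀ ζ ∈ logCover R, B ζ = powS S N • W ζ) ∧
      ∀ ζ ∈ logCover R, ∀ r t,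
        HasDlog s (fun ξ => W ξ r t) (fun j => (A j (expMap ζ) * W ζ) r t) ζ := by
  have hBW : ∀ ζ ∈ logCover R, B ζ = powS S N • (B ζ).map (divS s N) := fun ζ hζ => by
    ext r t
    rw [Matrix.smul_apply, Matrix.map_apply, smul_eq_mul, powS_mul_divS]
    intro u k hk
    refine coeffA_eq_zero_of_horizontal hA (g := fun ζ r => B ζ r t) (fun ζ hζ r => hB ζ hζ r t)
      hζ₀ (n := N - 1) (fun r u k hk' => ?_) hζ r u k (by omega)
    rw [hY, Matrix.smul_apply, smul_eq_mul, coeffA_powS_mul, if_neg (by omega)]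
  refine ⟨fun ζ => (B ζ).map (divS s N), ?_, hBW, fun ζ hζ r t u n => ?_⟩
  · beta_reduce
    ext r t
    rw [hY, Matrix.map_apply, Matrix.smul_apply, smul_eq_mul, divS_powS_mul]
  · have h := hB ζ hζ r t u (n + N)
    have h1 : ∀ j, coeffA s u (n + N) ((A j (expMap ζ) * B ζ) r t) =
        coeffA s u n ((A j (expMap ζ) * (B ζ).map (divS s N)) r t) := fun j => by
      conv_lhs => rw [hBW ζ hζ, mul_smul_comm, Matrix.smul_apply, smul_eq_mul, coeffA_powS_mul,
        if_pos (Nat.le_add_left _ _), Nat.add_sub_cancel]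
    simp only [h1] at h
    simpa only [Matrix.map_apply, divS, coeffA_ofCoeffs] using h

/-- The values of a resonant series with constant term a scalar matrix are triangular. -/
theorem evalM_resonant {κ : Type*} [Field κ] [CharZero κ] {μ : Fin d → I → κ}
    {Z : MvPowerSeries I (Matrix (Fin d) (Fin d) S)} (hZ : ResSupported μ Z)
    (hc : IsConvergent s R Z) {x : S} (hZ0 : MvPowerSeries.coeff 0 Z = x • 1) {z : I → ℂ}
    (hz : z ∈ polydisc R) : (∀ r, evalM s Z z r r = x) ∧
      ∀ r t, r ≠ t → evalM s Z z r t ≠ 0 → ∃ α ≠ 0, IsResonant μ α r t := by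
  have h : ∀ (X : Matrix (Fin d) (Fin d) S) r t,
      entrySeries r t Z = entrySeries r t (MvPowerSeries.C X) → evalM s Z z r t = X r t :=
    fun X r t h => ((hc.hasExpM r t).eqOn (h ▸ hasExpM_C X r t) hz :)
  constructor
  · intro r
    have h1 := h (x • 1) r r (by
      ext α
      rw [coeff_entrySeries, coeff_entrySeries, MvPowerSeries.coeff_C]
      split_ifs with hα
      · rw [hα, hZ0]
      · exact hZ α r r fun h' => hα (h'.unique (isResonant_zero μ r)))
    rw [h1, Matrix.smul_apply, Matrix.one_apply_eq, smul_eq_mul, mul_one]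
  · intro r t hrt
    contrapose!
    intro hα
    refine h 0 r t ?_
    ext α
    rw [coeff_entrySeries, coeff_entrySeries, map_zero, map_zero, Matrix.zero_apply]
    by_cases h0 : α = 0
    · rw [h0, hZ0, Matrix.smul_apply, Matrix.one_apply_ne hrt, smul_zero]
    · exact hZ α r t (hα α h0)

end Assembly

/-! ### The adapted basis -/

section Main

variable {I : Type*} [Fintype I] [DecidableEq I] {R : I → ENNReal} {S : Type*} [CommRing S]
  [Algebra ℂ⟦X⟧ S] {d e : ℕ} {s : Module.Basis (Fin e) ℂ⟦X⟧ S} [IsLocalRing (SpecialFibre S)]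

omit [Fintype I] [DecidableEq I] in
theorem ExponentLT.trans {m : Fin d → I → S} {r t k : Fin d} (h : ExponentLT m r t)
    (h' : ExponentLT m t k) : ExponentLT m r k := by
  obtain ⟨β, h0, hβ⟩ := h
  obtain ⟨γ, _, hγ⟩ := h'
  refine ⟨β + γ, fun h => h0 ?_, fun j => ?_⟩
  · funext j
    have := congrFun h j
    simp only [Pi.add_apply, Pi.zero_apply] at this ⊢
    omega
  · rw [Pi.add_apply, Nat.cast_add, ← hβ, ← hγ]
    ring

omit [Fintype I] [DecidableEq I] in
theorem ExponentLT.irrefl (m : Fin d → I → S) (r : Fin d) : ¬ExponentLT m r r := by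
  rintro ⟨β, h0, hβ⟩
  have := charZero_residueField (S := S)
  refine h0 (funext fun j => ?_)
  have := hβ j
  rw [sub_self] at this
  exact_mod_cast this.symm

variable {T : Type*} [CommRing T] (E : LaurentExtension s T)
  {A : I → (I → ℂ) → Matrix (Fin d) (Fin d) S}

/-- The normalized solution and the adapted basis, over an abstract Laurent extension: the basis is
given by the columns of `H z ^ {A_0} M` for a constant matrix `M` that is unitriangular for the
order on the exponents. -/
theorem exists_solution_and_basis (hR : ∀ j, 0 < R j)
    (hA : ∀ j, IsHolomorphicA s (polydisc R) (A j)) (hflat : IsIntegrable s (polydisc R) A)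
    {m : Fin d → I → S} (hA0 : ∀ j, A j 0 = Matrix.diagonal fun r => m r j)
    (hunit : ∀ (j : I) (r t : Fin d) (k : ℕ), k ≠ 0 →
      IsUnit ((k : T) - E.map (m r j) + E.map (m t j))) :
    ∃ H, E.IsSolution R A m H ∧ (∀ H', E.IsSolution R A m H' → Set.EqOn H' H (polydisc R)) ∧
      ∃ (b : Module.Basis (Fin d × Fin e) ℂ⟦X⟧ (horizontalSections s R A))
        (M : Matrix (Fin d) (Fin d) T),
        (∀ r, M r r = 1) ∧ (∀ t r, t ≠ r → M t r ≠ 0 → ExponentLT m r t) ∧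
        ∀ r u, ∀ ζ ∈ logCover R, ∀ i,
          E.map ((b (r, u)).1 ζ i) = (E.fundMatrix m H ζ * M) i r * E.map (s u) := by
  classical
  have := charZero_residueField (S := S)
  have : Module.Finite ℂ⟦X⟧ S := Module.Finite.of_basis s
  choose a ha using fun j => exists_hasExpM hR (hA j)
  have ha0 : ∀ j, MvPowerSeries.coeff 0 (a j) = Matrix.diagonal fun r => m r j := fun j => by
    rw [← (ha j).apply_zero hR, hA0]
  set μ : Fin d → I → IsLocalRing.ResidueField (SpecialFibre S) := fun r j => residueMap S (m r j)
    with hμ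
  -- `S` is local, so an exponent difference that does not vanish in the residue field is invertible
  have hunitS : ∀ (α : I →₀ ℕ) (r t : Fin d), ¬IsResonant μ α r t →
      ∃ j, IsUnit ((α j : S) - m r j + m t j) := fun α r t h => by
    obtain ⟨j, hj⟩ := not_forall.1 h
    refine ⟨j, isUnit_of_residueMap_ne_zero fun h0 => hj ?_⟩
    rw [map_add, map_sub, map_natCast] at h0
    simp only [hμ]
    linear_combination -h0
  have hLT : ∀ {α : I →₀ ℕ} {r t : Fin d}, α ≠ 0 → IsResonant μ α r t → ExponentLT m t r :=
    fun {α r t} hα h => ⟨α, fun h0 => hα (Finsupp.ext fun j => congrFun h0 j), h⟩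
  obtain ⟨N, P, P', Z, hP, hP', hPP', hP0, hZ, hZr, hZ0, hPZ⟩ := exists_convergent_solution E μ
    (fun j => (ha j).isConvergent) ha0 (flat_of_isIntegrable hR hflat ha) hunit hunitS
  set f : (I → ℂ) → Matrix (Fin d) (Fin d) S := fun z => evalM s P z * evalM s Z z with hf
  have hK : HasExpM s R (P * Z) f := hP.hasExpM.mul hZ.hasExpM
  have hH := E.isSolution_scaled (m := m) hR ha hK
    (by rw [coeff_zero_mul_eq, hP0, hZ0, one_mul]) hPZ
  refine ⟨_, hH, fun H' hH' => hH'.unique E hR ha ha0 hunit hH, ?_⟩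
  obtain ⟨ζ₀, hζ₀⟩ := nonempty_logCover hR
  -- the value of the resonant factor at the base point is unitriangular
  obtain ⟨hQ1, hQ⟩ := evalM_resonant hZr hZ hZ0 hζ₀
  set Q := E.scaled N (evalM s Z (expMap ζ₀)) with hQdef
  obtain ⟨Q', hQQ', hQ'1, hQ'⟩ := exists_unitriangular_inverse (lt := ExponentLT m)
    (fun h h' => h.trans h') (ExponentLT.irrefl m) (Q := Q)
    (fun r => by rw [hQdef, E.scaled_apply, hQ1, E.inv_mul_map_powS]) fun r t hrt h => by
      obtain ⟨α, hα, h'⟩ := hQ r t hrt fun h0 => h (by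
        rw [hQdef, E.scaled_apply, h0, map_zero, mul_zero])
      exact hLT hα h'
  set D : Matrix (Fin d) (Fin d) S := Matrix.diagonal fun t => zPow s m t ζ₀ with hD
  set D' : Matrix (Fin d) (Fin d) S := Matrix.diagonal fun t => zPow s (-m) t ζ₀ with hD'
  have hDD' : D * D' = 1 := diagonal_zPow_mul_neg m ζ₀
  have hz : ∀ t, E.map (zPow s (-m) t ζ₀) * E.map (zPow s m t ζ₀) = 1 := fun t => by
    rw [← map_mul, mul_comm, zPow_mul_zPow_neg, map_one]
  set M : Matrix (Fin d) (Fin d) T := D'.map E.map * Q' * D.map E.map with hM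
  have hMapply : ∀ t r, M t r =
      E.map (zPow s (-m) t ζ₀) * Q' t r * E.map (zPow s m r ζ₀) := fun t r => by
    rw [hM, hD, hD', Matrix.diagonal_map (map_zero _), Matrix.diagonal_map (map_zero _),
      Matrix.mul_diagonal, Matrix.diagonal_mul]
  -- a common denominator for the entries of `M`
  obtain ⟨N', MS, hMS⟩ : ∃ N' MS, M = E.scaled N' MS := by
    obtain ⟨N', x, hx⟩ := E.exists_common_denominator fun i : Fin d × Fin d => M i.1 i.2
    exact ⟨N', Matrix.of fun r t => x (r, t), Matrix.ext fun r t => hx (r, t)⟩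
  have hGS := fun (ζ : I → ℂ) => hasDlog_of_formalConn_eq_zero (m := m) ha hK hPZ (ζ := ζ)
  set G : (I → ℂ) → Matrix (Fin d) (Fin d) S := fun ζ =>
    f (expMap ζ) * Matrix.diagonal fun t => zPow s m t ζ with hG
  have hfund : ∀ ζ, E.fundMatrix m (fun z => E.scaled N (f z)) ζ = E.scaled N (G ζ) := fun ζ =>
    E.fundMatrix_of_eq_scaled rfl
  have hBS : ∀ ζ, E.fundMatrix m (fun z => E.scaled N (f z)) ζ * M =
      E.scaled (N + N') (G ζ * MS) := fun ζ => by rw [hfund, hMS, E.scaled_mul_scaled]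
  -- at the base point the product is defined over `S` and invertible there
  have hbase : G ζ₀ * MS = powS S (N + N') • (evalM s P (expMap ζ₀) * D) := by
    refine E.scaled_injective (N + N') ?_
    rw [← hBS, hfund, E.scaled_powS_smul, hM]
    have h1 : E.scaled N (G ζ₀) = (evalM s P (expMap ζ₀)).map E.map * Q * D.map E.map := by
      rw [hQdef, E.map_mul_scaled, E.scaled_mul_map]
    have h2 : D.map E.map * D'.map E.map = 1 := by
      rw [← Matrix.map_mul, hDD', Matrix.map_one _ (map_zero _) (map_one _)]
    rw [h1, Matrix.map_mul]
    calc _ = (evalM s P (expMap ζ₀)).map E.map * Q * (D.map E.map * D'.map E.map) * Q' *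
          D.map E.map := by simp only [mul_assoc]
      _ = (evalM s P (expMap ζ₀)).map E.map * (Q * Q') * D.map E.map := by
          rw [h2, mul_one, mul_assoc _ Q]
      _ = _ := by rw [hQQ', mul_one]
  obtain ⟨W, hW0, hBW, hW⟩ := exists_horizontal_quotient hA (N + N')
    (fun ζ hζ => hasDlog_mul_const (hGS ζ hζ) MS) hζ₀ hbase
  have hinv : evalM s P (expMap ζ₀) * evalM s P' (expMap ζ₀) = 1 :=
    (hP.hasExpM.mul hP'.hasExpM).eqOn (C := fun _ => 1) (by rw [hPP']; exact hasExpM_C 1) hζ₀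
  obtain ⟨b, hb⟩ := exists_basis_horizontalSections hA hW hζ₀
    (Y := D' * evalM s P' (expMap ζ₀)) (by
      rw [hW0, mul_assoc, ← mul_assoc D, hDD', one_mul, hinv])
  refine ⟨b, M, fun r => ?_, fun t r htr h => ?_, fun r u ζ hζ i => ?_⟩
  · rw [hMapply, hQ'1, mul_one, hz]
  · refine hQ' t r htr fun h0 => h ?_
    rw [hMapply, h0, mul_zero, zero_mul]
  · rw [hb r u ζ hζ i, map_mul, hBS, hBW ζ hζ, E.scaled_powS_smul, Matrix.map_apply]

end Main

section Coordinates

variable {I : Type*} [Fintype I] {S : Type*} [CommRing S] [Algebra ℂ⟦X⟧ S] {d e : ℕ}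
  (s : Module.Basis (Fin e) ℂ⟦X⟧ S)

theorem sum_repr_smul_toGeneric (y : GenericFibre S) :
    ∑ v, (s.baseChange ℂ⸨X⸩).repr y v • toGeneric S (s v) = y := by
  conv_rhs => rw [← (s.baseChange ℂ⸨X⸩).sum_repr y]
  refine Finset.sum_congr rfl fun v _ => ?_
  rw [Module.Basis.baseChange_apply]
  rfl

/-- The coordinates of an element of `S_F` in the basis of the images of `s`. -/
theorem exists_coordinates (y : GenericFibre S) : ∃ c : Fin e → ℂ⸨X⸩, (y = 0 → c = 0) ∧
    ∑ v, c v • toGeneric S (s v) = y :=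
  ⟨fun v => (s.baseChange ℂ⸨X⸩).repr y v, fun h => by rw [h, map_zero]; rfl,
    sum_repr_smul_toGeneric s y⟩

theorem fundamentalSection_apply (m : Fin d → I → S)
    (H : (I → ℂ) → Matrix (Fin d) (Fin d) (GenericFibre S)) (r : Fin d) (u : Fin e)
    (ζ : I → ℂ) (i : Fin d) : fundamentalSection s m H r u ζ i =
      fundamentalMatrix s m H ζ i r * toGeneric S (s u) := by
  simp [fundamentalSection, Matrix.mulVec_single]

/-- A combination of the columns of `G`, whose coefficients other than the `r`-th are expanded in the
family `σ`. The scalars need not form a ring: only the two properties `hsmul`, `hzero` matter. -/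
theorem mul_apply_mul_eq_sum {ι κ F T : Type*} [Fintype ι] [DecidableEq ι] [Fintype κ] [CommRing T]
    [Zero F] [SMul F T] (hsmul : ∀ (c : F) (x y : T), c • (x * y) = x * (c • y))
    (hzero : ∀ x : T, (0 : F) • x = 0) (G M : Matrix ι ι T) {r : ι} (hM : M r r = 1) (i : ι)
    (σ : κ → T) (y : T) (c : ι → κ → F) (hr : ∀ v, c r v = 0)
    (hc : ∀ t, t ≠ r → ∑ v, c t v • σ v = M t r * y) :
    (G * M) i r * y = G i r * y + ∑ t, ∑ v, c t v • (G i t * σ v) := by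
  have h1 : ∀ t, ∑ v, c t v • (G i t * σ v) = if t = r then 0 else G i t * (M t r * y) := by
    intro t
    split_ifs with h
    · exact Finset.sum_eq_zero fun v _ => by rw [h, hr, hzero]
    · rw [← hc t h, Finset.mul_sum]
      exact Finset.sum_congr rfl fun v _ => hsmul _ _ _
  simp only [h1]
  rw [Matrix.mul_apply, Finset.sum_mul, ← Finset.add_sum_erase _ _ (Finset.mem_univ r)]
  congr 1
  · rw [hM, mul_one]
  · rw [← Finset.add_sum_erase _ _ (Finset.mem_univ r), if_pos rfl, zero_add]
    refine Finset.sum_congr rfl fun t ht => ?_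
    rw [if_neg (Finset.ne_of_mem_erase ht), mul_assoc]

theorem sum_fundamentalSection_apply (m : Fin d → I → S)
    (H : (I → ℂ) → Matrix (Fin d) (Fin d) (GenericFibre S)) (r : Fin d) (u : Fin e)
    (ζ : I → ℂ) (i : Fin d) (c : Fin d → Fin e → ℂ⸨X⸩) :
    (fundamentalSection s m H r u ζ + ∑ t, ∑ v, c t v • fundamentalSection s m H t v ζ) i =
      fundamentalMatrix s m H ζ i r * toGeneric S (s u) +
        ∑ t, ∑ v, c t v • (fundamentalMatrix s m H ζ i t * toGeneric S (s v)) := by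
  rw [Pi.add_apply, Finset.sum_apply, fundamentalSection_apply]
  simp only [Finset.sum_apply, Pi.smul_apply, fundamentalSection_apply]

end Coordinates

end

end FormalConnection

open FormalConnection PowerSeries LaurentSeries in
theorem proposition7p1 {I : Type*} [Fintype I] [DecidableEq I]
    (R : I → ENNReal) (hR : ∀ j, 0 < R j)
    {S : Type*} [CommRing S] [Algebra ℂ⟦X⟧ S] {d e : ℕ}
    (s : Module.Basis (Fin e) ℂ⟦X⟧ S) [IsLocalRing (SpecialFibre S)]
    (A : I → (I → ℂ) → Matrix (Fin d) (Fin d) S)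
    (hA : ∀ j, IsHolomorphicA s (polydisc R) (A j))
    (hflat : IsIntegrable s (polydisc R) A)
    (m : Fin d → I → S)
    (hA0 : ∀ j, A j 0 = Matrix.diagonal fun r => m r j)
    (hm : ∀ (j : I) (r t : Fin d) (k : ℤ), k ≠ 0 →
      IsUnit ((k : GenericFibre S) + toGeneric S (m r j) - toGeneric S (m t j))) :
    ∃ H : (I → ℂ) → Matrix (Fin d) (Fin d) (GenericFibre S),
      IsNormalizedSolution s R A m H ∧
      (∀ H', IsNormalizedSolution s R A m H' → Set.EqOn H' H (polydisc R)) ∧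
      ∃ b : Module.Basis (Fin d × Fin e) ℂ⟦X⟧ (horizontalSections s R A),
        ∀ (r : Fin d) (u : Fin e), ∃ x : Fin d → Fin e → ℂ⸨X⸩,
          (∀ t v, x t v ≠ 0 → ExponentLT m r t) ∧
          ∀ ζ ∈ logCover R,
            (fun i => toGeneric S ((b (r, u)).1 ζ i)) =
              fundamentalSection s m H r u ζ +
                ∑ t, ∑ v, x t v • fundamentalSection s m H t v ζ := by
  obtain ⟨H, hH, huniq, b, M, hM1, hM, hb⟩ := exists_solution_and_basis (genericExtension s) hR hA
    hflat hA0 fun j r t k hk => by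
      have h := hm j t r k (by exact_mod_cast hk)
      have h2 : ((k : ℤ) : GenericFibre S) + toGeneric S (m t j) - toGeneric S (m r j) =
        (k : GenericFibre S) - toGeneric S (m r j) + toGeneric S (m t j) := by
        push_cast; ring
      rw [h2] at h
      exact h
  refine ⟨H, ⟨⟨hH.holomorphic, hH.bounded⟩, hH.map_zero, hH.horizontal⟩, fun H' hH' =>
    huniq H' ⟨hH'.holomorphic.1, hH'.holomorphic.2, hH'.map_zero, hH'.horizontal⟩, b,
    fun r u => ?_⟩
  choose c hc0 hc using fun t => exists_coordinates s (M t r * toGeneric S (s u))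
  refine ⟨fun t => if t = r then 0 else c t, fun t v h => ?_, fun ζ hζ => funext fun i => ?_⟩
  · have htr : t ≠ r := fun htr => h (by simp only [htr, if_true]; rfl)
    refine hM t r htr fun h0 => h ?_
    simp only [if_neg htr, hc0 t (by rw [h0]; exact zero_mul _)]
    rfl
  · refine ((hb r u ζ hζ i).trans ?_).trans
      (sum_fundamentalSection_apply s m H r u ζ i (fun t => if t = r then 0 else c t)).symm
    refine mul_apply_mul_eq_sum (fun (c : ℂ⸨X⸩) x y => (mul_smul_comm c x y).symm)
      (fun x => zero_smul ℂ⸨X⸩ x) (fundamentalMatrix s m H ζ) M (hM1 r) i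
      (fun v => toGeneric S (s v)) (toGeneric S (s u)) _ (fun v => ?_) fun t ht => ?_
    · simp only [if_true]
      rfl
    · simp only [if_neg ht]
      exact hc t
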